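/- **Conventions.** A $k$-uniform hypergraph on $[n]$ is a finite collection $H$ (repetitions allowed) of $k$-tuples $U\in[n]^k$; $|H|$ counts repetitions. A $k\mathsf{XOR}$ instance on $H$ is given by a sign $b\in\{\pm1\}$ for each hyperedge $U$ of $H$ (each copy has its own sign), and $x\in\{\pm1\}^n$ satisfies the clause $(b,U)$ if $\prod_{i=1}^k x_{U_i}=b$. The assignment $x$ is $(1-\eta)$-satisfying if it satisfies at least $(1-\eta)|H|$ clauses. The random hypergraph $\mathbf H_k(m,n)$ is obtained by including each of the $2^kn^k$ pairs $(c,U)\in\{\pm1\}^k\times[n]^k$ independently with probability $\frac{m}{2^kn^k}$ and then removing the signs $c$. **Theorem.** Let $k\ge 3$ be an integer and $\delta\in(0,k-1)$. There are constants $C,c>0$, depending only on $k$ and $\delta$, such that for every $\varepsilon>0$ there is a deterministic polynomial-time algorithm $\mathcal A$ which takes as input $n$, a $k$-uniform hypergraph $H$ on $[n]$ and the number $\lfloor\eta|H|\rfloor$ of clauses that a $(1-\eta)$-satisfying assignment may violate (but no signs), which outputs a natural number $\mathcal A(H,\eta)$, and which has the following two properties. 1. For every $n$, every $k$-uniform hypergraph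 $H$ on $[n]$ and every $\eta\in[0,1]$, every $k\mathsf{XOR}$ instance on $H$ has at most $\mathcal A(H,\eta)$ assignments that are $(1-\eta)$-satisfying. 2. For all sufficiently large $n$ (depending on $k,\delta,\varepsilon$) and every $\eta\in[0,1]$, if $\mathbf H\sim\mathbf H_k(n^{1+\delta},n)$, then with probability at least $1-n^k\exp(-n^{c\varepsilon})$, $$\mathcal A(\mathbf H,\eta)\;\le\;2(2n)^{k-2}\cdot\exp\left(C\,\eta n\log n\right)\cdot\exp\left(C\,n^{1-\frac{\delta}{k-2}+\varepsilon}\right).$$ -/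

import Mathlib

/-! ## A machine model with a step count

A small structured programming language on binary trees. A program transforms one tree (its whole
memory). Every primitive operation and every loop test is charged the size of the tree it acts on,
so the cost also bounds the size of every tree that is ever written down; polynomial time in
this model is polynomial time on a Turing machine. -/

/-- Binary trees, the data that programs act on. -/
inductive BinData : Type
  | leaf : BinData
  | node : BinData → BinData → BinData

namespace BinData

/-- The number of nodes, leaves included. -/
def size : BinData → ℕ
  | leaf => 1
  | node a b => a.size + b.size + 1

/-- The left subtree (a leaf stays a leaf). -/
def left : BinData → BinData
  | leaf => leaf
  | node a _ => a

/-- The right subtree (a leaf stays a leaf). -/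
def right : BinData → BinData
  | leaf => leaf
  | node _ b => b

/-- A list of trees, as the right comb `node a₁ (node a₂ (… leaf))`. -/
def ofList : List BinData → BinData
  | [] => leaf
  | a :: l => node a (ofList l)

/-- A natural number in unary. -/
def ofUnary (n : ℕ) : BinData := ofList (List.replicate n leaf)

/-- One bit. -/
def ofBool : Bool → BinData
  | false => leaf
  | true => node leaf leaf

/-- A natural number in binary, least significant bit first. -/
def ofBinary (n : ℕ) : BinData := ofList (n.bits.map ofBool)

end BinData

/-- Programs. -/
inductive TreeProg : Type
  | skip : TreeProg
  | nil : TreeProg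
  | left : TreeProg
  | right : TreeProg
  | pair : TreeProg → TreeProg → TreeProg
  | seq : TreeProg → TreeProg → TreeProg
  | ite : TreeProg → TreeProg → TreeProg → TreeProg
  | while : TreeProg → TreeProg → TreeProg

/-- `p.Runs x y s`: started on `x`, the program `p` halts with result `y` after `s` steps. -/
inductive TreeProg.Runs : TreeProg → BinData → BinData → ℕ → Prop
  | skip (x : BinData) : Runs skip x x (x.size + 1)
  | nil (x : BinData) : Runs nil x BinData.leaf (x.size + 1)
  | left (x : BinData) : Runs left x x.left (x.size + 1)
  | right (x : BinData) : Runs right x x.right (x.size + 1)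
  | pair {p q : TreeProg} {x y z : BinData} {s t : ℕ} :
      Runs p x y s → Runs q x z t → Runs (pair p q) x (BinData.node y z) (s + t + 1)
  | seq {p q : TreeProg} {x y z : BinData} {s t : ℕ} :
      Runs p x y s → Runs q y z t → Runs (seq p q) x z (s + t + 1)
  | ite_true {c p q : TreeProg} {x a b y : BinData} {s t : ℕ} :
      Runs c x (BinData.node a b) s → Runs p x y t → Runs (ite c p q) x y (s + t + 1)
  | ite_false {c p q : TreeProg} {x y : BinData} {s t : ℕ} :
      Runs c x BinData.leaf s → Runs q x y t → Runs (ite c p q) x y (s + t + 1)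
  | while_stop {c p : TreeProg} {x : BinData} {s : ℕ} :
      Runs c x BinData.leaf s → Runs (TreeProg.while c p) x x (s + x.size + 1)
  | while_step {c p : TreeProg} {x a b y z : BinData} {s t u : ℕ} :
      Runs c x (BinData.node a b) s → Runs p x y t → Runs (TreeProg.while c p) y z u →
      Runs (TreeProg.while c p) x z (s + t + u + 1)

/-- `f` is computed by one program in time polynomial in the size of the encoded input. -/
def PolyTimeComputable {α β : Type*} (encIn : α → BinData) (encOut : β → BinData)
    (f : α → β) : Prop :=
  ∃ (p : TreeProg) (T : Polynomial ℕ), ∀ a : α,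
    ∃ s : ℕ, s ≤ T.eval (encIn a).size ∧ p.Runs (encIn a) (encOut (f a)) s

/-! ## Hypergraphs and XOR instances -/

/-- A hyperedge is a `k`-tuple of vertices. -/
abbrev HyperTuple (k n : ℕ) : Type := Fin k → Fin n

/-- A `k`XOR instance on `n` variables: a list of clauses `(b, U)`, which
ask for `∏ i, x (U i) = b`. The signs `±1` are the elements of `ℤˣ`. -/
abbrev XorInstance (k n : ℕ) : Type := List (ℤˣ × HyperTuple k n)

namespace XorInstance

/-- The underlying hypergraph, the signs being forgotten. -/
def hypergraph {k n : ℕ} (Φ : XorInstance k n) : List (HyperTuple k n) := Φ.map Prod.snd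

/-- The number of clauses (with multiplicity) that `x` satisfies. -/
def numSat {k n : ℕ} (Φ : XorInstance k n) (x : Fin n → ℤˣ) : ℕ :=
  Φ.countP fun c => ∏ i, x (c.2 i) = c.1

/-- `x` is `(1 - η)`-satisfying: it satisfies at least a fraction `1 - η` of the clauses. -/
def IsApproxSat {k n : ℕ} (Φ : XorInstance k n) (η : ℝ) (x : Fin n → ℤˣ) : Prop :=
  (1 - η) * (Φ.length : ℝ) ≤ (Φ.numSat x : ℝ)

/-- The number of `(1 - η)`-satisfying assignments. -/
noncomputable def numApproxSat {k n : ℕ} (Φ : XorInstance k n) (η : ℝ) : ℕ :=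
  Set.ncard {x : Fin n → ℤˣ | Φ.IsApproxSat η x}

end XorInstance

/-! ## The random hypergraph -/

/-- A signed hypergraph: a set of pairs of a sign vector and a `k`-tuple of vertices. -/
abbrev SignedHypergraph (k n : ℕ) : Type := Set ((Fin k → ℤˣ) × HyperTuple k n)

/-- Each of the `2 ^ k * n ^ k` signed tuples is included independently with
probability `m / (2 ^ k * n ^ k)`. -/
noncomputable def signedHypergraphLaw (k : ℕ) (m : ℝ) (n : ℕ) :
    MeasureTheory.Measure (SignedHypergraph k n) :=
  ProbabilityTheory.setBernoulli Set.univ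
    (Set.projIcc (0 : ℝ) 1 zero_le_one (m / (2 ^ k * (n : ℝ) ^ k)))

/-- `L` lists, in some order, the hyperedges of the unsigned hypergraph that arises from `I` by
removing the signs: a tuple occurs once for every sign vector that it carries in `I`. -/
def SignedHypergraph.IsUnsignedListing {k n : ℕ} (I : SignedHypergraph k n)
    (L : List (HyperTuple k n)) : Prop :=
  ∀ U : HyperTuple k n, L.count U = Set.ncard {c : Fin k → ℤˣ | (c, U) ∈ I}

/-! ## Certification algorithms -/

/-- An input: the number `n` of vertices, a list of hyperedges, and the number of
clauses that an assignment may violate. -/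
structure CertInput (k : ℕ) : Type where
  n : ℕ
  edges : List (HyperTuple k n)
  budget : ℕ

/-- The input as a tree; all numbers are in unary, a hyperedge is the list of its vertices. -/
def CertInput.encode {k : ℕ} (a : CertInput k) : BinData :=
  BinData.node (BinData.ofUnary a.n)
    (BinData.node
      (BinData.ofList (a.edges.map fun U =>
        BinData.ofList (List.ofFn fun i => BinData.ofUnary (U i : ℕ))))
      (BinData.ofUnary a.budget))

/-- The input that presents a hypergraph `L` and a real parameter `η` to an algorithm: an assignment
is `(1 - η)`-satisfying exactly if it violates at most `⌊η * |L|⌋` clauses. -/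
noncomputable def certInput {k n : ℕ} (L : List (HyperTuple k n)) (η : ℝ) : CertInput k :=
  ⟨n, L, ⌊η * (L.length : ℝ)⌋₊⟩

/-- On every hypergraph and for every `η`, the output of `A`, which does not see the signs, is an
upper bound for the number of `(1 - η)`-satisfying assignments of every signing. -/
def CertifiesAllSignings {k : ℕ} (A : CertInput k → ℕ) : Prop :=
  ∀ (n : ℕ) (L : List (HyperTuple k n)) (η : ℝ), 0 ≤ η → η ≤ 1 →
    ∀ Φ : XorInstance k n, Φ.hypergraph = L → Φ.numApproxSat η ≤ A (certInput L η)

/-! ## Closure properties of polynomial time -/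

/-! Fix a block length s and sort the hyperedges of a slab into classes according to the blocks that
contain their first k-2 vertices. The last two vertices of the hyperedges in a class form a graph on
[n]. Suppose that x and y agree on the blocks of a class, and let Z be the set where they differ. A
hyperedge of the class whose last two vertices are separated by Z is violated by x or by y, whatever
its sign. If the graph expands and both assignments violate few clauses of the class, then Z or its
complement is small. By averaging, every assignment within the budget has a class in which it
violates at most the proportional share of clauses. Up to a small set or the complement of one, it
is then described by that class and its values on k-2 blocks. Counting these descriptions gives
`CertInput.Valid.card_le_two_pow_bound`.

Expansion is tested in exact integer arithmetic, by a minimum degree and by the trace of the ℓ-th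
power of the adjacency matrix with its mean removed. Such a trace bounds the quadratic form
(`Matrix.dotProduct_mulVec_pow_le_trace`), and the resulting gap bounds cuts from below
(`Matrix.card_mul_card_compl_le_cut`). The output is 2 to the minimum of n and the bounds for all
block lengths that pass the test, so it is correct on every input; randomness matters only for its
size.

For the random hypergraph take s of order n^(1-δ/(k-2)+ε), or s = 1 if that is at most 1. In each
class a vertex then has expected degree y^4 ≥ n^ε as a first, and as a second, endpoint. A Chernoff
bound and a union bound over pairs of vertex sets give discrepancy at most y^3 √(|S||T|)
(`setBernoulli_real_not_isQuasirandom_le`). Small discrepancy gives a small operator norm at the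
price of a harmonic number (`Matrix.mulVec_dotProduct_mulVec_le_of_discrepancy`). The norm is thus
below the degree by a factor of order n^(ε/8), and a constant power ℓ with ℓε ≥ 8 absorbs the factor
n between norm and trace.

Polynomial time comes from closure properties of the machine model. All intermediate numbers are
unary; as ℓ does not depend on the input, even the entries of the matrix power have polynomial size.
Only the final power of two is written in binary. -/

theorem Polynomial.eval_mono_nat (T : Polynomial ℕ) {a b : ℕ} (h : a ≤ b) :
    T.eval a ≤ T.eval b := by
  rw [Polynomial.eval_eq_sum_range, Polynomial.eval_eq_sum_range]
  gcongr

namespace BinData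

theorem one_le_size (x : BinData) : 1 ≤ x.size := by
  cases x <;> simp [size]

theorem size_left_le (x : BinData) : x.left.size ≤ x.size := by
  cases x <;> simp [size, left]; omega

theorem size_right_le (x : BinData) : x.right.size ≤ x.size := by
  cases x <;> simp [size, right]; omega

theorem ofUnary_succ (n : ℕ) : ofUnary (n + 1) = node leaf (ofUnary n) := by
  simp [ofUnary, List.replicate_succ, ofList]

theorem ofUnary_zero : ofUnary 0 = leaf := rfl

theorem size_ofUnary (n : ℕ) : (ofUnary n).size = 2 * n + 1 := by
  induction n with
  | zero => rfl
  | succ n ih => rw [ofUnary_succ, size, ih, size]; ring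

theorem right_ofUnary (n : ℕ) : (ofUnary n).right = ofUnary (n - 1) := by
  cases n with
  | zero => rfl
  | succ n => rw [ofUnary_succ]; rfl

end BinData

/-! ### Step counts and loops of programs -/

namespace TreeProg

/-- Each primitive is charged the size of its argument, so nothing larger than the cost can be
produced. This lets a time bound for one program serve as an input-size bound for the next. -/
theorem Runs.size_le {p : TreeProg} {x y : BinData} {s : ℕ} (h : p.Runs x y s) : y.size ≤ s := by
  induction h with
  | skip x => omega
  | nil x => have := x.one_le_size; simp [BinData.size]
  | left x => have := x.size_left_le; omega
  | right x => have := x.size_right_le; omega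
  | pair _ _ ih₁ ih₂ => simp only [BinData.size]; omega
  | seq _ _ ih₁ ih₂ => omega
  | ite_true _ _ ih₁ ih₂ => omega
  | ite_false _ _ ih₁ ih₂ => omega
  | while_stop _ ih => omega
  | while_step _ _ _ ih₁ ih₂ ih₃ => omega

/-- A loop that passes through the states `y 0, …, y N`, each test and each round costing at
most `K`. -/
theorem Runs.while_of_states {c p : TreeProg} (y : ℕ → BinData) (K : ℕ) (N : ℕ)
    (hc : ∀ i < N, ∃ a b s, s ≤ K ∧ c.Runs (y i) (BinData.node a b) s)
    (hp : ∀ i < N, ∃ s, s ≤ K ∧ p.Runs (y i) (y (i + 1)) s)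
    (hfin : ∃ s, s ≤ K ∧ c.Runs (y N) BinData.leaf s) (hN : (y N).size ≤ K) :
    ∃ s, s ≤ (N + 1) * (2 * K + 1) ∧ (TreeProg.while c p).Runs (y 0) (y N) s := by
  induction N generalizing y with
  | zero =>
    obtain ⟨s, hs, h⟩ := hfin
    exact ⟨_, by omega, Runs.while_stop h⟩
  | succ N ih =>
    obtain ⟨a, b, s, hs, h₁⟩ := hc 0 (by omega)
    obtain ⟨t, ht, h₂⟩ := hp 0 (by omega)
    obtain ⟨u, hu, h₃⟩ := ih (fun i => y (i + 1)) (fun i hi => hc (i + 1) (by omega))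
      (fun i hi => hp (i + 1) (by omega)) hfin hN
    refine ⟨s + t + u + 1, ?_, Runs.while_step h₁ h₂ h₃⟩
    have : (N + 1 + 1) * (2 * K + 1) = (N + 1) * (2 * K + 1) + (2 * K + 1) := by ring
    omega

end TreeProg

/-! ### Tree-valued functions: composition, branching, bounded iteration -/

/-- Up to the encoding of the arguments, the tree-valued function `F` is computed in
polynomial time. -/
def TreeComputable {X : Type*} (enc : X → BinData) (F : X → BinData) : Prop :=
  ∃ (p : TreeProg) (T : Polynomial ℕ), ∀ x : X,
    ∃ s : ℕ, s ≤ T.eval (enc x).size ∧ p.Runs (enc x) (F x) s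

namespace TreeComputable

variable {X Y : Type*} {enc : X → BinData}

theorem size_le {F : X → BinData} (h : TreeComputable enc F) :
    ∃ T : Polynomial ℕ, ∀ x, (F x).size ≤ T.eval (enc x).size := by
  obtain ⟨p, T, h⟩ := h
  refine ⟨T, fun x => ?_⟩
  obtain ⟨s, hs, hr⟩ := h x
  exact hr.size_le.trans hs

theorem self : TreeComputable enc enc :=
  ⟨.skip, .X + 1, fun x => ⟨_, by simp, .skip _⟩⟩

theorem leaf : TreeComputable enc (fun _ => BinData.leaf) :=
  ⟨.nil, .X + 1, fun x => ⟨_, by simp, .nil _⟩⟩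

/-- The second program sees an input no larger than the running time of the first, so the time
polynomials compose. -/
theorem comp {F : X → Y} {encY : Y → BinData} {G : Y → BinData}
    (hG : TreeComputable encY G) (hF : TreeComputable enc (fun x => encY (F x))) :
    TreeComputable enc (fun x => G (F x)) := by
  obtain ⟨p, T, hp⟩ := hF
  obtain ⟨q, S, hq⟩ := hG
  refine ⟨.seq p q, T + S.comp T + 1, fun x => ?_⟩
  obtain ⟨s, hs, h₁⟩ := hp x
  obtain ⟨t, ht, h₂⟩ := hq (F x)
  refine ⟨_, ?_, .seq h₁ h₂⟩
  have : S.eval (encY (F x)).size ≤ S.eval (T.eval (enc x).size) :=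
    S.eval_mono_nat (h₁.size_le.trans hs)
  simp only [Polynomial.eval_add, Polynomial.eval_comp, Polynomial.eval_one]
  omega

theorem left {F : X → BinData} (hF : TreeComputable enc F) :
    TreeComputable enc (fun x => (F x).left) :=
  comp (encY := id) (G := BinData.left) ⟨.left, .X + 1, fun x => ⟨_, by simp, .left _⟩⟩ hF

theorem right {F : X → BinData} (hF : TreeComputable enc F) :
    TreeComputable enc (fun x => (F x).right) :=
  comp (encY := id) (G := BinData.right) ⟨.right, .X + 1, fun x => ⟨_, by simp, .right _⟩⟩ hF

theorem node {F G : X → BinData} (hF : TreeComputable enc F) (hG : TreeComputable enc G) :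
    TreeComputable enc (fun x => BinData.node (F x) (G x)) := by
  obtain ⟨p, T, hp⟩ := hF
  obtain ⟨q, S, hq⟩ := hG
  refine ⟨.pair p q, T + S + 1, fun x => ?_⟩
  obtain ⟨s, hs, h₁⟩ := hp x
  obtain ⟨t, ht, h₂⟩ := hq x
  refine ⟨_, ?_, .pair h₁ h₂⟩
  simp only [Polynomial.eval_add, Polynomial.eval_one]
  omega

theorem ite {F G H : X → BinData} (P : X → Prop) [DecidablePred P]
    (hP : ∀ x, P x ↔ H x ≠ BinData.leaf) (hH : TreeComputable enc H)
    (hF : TreeComputable enc F) (hG : TreeComputable enc G) :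
    TreeComputable enc (fun x => if P x then F x else G x) := by
  obtain ⟨p, T, hp⟩ := hF
  obtain ⟨q, S, hq⟩ := hG
  obtain ⟨c, R, hc⟩ := hH
  refine ⟨.ite c p q, T + S + R + 1, fun x => ?_⟩
  obtain ⟨s, hs, h₁⟩ := hp x
  obtain ⟨t, ht, h₂⟩ := hq x
  obtain ⟨u, hu, h₃⟩ := hc x
  by_cases h : P x
  · have h' := (hP x).1 h
    simp only [if_pos h]
    cases hx : H x with
    | leaf => exact absurd hx h'
    | node a b =>
      rw [hx] at h₃
      refine ⟨_, ?_, .ite_true h₃ h₁⟩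
      simp only [Polynomial.eval_add, Polynomial.eval_one]
      omega
  · have h' : H x = BinData.leaf := by
      by_contra h''
      exact h ((hP x).2 h'')
    simp only [if_neg h]
    rw [h'] at h₃
    refine ⟨_, ?_, .ite_false h₃ h₂⟩
    simp only [Polynomial.eval_add, Polynomial.eval_one]
    omega

/-- Bounded iteration: the number of rounds is computed in unary, and the size of the state stays
polynomially bounded. -/
theorem iterate {A : Type*} {encA : A → BinData} {init : X → A} {step : X → A → A} {g : X → ℕ}
    (hg : TreeComputable enc (fun x => BinData.ofUnary (g x)))
    (hinit : TreeComputable enc (fun x => encA (init x)))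
    (hstep : TreeComputable (fun p : A × X => BinData.node (encA p.1) (enc p.2))
      (fun p => encA (step p.2 p.1)))
    (hsize : ∃ Q : Polynomial ℕ, ∀ x, ∀ i ≤ g x,
      (encA ((step x)^[i] (init x))).size ≤ Q.eval (enc x).size) :
    TreeComputable enc (fun x => encA ((step x)^[g x] (init x))) := by
  obtain ⟨Q, hQ⟩ := hsize
  -- the state of the loop: a counter, the iterated object, and the argument
  let E : (ℕ × A) × X → BinData := fun z =>
    BinData.node (BinData.ofUnary z.1.1) (BinData.node (encA z.1.2) (enc z.2))
  have hstart : TreeComputable enc (fun x => E ((g x, init x), x)) := hg.node (hinit.node self)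
  have hself : TreeComputable E E := self
  have hA : TreeComputable E (fun z => encA (step z.2 z.1.2)) :=
    comp (F := fun z : (ℕ × A) × X => (z.1.2, z.2)) hstep hself.right
  have hround : TreeComputable E (fun z => E ((z.1.1 - 1, step z.2 z.1.2), z.2)) := by
    have h := hself.left.right.node (hA.node hself.right.right)
    simp only [E, ← BinData.right_ofUnary]
    exact h
  obtain ⟨p, T, hp⟩ := hround
  obtain ⟨Tg, hTg⟩ := hg.size_le
  let S : Polynomial ℕ := Tg + Q + .X + 2
  have hS : ∀ x, ∀ i ≤ g x, (E ((g x - i, (step x)^[i] (init x)), x)).size ≤ S.eval (enc x).size := by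
    intro x i hi
    have h₁ := hTg x
    have h₂ := hQ x i hi
    rw [BinData.size_ofUnary] at h₁
    simp only [E, S, BinData.size, BinData.size_ofUnary, Polynomial.eval_add, Polynomial.eval_X,
      Polynomial.eval_ofNat]
    omega
  have hloop : TreeComputable (fun x => E ((g x, init x), x))
      (fun x => E ((0, (step x)^[g x] (init x)), x)) := by
    let K : Polynomial ℕ := T.comp S + S + 1
    -- The test `.left` reads the unary counter, which is a leaf exactly when the counter is zero.
    refine ⟨.while .left p, (Tg + 1) * (2 * K + 1) |>.comp .X, fun x => ?_⟩
    have hK₁ : ∀ i ≤ g x, (E ((g x - i, (step x)^[i] (init x)), x)).size + 1 ≤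
        K.eval (enc x).size := by
      intro i hi
      have := hS x i hi
      simp only [K, Polynomial.eval_add, Polynomial.eval_one, Polynomial.eval_comp]
      omega
    obtain ⟨s, hs, h⟩ := TreeProg.Runs.while_of_states (c := .left) (p := p)
      (fun i => E ((g x - i, (step x)^[i] (init x)), x)) (K.eval (enc x).size) (g x)
      (by
        intro i hi
        obtain ⟨m, hm⟩ : ∃ m, g x - i = m + 1 := ⟨g x - i - 1, by omega⟩
        refine ⟨BinData.leaf, BinData.ofUnary m, _, hK₁ i hi.le, ?_⟩
        have := TreeProg.Runs.left (E ((g x - i, (step x)^[i] (init x)), x))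
        have e : (E ((g x - i, (step x)^[i] (init x)), x)).left =
          BinData.node BinData.leaf (BinData.ofUnary m) := by
          simp only [E, BinData.left, hm, BinData.ofUnary_succ]
        rwa [e] at this)
      (by
        intro i hi
        obtain ⟨s, hs, h⟩ := hp ((g x - i, (step x)^[i] (init x)), x)
        refine ⟨s, hs.trans ?_, ?_⟩
        · have := T.eval_mono_nat (hS x i hi.le)
          simp only [K, Polynomial.eval_add, Polynomial.eval_one, Polynomial.eval_comp]
          omega
        · rw [Function.iterate_succ_apply', ← Nat.sub_sub]
          exact h)
      (by
        refine ⟨_, hK₁ (g x) le_rfl, ?_⟩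
        have := TreeProg.Runs.left (E ((g x - g x, (step x)^[g x] (init x)), x))
        have e : (E ((g x - g x, (step x)^[g x] (init x)), x)).left = BinData.leaf := by
          simp only [E, BinData.left, Nat.sub_self, BinData.ofUnary_zero]
        rwa [e] at this)
      ((Nat.le_succ _).trans (hK₁ (g x) le_rfl))
    refine ⟨s, hs.trans ?_, by simpa using h⟩
    have h₁ := hTg x
    rw [BinData.size_ofUnary] at h₁
    have h₂ : (enc x).size ≤ (E ((g x, init x), x)).size := by
      simp only [E, BinData.size]; omega
    have h₃ := K.eval_mono_nat h₂
    have h₄ := Tg.eval_mono_nat h₂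
    simp only [Polynomial.eval_mul, Polynomial.eval_add, Polynomial.eval_one,
      Polynomial.eval_comp, Polynomial.eval_X, Polynomial.eval_ofNat]
    gcongr
    omega
  have hfinal := comp (F := fun x => x) hloop hstart
  exact hfinal.right.left

end TreeComputable

/-! ### Unary arithmetic -/

/-- The function `f` with values in unary is computed in polynomial time. -/
def UnaryComputable {X : Type*} (enc : X → BinData) (f : X → ℕ) : Prop :=
  TreeComputable enc (fun x => BinData.ofUnary (f x))

/-- The encoding of an argument together with an extra number in unary. -/
def BinData.pushEnc {X : Type*} (enc : X → BinData) (p : ℕ × X) : BinData :=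
  BinData.node (BinData.ofUnary p.1) (enc p.2)

/-- Context extension: it moves a computable function under a bound variable, such as a summation
index or a quantified number. -/
theorem TreeComputable.weaken {X : Type*} {enc : X → BinData} {F : X → BinData}
    (h : TreeComputable enc F) : TreeComputable (BinData.pushEnc enc) (fun p => F p.2) :=
  TreeComputable.comp (F := fun p : ℕ × X => p.2) h (TreeComputable.self (enc := BinData.pushEnc enc)).right

namespace UnaryComputable

variable {X : Type*} {enc : X → BinData} {f g : X → ℕ}

theorem le_eval (h : UnaryComputable enc f) :
    ∃ T : Polynomial ℕ, ∀ x, 2 * f x + 1 ≤ T.eval (enc x).size := by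
  obtain ⟨T, hT⟩ := h.size_le
  exact ⟨T, fun x => by simpa [BinData.size_ofUnary] using hT x⟩

theorem congr (h : UnaryComputable enc f) (hfg : ∀ x, f x = g x) : UnaryComputable enc g := by
  rwa [show g = f from funext fun x => (hfg x).symm]

theorem weaken (h : UnaryComputable enc f) :
    UnaryComputable (BinData.pushEnc enc) (fun p => f p.2) :=
  TreeComputable.weaken h

theorem var : UnaryComputable (BinData.pushEnc enc) (fun p => p.1) :=
  (TreeComputable.self (enc := BinData.pushEnc enc)).left

theorem succ (hf : UnaryComputable enc f) : UnaryComputable enc (fun x => f x + 1) := by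
  unfold UnaryComputable
  simp only [BinData.ofUnary_succ]
  exact TreeComputable.leaf.node hf

theorem pred (hf : UnaryComputable enc f) : UnaryComputable enc (fun x => f x - 1) := by
  unfold UnaryComputable
  simp only [← BinData.right_ofUnary]
  exact TreeComputable.right hf

theorem const (c : ℕ) : UnaryComputable enc (fun _ => c) := by
  induction c with
  | zero => exact TreeComputable.leaf
  | succ c ih => exact ih.succ

/-- Bounded recursion on numbers. -/
theorem iterate {step : ℕ → X → ℕ} {N : X → ℕ} (hN : UnaryComputable enc N)
    (hf : UnaryComputable enc f)
    (hstep : UnaryComputable (BinData.pushEnc enc) (fun p => step p.1 p.2))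
    (hbound : ∃ Q : Polynomial ℕ, ∀ x, ∀ i ≤ N x,
      (fun m => step m x)^[i] (f x) ≤ Q.eval (enc x).size) :
    UnaryComputable enc (fun x => (fun m => step m x)^[N x] (f x)) := by
  obtain ⟨Q, hQ⟩ := hbound
  refine TreeComputable.iterate (encA := BinData.ofUnary) (init := f)
    (step := fun x m => step m x) hN hf hstep ⟨2 * Q + 1, fun x i hi => ?_⟩
  have := hQ x i hi
  simp only [BinData.size_ofUnary, Polynomial.eval_add, Polynomial.eval_mul,
    Polynomial.eval_ofNat, Polynomial.eval_one]
  omega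

theorem add (hf : UnaryComputable enc f) (hg : UnaryComputable enc g) :
    UnaryComputable enc (fun x => f x + g x) := by
  have key : ∀ i m : ℕ, (fun m => m + 1)^[i] m = m + i := fun i m => by simp
  obtain ⟨T, hT⟩ := hf.le_eval
  obtain ⟨S, hS⟩ := hg.le_eval
  have := iterate (step := fun m _ => m + 1) hg hf var.succ ⟨T + S, fun x i hi => by
    have h₁ := hT x
    have h₂ := hS x
    rw [key, Polynomial.eval_add]
    omega⟩
  simpa only [key] using this

theorem tsub (hf : UnaryComputable enc f) (hg : UnaryComputable enc g) :
    UnaryComputable enc (fun x => f x - g x) := by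
  have key : ∀ i m : ℕ, (fun m => m - 1)^[i] m = m - i := fun i m => by
    induction i with
    | zero => rfl
    | succ i ih => rw [Function.iterate_succ_apply', ih, Nat.sub_sub]
  obtain ⟨T, hT⟩ := hf.le_eval
  have := iterate (step := fun m _ => m - 1) hg hf var.pred ⟨T, fun x i hi => by
    have h₁ := hT x
    rw [key]
    omega⟩
  simpa only [key] using this

/-- A loop whose state is the pair of index and partial sum. The summands are evaluated on inputs of
polynomial size, so the partial sums stay polynomial too. Counting, bounded quantifiers, division
and logarithms all reduce to this. -/
theorem sum {F : ℕ → X → ℕ} (hf : UnaryComputable enc f)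
    (hF : UnaryComputable (BinData.pushEnc enc) (fun p => F p.1 p.2)) :
    UnaryComputable enc (fun x => ∑ i ∈ Finset.range (f x), F i x) := by
  have key : ∀ (x : X) (i : ℕ), (fun z : ℕ × ℕ => (z.1 + 1, z.2 + F z.1 x))^[i] (0, 0) =
      (i, ∑ j ∈ Finset.range i, F j x) := by
    intro x i
    induction i with
    | zero => rfl
    | succ i ih => rw [Function.iterate_succ_apply', ih, Finset.sum_range_succ]
  let encA : ℕ × ℕ → BinData := fun z => BinData.node (BinData.ofUnary z.1) (BinData.ofUnary z.2)
  obtain ⟨T, hT⟩ := hf.le_eval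
  obtain ⟨S, hS⟩ := hF.le_eval
  have h := TreeComputable.iterate (encA := encA) (init := fun _ : X => ((0, 0) : ℕ × ℕ))
    (step := fun x z => (z.1 + 1, z.2 + F z.1 x)) hf
    (TreeComputable.leaf.node TreeComputable.leaf)
    (by
      let E : (ℕ × ℕ) × X → BinData := fun p => BinData.node (encA p.1) (enc p.2)
      have hs : TreeComputable E E := .self
      have h₁ : UnaryComputable E (fun p => p.1.1) := hs.left.left
      have h₂ : UnaryComputable E (fun p => p.1.2) := hs.left.right
      have h₃ : UnaryComputable E (fun p => F p.1.1 p.2) :=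
        TreeComputable.comp (F := fun p : (ℕ × ℕ) × X => (p.1.1, p.2)) hF
          (TreeComputable.node h₁ hs.right)
      exact TreeComputable.node h₁.succ (h₂.add h₃))
    (by
      refine ⟨T + 1 + 2 * (T * S.comp (T + .X + 1)) + 1, fun x i hi => ?_⟩
      rw [key]
      have h₁ := hT x
      have h₂ : ∀ j ∈ Finset.range i, F j x ≤ S.eval (T.eval (enc x).size + (enc x).size + 1) := by
        intro j hj
        have hj := Finset.mem_range.1 hj
        have h₃ := hS (j, x)
        have h₄ : (BinData.pushEnc enc (j, x)).size ≤
            T.eval (enc x).size + (enc x).size + 1 := by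
          simp only [BinData.pushEnc, BinData.size, BinData.size_ofUnary]
          omega
        have h₅ := S.eval_mono_nat h₄
        simp only at h₃
        omega
      have h₆ := Finset.sum_le_card_nsmul _ _ _ h₂
      rw [Finset.card_range, smul_eq_mul] at h₆
      have h₇ : i * S.eval (T.eval (enc x).size + (enc x).size + 1) ≤
          T.eval (enc x).size * S.eval (T.eval (enc x).size + (enc x).size + 1) := by
        gcongr
        omega
      simp only [encA, BinData.size, BinData.size_ofUnary, Polynomial.eval_add,
        Polynomial.eval_mul, Polynomial.eval_ofNat, Polynomial.eval_one, Polynomial.eval_comp,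
        Polynomial.eval_X]
      omega)
  simp only [key] at h
  exact TreeComputable.right h

theorem mul (hf : UnaryComputable enc f) (hg : UnaryComputable enc g) :
    UnaryComputable enc (fun x => f x * g x) := by
  simpa using sum (F := fun _ x => g x) hf hg.weaken

theorem pow (hf : UnaryComputable enc f) (c : ℕ) : UnaryComputable enc (fun x => f x ^ c) := by
  induction c with
  | zero => simpa using const 1
  | succ c ih => simpa only [pow_succ] using ih.mul hf

theorem ite (P : X → Prop) [DecidablePred P]
    (hP : UnaryComputable enc (fun x => if P x then 1 else 0))
    (hf : UnaryComputable enc f) (hg : UnaryComputable enc g) :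
    UnaryComputable enc (fun x => if P x then f x else g x) := by
  have h := TreeComputable.ite (enc := enc) P (fun x => ?_) hP hf hg
  · have e : (fun x => BinData.ofUnary (if P x then f x else g x)) =
        fun x => if P x then BinData.ofUnary (f x) else BinData.ofUnary (g x) := by
      funext x
      split <;> rfl
    unfold UnaryComputable
    rwa [e]
  · by_cases h : P x
    · simp [h, BinData.ofUnary, BinData.ofList]
    · simp [h, BinData.ofUnary_zero]

end UnaryComputable

/-! ### Decidable predicates and bounded quantifiers -/

/-- The predicate `P` is decided in polynomial time. -/
def PredComputable {X : Type*} (enc : X → BinData) (P : X → Prop) : Prop :=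
  ∃ _ : DecidablePred P, UnaryComputable enc (fun x => if P x then 1 else 0)

namespace PredComputable

variable {X : Type*} {enc : X → BinData} {f g : X → ℕ} {P Q : X → Prop}

theorem indicator [DecidablePred P] (h : PredComputable enc P) :
    UnaryComputable enc (fun x => if P x then 1 else 0) := by
  obtain ⟨_, h⟩ := h
  convert h

theorem ite [DecidablePred P] (h : PredComputable enc P) (hf : UnaryComputable enc f)
    (hg : UnaryComputable enc g) : UnaryComputable enc (fun x => if P x then f x else g x) :=
  UnaryComputable.ite P h.indicator hf hg

theorem congr (h : PredComputable enc P) (hPQ : ∀ x, P x ↔ Q x) : PredComputable enc Q := by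
  rwa [show Q = P from funext fun x => propext (hPQ x).symm]

/-- The indicator is the truncated difference 1 - f. Comparisons and connectives are reduced to this
test. -/
theorem _root_.UnaryComputable.eq_zero (hf : UnaryComputable enc f) :
    PredComputable enc (fun x => f x = 0) := by
  refine ⟨inferInstance, ?_⟩
  refine ((UnaryComputable.const 1).tsub hf).congr fun x => ?_
  split <;> omega

theorem _root_.UnaryComputable.le (hf : UnaryComputable enc f) (hg : UnaryComputable enc g) :
    PredComputable enc (fun x => f x ≤ g x) :=
  (UnaryComputable.eq_zero (hf.tsub hg)).congr fun x => by omega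

theorem _root_.UnaryComputable.lt (hf : UnaryComputable enc f) (hg : UnaryComputable enc g) :
    PredComputable enc (fun x => f x < g x) := hf.succ.le hg

theorem not (hP : PredComputable enc P) : PredComputable enc (fun x => ¬ P x) := by
  obtain ⟨_, h⟩ := hP
  exact (UnaryComputable.eq_zero h).congr fun x => by simp

theorem and (hP : PredComputable enc P) (hQ : PredComputable enc Q) :
    PredComputable enc (fun x => P x ∧ Q x) := by
  obtain ⟨_, h₁⟩ := hP
  obtain ⟨_, h₂⟩ := hQ
  exact (UnaryComputable.eq_zero (h₁.mul h₂)).not.congr fun x => by simp [and_comm]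

theorem imp (hP : PredComputable enc P) (hQ : PredComputable enc Q) :
    PredComputable enc (fun x => P x → Q x) :=
  (hP.and hQ.not).not.congr fun x => by tauto

theorem _root_.UnaryComputable.eq (hf : UnaryComputable enc f) (hg : UnaryComputable enc g) :
    PredComputable enc (fun x => f x = g x) :=
  ((hf.le hg).and (hg.le hf)).congr fun x => by omega

/-- The statement holds for all indices exactly if the number of counterexamples is zero, and that
number is a computable sum. -/
theorem forall_lt {R : ℕ → X → Prop} (hf : UnaryComputable enc f)
    (hR : PredComputable (BinData.pushEnc enc) (fun p => R p.1 p.2)) :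
    PredComputable enc (fun x => ∀ i < f x, R i x) := by
  classical
  refine (UnaryComputable.eq_zero (hf.sum (F := fun i x => if ¬ R i x then 1 else 0) ?_)).congr fun x => ?_
  · exact hR.not.indicator
  · simp [Finset.sum_eq_zero_iff]

theorem forall_const {R : ℕ → X → Prop} (m : ℕ) (hR : ∀ i < m, PredComputable enc (R i)) :
    PredComputable enc (fun x => ∀ i < m, R i x) := by
  induction m with
  | zero => exact (UnaryComputable.eq_zero (UnaryComputable.const 0)).congr fun x => by simp
  | succ m ih =>
    refine ((ih fun i hi => hR i (by omega)).and (hR m (by omega))).congr fun x => ?_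
    rw [Nat.forall_lt_succ_right]

end PredComputable

/-! ### Division, truncated powers of two, logarithms -/

namespace UnaryComputable

variable {X : Type*} {enc : X → BinData} {f g : X → ℕ}

/-- The quotient is the number of positive multiples of g that do not exceed f. The guard `0 < g x`
reproduces the convention that division by zero is zero. -/
theorem div (hf : UnaryComputable enc f) (hg : UnaryComputable enc g) :
    UnaryComputable enc (fun x => f x / g x) := by
  classical
  have h : UnaryComputable enc (fun x => ∑ i ∈ Finset.range (f x),
      if (0 < g x ∧ (i + 1) * g x ≤ f x) then 1 else 0) :=
    hf.sum (F := fun i x => if (0 < g x ∧ (i + 1) * g x ≤ f x) then 1 else 0)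
      ((UnaryComputable.lt (const 0) hg.weaken).and
        (UnaryComputable.le (var.succ.mul hg.weaken) hf.weaken)).indicator
  refine h.congr fun x => ?_
  rw [← Finset.sum_filter, ← Finset.card_eq_sum_ones]
  rcases Nat.eq_zero_or_pos (g x) with h0 | h0
  · simp [h0]
  · have : (Finset.range (f x)).filter (fun i => 0 < g x ∧ (i + 1) * g x ≤ f x) =
        Finset.range (f x / g x) := by
      ext i
      simp only [Finset.mem_filter, Finset.mem_range, h0, true_and]
      rw [← Nat.le_div_iff_mul_le h0, Nat.succ_le_iff]
      exact ⟨fun h => h.2, fun h => ⟨h.trans_le (Nat.div_le_self _ _), h⟩⟩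
    rw [this, Finset.card_range]

/-- Powers of two, truncated at a computed value. -/
theorem min_two_pow (hf : UnaryComputable enc f) (hg : UnaryComputable enc g) :
    UnaryComputable enc (fun x => min (2 ^ f x) (g x + 1)) := by
  classical
  have key : ∀ (x : X) (i : ℕ), (fun m => if 2 * m ≤ g x + 1 then 2 * m else g x + 1)^[i] 1 =
      min (2 ^ i) (g x + 1) := by
    intro x i
    induction i with
    | zero => simp
    | succ i ih =>
      rw [Function.iterate_succ_apply', ih, pow_succ]
      split <;> omega
  obtain ⟨T, hT⟩ := hg.le_eval
  have h := iterate (step := fun m x => if 2 * m ≤ g x + 1 then 2 * m else g x + 1) hf (const 1)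
    ((UnaryComputable.le ((const 2).mul var) hg.weaken.succ).ite ((const 2).mul var)
      hg.weaken.succ) ⟨T + 1, fun x i hi => by
        have := hT x
        rw [key, Polynomial.eval_add, Polynomial.eval_one]
        omega⟩
  simpa only [key] using h

/-- The logarithm counts the i with 2^(i+1) ≤ f. Truncating the power at f + 1 keeps it writable in
unary and does not change the comparison. -/
theorem log_two (hf : UnaryComputable enc f) : UnaryComputable enc (fun x => Nat.log 2 (f x)) := by
  classical
  have h : UnaryComputable enc (fun x => ∑ i ∈ Finset.range (f x),
      if min (2 ^ (i + 1)) (f x + 1) ≤ f x then 1 else 0) :=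
    hf.sum (F := fun i x => if min (2 ^ (i + 1)) (f x + 1) ≤ f x then 1 else 0)
      (UnaryComputable.le (min_two_pow var.succ hf.weaken) hf.weaken).indicator
  refine h.congr fun x => ?_
  rw [← Finset.sum_filter, ← Finset.card_eq_sum_ones]
  have : (Finset.range (f x)).filter (fun i => min (2 ^ (i + 1)) (f x + 1) ≤ f x) =
      Finset.range (Nat.log 2 (f x)) := by
    ext i
    simp only [Finset.mem_filter, Finset.mem_range]
    rcases Nat.eq_zero_or_pos (f x) with h0 | h0
    · simp [h0]
    · rw [← Nat.succ_le_iff (m := i) (n := Nat.log 2 _), Nat.le_log_iff_pow_le (by norm_num) h0.ne']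
      have h₁ : i < 2 ^ i := Nat.lt_two_pow_self
      have h₂ : 2 ^ (i + 1) = 2 * 2 ^ i := by ring
      simp only [Nat.succ_eq_add_one]
      omega
  rw [this, Finset.card_range]

end UnaryComputable

/-! ### Integers as differences of unary numbers -/

/-- The integer-valued function `f` is a difference of functions that are computed in unary. -/
def IntComputable {X : Type*} (enc : X → BinData) (f : X → ℤ) : Prop :=
  ∃ a b : X → ℕ, UnaryComputable enc a ∧ UnaryComputable enc b ∧ ∀ x, f x = (a x : ℤ) - b x

namespace IntComputable

variable {X : Type*} {enc : X → BinData} {f g : X → ℤ}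

theorem natCast {a : X → ℕ} (h : UnaryComputable enc a) : IntComputable enc (fun x => (a x : ℤ)) :=
  ⟨a, fun _ => 0, h, .const 0, fun x => by simp⟩

theorem sub (hf : IntComputable enc f) (hg : IntComputable enc g) :
    IntComputable enc (fun x => f x - g x) := by
  obtain ⟨a, b, ha, hb, h⟩ := hf
  obtain ⟨c, d, hc, hd, h'⟩ := hg
  exact ⟨_, _, ha.add hd, hb.add hc, fun x => by simp only [h, h']; push_cast; ring⟩

theorem mul (hf : IntComputable enc f) (hg : IntComputable enc g) :
    IntComputable enc (fun x => f x * g x) := by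
  obtain ⟨a, b, ha, hb, h⟩ := hf
  obtain ⟨c, d, hc, hd, h'⟩ := hg
  exact ⟨_, _, (ha.mul hc).add (hb.mul hd), (ha.mul hd).add (hb.mul hc), fun x => by
    simp only [h, h']; push_cast; ring⟩

theorem sum {N : X → ℕ} {F : ℕ → X → ℤ} (hN : UnaryComputable enc N)
    (hF : IntComputable (BinData.pushEnc enc) (fun p => F p.1 p.2)) :
    IntComputable enc (fun x => ∑ i ∈ Finset.range (N x), F i x) := by
  obtain ⟨a, b, ha, hb, h⟩ := hF
  refine ⟨_, _, hN.sum (F := fun i x => a (i, x)) ha, hN.sum (F := fun i x => b (i, x)) hb,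
    fun x => ?_⟩
  push_cast
  rw [← Finset.sum_sub_distrib]
  exact Finset.sum_congr rfl fun i _ => h (i, x)

theorem le (hf : IntComputable enc f) (hg : IntComputable enc g) :
    PredComputable enc (fun x => f x ≤ g x) := by
  obtain ⟨a, b, ha, hb, h⟩ := hf
  obtain ⟨c, d, hc, hd, h'⟩ := hg
  exact (UnaryComputable.le (ha.add hd) (hc.add hb)).congr fun x => by rw [h, h']; omega

end IntComputable

/-! ### Access to lists, and powers of two in binary -/

theorem TreeComputable.congr {X : Type*} {enc F G : X → BinData} (h : TreeComputable enc F)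
    (hFG : ∀ x, F x = G x) : TreeComputable enc G := by
  rwa [show G = F from funext fun x => (hFG x).symm]

/-- A loop strips one element from the list in the left component and prepends a leaf to the counter
in the right one. It is a raw program because the iteration lemma needs the number of rounds in
advance. -/
theorem UnaryComputable.length {X : Type*} {enc : X → BinData} {l : X → List BinData}
    (hl : TreeComputable enc (fun x => BinData.ofList (l x))) :
    UnaryComputable enc (fun x => (l x).length) := by
  have hsize : ∀ (L : List BinData) (i : ℕ),
      (BinData.ofList (L.drop i)).size ≤ (BinData.ofList L).size := by
    intro L
    induction L with
    | nil => intro i; simp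
    | cons a L ih =>
      intro i
      cases i with
      | zero => simp
      | succ i => have := ih i; simp only [List.drop_succ_cons, BinData.ofList, BinData.size]; omega
  have hlen : ∀ L : List BinData, 2 * L.length + 1 ≤ (BinData.ofList L).size := by
    intro L
    induction L with
    | nil => simp [BinData.ofList, BinData.size]
    | cons a L ih => have := a.one_le_size; simp only [BinData.ofList, BinData.size, List.length_cons]; omega
  let E : List BinData → BinData := fun L => BinData.node (BinData.ofList L) BinData.leaf
  have hloop : TreeComputable E
      (fun L => BinData.node BinData.leaf (BinData.ofUnary L.length)) := by
    refine ⟨.while .left (.pair (.seq .left .right) (.pair .nil .right)),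
      (.X + 1) * (2 * (8 * .X + 8) + 1), fun L => ?_⟩
    have hy : ∀ i ≤ L.length, (BinData.node (BinData.ofList (L.drop i))
        (BinData.ofUnary i)).size ≤ 2 * (E L).size := by
      intro i hi
      have h₁ := hsize L i
      have h₂ := hlen L
      simp only [E, BinData.size, BinData.size_ofUnary]
      omega
    let y : ℕ → BinData := fun i => BinData.node (BinData.ofList (L.drop i)) (BinData.ofUnary i)
    have hcons : ∀ i (hi : i < L.length), BinData.ofList (L.drop i) =
        BinData.node L[i] (BinData.ofList (L.drop (i + 1))) := by
      intro i hi
      rw [List.drop_eq_getElem_cons hi]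
      rfl
    obtain ⟨s, hs, h⟩ := TreeProg.Runs.while_of_states (c := .left)
      (p := .pair (.seq .left .right) (.pair .nil .right)) y (8 * (E L).size + 8) L.length
      (by
        intro i hi
        have h₁ : (y i).size ≤ 2 * (E L).size := hy i hi.le
        have h₃ := TreeProg.Runs.left (y i)
        rw [show (y i).left = _ from hcons i hi] at h₃
        exact ⟨_, _, _, by omega, h₃⟩)
      (by
        intro i hi
        have h₁ : (y i).size ≤ 2 * (E L).size := hy i hi.le
        have h₂ := (y i).size_left_le
        have h₃ := TreeProg.Runs.pair (TreeProg.Runs.seq (TreeProg.Runs.left (y i))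
          (TreeProg.Runs.right _)) (TreeProg.Runs.pair (TreeProg.Runs.nil _)
          (TreeProg.Runs.right (y i)))
        have h₄ : BinData.node (y i).left.right (BinData.node BinData.leaf (y i).right) =
            y (i + 1) := by
          simp only [y, BinData.left, BinData.right, hcons i hi, BinData.ofUnary_succ]
        rw [h₄] at h₃
        exact ⟨_, by omega, h₃⟩)
      (by
        have h₁ : (y L.length).size ≤ 2 * (E L).size := hy L.length le_rfl
        have h₃ := TreeProg.Runs.left (y L.length)
        rw [show (y L.length).left = BinData.leaf by
          simp [y, BinData.left, BinData.ofList]] at h₃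
        exact ⟨_, by omega, h₃⟩)
      (by have : (y L.length).size ≤ 2 * (E L).size := hy L.length le_rfl; omega)
    refine ⟨s, hs.trans ?_, by simpa [y, E, BinData.ofUnary_zero, BinData.ofList] using h⟩
    have h₂ : L.length ≤ (E L).size := by
      have := hlen L
      simp only [E, BinData.size]
      omega
    simp only [Polynomial.eval_mul, Polynomial.eval_add, Polynomial.eval_one,
      Polynomial.eval_X, Polynomial.eval_ofNat]
    gcongr
  exact (TreeComputable.comp (F := l) hloop (hl.node TreeComputable.leaf)).right

namespace BinData

theorem left_iterate_right_ofList (l : List BinData) (j : ℕ) :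
    (right^[j] (ofList l)).left = l.getD j leaf := by
  induction l generalizing j with
  | nil =>
    have : right^[j] leaf = leaf := by
      induction j with
      | zero => rfl
      | succ j ih => rw [Function.iterate_succ_apply]; exact ih
    simp [ofList, this, left]
  | cons a l ih =>
    cases j with
    | zero => rfl
    | succ j => rw [Function.iterate_succ_apply]; exact ih j

end BinData

theorem TreeComputable.getD {X : Type*} {enc : X → BinData} {l : X → List BinData} {j : X → ℕ}
    (hl : TreeComputable enc (fun x => BinData.ofList (l x))) (hj : UnaryComputable enc j) :
    TreeComputable enc (fun x => (l x).getD (j x) BinData.leaf) := by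
  obtain ⟨T, hT⟩ := hl.size_le
  have h := TreeComputable.iterate (encA := id) (step := fun _ => BinData.right) hj hl
    (TreeComputable.self.left.right) ⟨T, fun x i hi => by
      refine le_trans ?_ (hT x)
      clear hi
      induction i with
      | zero => rfl
      | succ i ih =>
        rw [Function.iterate_succ_apply']
        exact (BinData.size_right_le _).trans ih⟩
  exact h.left.congr fun x => BinData.left_iterate_right_ofList _ _

/-- With the least significant bit first, 2^e is a string of e zero bits followed by a one. A unary
exponent thus suffices to write the output in polynomial time. -/
theorem BinData.ofBinary_two_pow (e : ℕ) :
    ofBinary (2 ^ e) = (fun t => node leaf t)^[e] (node (node leaf leaf) leaf) := by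
  induction e with
  | zero => simp [ofBinary, ofList, ofBool]
  | succ e ih =>
    rw [Function.iterate_succ_apply', ← ih, pow_succ, mul_comm]
    have : (2 * 2 ^ e).bits = false :: (2 ^ e).bits := Nat.bit0_bits _ (by positivity)
    simp [ofBinary, this, ofList, ofBool]

theorem TreeComputable.ofBinary_two_pow {X : Type*} {enc : X → BinData} {e : X → ℕ}
    (he : UnaryComputable enc e) :
    TreeComputable enc (fun x => BinData.ofBinary (2 ^ e x)) := by
  have key : ∀ i, ((fun t => BinData.node BinData.leaf t)^[i]
      (BinData.node (BinData.node BinData.leaf BinData.leaf) BinData.leaf)).size = 2 * i + 5 := by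
    intro i
    induction i with
    | zero => rfl
    | succ i ih => rw [Function.iterate_succ_apply', BinData.size, ih, BinData.size]; ring
  obtain ⟨T, hT⟩ := he.le_eval
  have h := TreeComputable.iterate (encA := id) (step := fun _ t => BinData.node BinData.leaf t)
    (init := fun _ => BinData.node (BinData.node BinData.leaf BinData.leaf) BinData.leaf) he
    ((TreeComputable.leaf.node TreeComputable.leaf).node TreeComputable.leaf)
    (TreeComputable.leaf.node TreeComputable.self.left) ⟨T + 4, fun x i hi => by
      have := hT x
      simp only [id, key, Polynomial.eval_add, Polynomial.eval_ofNat]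
      omega⟩
  exact h.congr fun x => (BinData.ofBinary_two_pow _).symm

/-! ## The certification algorithm -/

namespace CertInput

variable {k : ℕ}

/-- The `i`-th vertex of the `j`-th hyperedge. -/
def vert (a : CertInput k) (j i : ℕ) : ℕ :=
  if h : j < a.edges.length ∧ i < k then (a.edges.get ⟨j, h.1⟩ ⟨i, h.2⟩ : ℕ) else 0

/-- The first `k - 2` vertices of the hyperedge lie below the largest power of two that is at
most `n`. -/
def InSlab (a : CertInput k) (j : ℕ) : Prop :=
  ∀ i < k - 2, a.vert j i < 2 ^ Nat.log 2 a.n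

/-- The first `k - 2` vertices of two hyperedges lie in the same blocks of length `s`. -/
def SameClass (a : CertInput k) (s j₀ j : ℕ) : Prop :=
  a.InSlab j ∧ ∀ i < k - 2, a.vert j i / s = a.vert j₀ i / s

open Classical in
/-- The number of hyperedges in the class of `j₀`. -/
noncomputable def classSize (a : CertInput k) (s j₀ : ℕ) : ℕ :=
  ∑ j ∈ Finset.range a.edges.length, if a.SameClass s j₀ j then 1 else 0

open Classical in
/-- The adjacency matrix of the graph of the last two vertices of the hyperedges in a class. -/
noncomputable def adj (a : CertInput k) (s j₀ u v : ℕ) : ℕ :=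
  ∑ j ∈ Finset.range a.edges.length, if a.SameClass s j₀ j then
    (if a.vert j (k - 2) = u ∧ a.vert j (k - 1) = v then 1 else 0) +
    (if a.vert j (k - 2) = v ∧ a.vert j (k - 1) = u then 1 else 0) else 0

/-- The adjacency matrix, scaled and shifted to total sum zero. -/
noncomputable def shiftedAdj (a : CertInput k) (s j₀ u v : ℕ) : ℤ :=
  ((a.n ^ 2 * a.adj s j₀ u v : ℕ) : ℤ) - ((2 * a.classSize s j₀ : ℕ) : ℤ)

/-- The powers of the shifted adjacency matrix. -/
noncomputable def shiftedPow (a : CertInput k) (s j₀ : ℕ) : ℕ → ℕ → ℕ → ℤ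
  | 0, u, v => ((if u = v then 1 else 0 : ℕ) : ℤ)
  | l + 1, u, v => ∑ w ∈ Finset.range a.n, a.shiftedAdj s j₀ u w * a.shiftedPow s j₀ l w v

/-- The spectral test for a class: a degree condition, and a bound on the trace of the `ℓ`-th
power of the shifted adjacency matrix. -/
def Expands (ℓ : ℕ) (a : CertInput k) (s j₀ : ℕ) : Prop :=
  (∀ u < a.n, a.classSize s j₀ ≤ a.n * ∑ v ∈ Finset.range a.n, a.adj s j₀ u v) ∧
  ((2 ^ ℓ : ℕ) : ℤ) * ∑ u ∈ Finset.range a.n, a.shiftedPow s j₀ ℓ u u ≤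
    (((a.n * a.classSize s j₀) ^ ℓ : ℕ) : ℤ)

open Classical in
/-- The number of hyperedges whose first `k - 2` vertices lie in the slab. -/
noncomputable def slabSize (a : CertInput k) : ℕ :=
  ∑ j ∈ Finset.range a.edges.length, if a.InSlab j then 1 else 0

/-- Every class for the block length `s` passes the spectral test. -/
def Valid (ℓ : ℕ) (a : CertInput k) (s : ℕ) : Prop :=
  0 < a.slabSize ∧ ∀ j < a.edges.length, a.InSlab j → a.Expands ℓ s j

/-- The binary logarithm of the bound for the block length `s`. -/
noncomputable def bound (a : CertInput k) (s : ℕ) : ℕ :=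
  1 + (k - 2) * Nat.log 2 a.n + (k - 2) * s +
    (8 * a.n * a.budget / a.slabSize) * (Nat.log 2 a.n + 1)

/-- The number `i` is below the bounds for all valid block lengths. -/
def BelowBounds (ℓ : ℕ) (a : CertInput k) (i : ℕ) : Prop :=
  ∀ s < a.n, a.Valid ℓ (s + 1) → i < a.bound (s + 1)

open Classical in
/-- The minimum of `n` and the bounds for all valid block lengths. -/
noncomputable def exponent (ℓ : ℕ) (a : CertInput k) : ℕ :=
  ∑ i ∈ Finset.range a.n, if a.BelowBounds ℓ i then 1 else 0

/-! ### The certificate is computable in polynomial time -/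

section Computable

variable {X : Type*} {enc : X → BinData} {inp : X → CertInput k} {s j₀ j u v : X → ℕ}

theorem computable_n (h : TreeComputable enc (fun x => (inp x).encode)) :
    UnaryComputable enc (fun x => (inp x).n) := h.left

theorem computable_budget (h : TreeComputable enc (fun x => (inp x).encode)) :
    UnaryComputable enc (fun x => (inp x).budget) := h.right.right

theorem computable_length (h : TreeComputable enc (fun x => (inp x).encode)) :
    UnaryComputable enc (fun x => (inp x).edges.length) :=
  (UnaryComputable.length (l := fun x => (inp x).edges.map fun U =>
    BinData.ofList (List.ofFn fun i => BinData.ofUnary (U i : ℕ))) h.right.left).congr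
    fun x => by simp

theorem computable_vert (h : TreeComputable enc (fun x => (inp x).encode))
    (hj : UnaryComputable enc j) (i : ℕ) :
    UnaryComputable enc (fun x => (inp x).vert (j x) i) := by
  have h₁ := TreeComputable.getD (l := fun x => (inp x).edges.map fun U =>
    BinData.ofList (List.ofFn fun i => BinData.ofUnary (U i : ℕ))) h.right.left hj
  have h₂ : TreeComputable enc (fun x => BinData.ofList
      (if hx : j x < (inp x).edges.length then
        List.ofFn fun i => BinData.ofUnary ((inp x).edges[j x] i : ℕ) else [])) := by
    refine h₁.congr fun x => ?_
    rw [List.getD_eq_getElem?_getD, List.getElem?_map]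
    split
    · next hx => simp [hx]
    · next hx => simp [List.getElem?_eq_none (not_lt.1 hx), BinData.ofList]
  have h₃ := TreeComputable.getD h₂ (UnaryComputable.const i)
  refine h₃.congr fun x => ?_
  unfold vert
  rw [List.getD_eq_getElem?_getD]
  by_cases hx : j x < (inp x).edges.length
  · by_cases hi : i < k
    · simp [hx, hi]
    · simp [hx, hi, BinData.ofUnary, BinData.ofList]
  · simp [hx, BinData.ofUnary, BinData.ofList]

theorem computable_inSlab (h : TreeComputable enc (fun x => (inp x).encode))
    (hj : UnaryComputable enc j) : PredComputable enc (fun x => (inp x).InSlab (j x)) := by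
  refine (PredComputable.forall_const (k - 2) fun i _ =>
    UnaryComputable.lt (computable_vert h hj i) (UnaryComputable.min_two_pow
      (UnaryComputable.log_two (computable_n h)) (computable_n h))).congr fun x => ?_
  unfold InSlab
  refine forall₂_congr fun i hi => ?_
  -- The truncation at n + 1 is inactive, as the power of two is at most n; for n = 0 the truncated
  -- and the true value are both 1.
  rcases Nat.eq_zero_or_pos (inp x).n with h0 | h0
  · simp [h0]
  · rw [min_eq_left ((Nat.pow_log_le_self 2 h0.ne').trans (Nat.le_succ _))]

theorem computable_sameClass (h : TreeComputable enc (fun x => (inp x).encode))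
    (hs : UnaryComputable enc s) (hj₀ : UnaryComputable enc j₀) (hj : UnaryComputable enc j) :
    PredComputable enc (fun x => (inp x).SameClass (s x) (j₀ x) (j x)) :=
  (computable_inSlab h hj).and (PredComputable.forall_const (k - 2) fun i _ =>
    UnaryComputable.eq ((computable_vert h hj i).div hs) ((computable_vert h hj₀ i).div hs))

theorem computable_classSize (h : TreeComputable enc (fun x => (inp x).encode))
    (hs : UnaryComputable enc s) (hj₀ : UnaryComputable enc j₀) :
    UnaryComputable enc (fun x => (inp x).classSize (s x) (j₀ x)) := by
  classical
  exact (computable_length h).sum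
    (F := fun j x => if (inp x).SameClass (s x) (j₀ x) j then 1 else 0)
    (computable_sameClass h.weaken hs.weaken hj₀.weaken .var).indicator

theorem computable_adj (h : TreeComputable enc (fun x => (inp x).encode))
    (hs : UnaryComputable enc s) (hj₀ : UnaryComputable enc j₀) (hu : UnaryComputable enc u)
    (hv : UnaryComputable enc v) :
    UnaryComputable enc (fun x => (inp x).adj (s x) (j₀ x) (u x) (v x)) := by
  classical
  have h₁ := computable_vert h.weaken UnaryComputable.var (k - 2)
  have h₂ := computable_vert h.weaken UnaryComputable.var (k - 1)
  exact (computable_length h).sum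
    (F := fun j x => if (inp x).SameClass (s x) (j₀ x) j then
      (if (inp x).vert j (k - 2) = u x ∧ (inp x).vert j (k - 1) = v x then 1 else 0) +
      (if (inp x).vert j (k - 2) = v x ∧ (inp x).vert j (k - 1) = u x then 1 else 0) else 0)
    ((computable_sameClass h.weaken hs.weaken hj₀.weaken .var).ite
      (((h₁.eq hu.weaken).and (h₂.eq hv.weaken)).indicator.add
        ((h₁.eq hv.weaken).and (h₂.eq hu.weaken)).indicator) (.const 0))

theorem computable_shiftedAdj (h : TreeComputable enc (fun x => (inp x).encode))
    (hs : UnaryComputable enc s) (hj₀ : UnaryComputable enc j₀) (hu : UnaryComputable enc u)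
    (hv : UnaryComputable enc v) :
    IntComputable enc (fun x => (inp x).shiftedAdj (s x) (j₀ x) (u x) (v x)) :=
  (IntComputable.natCast (((computable_n h).pow 2).mul (computable_adj h hs hj₀ hu hv))).sub
    (IntComputable.natCast ((UnaryComputable.const 2).mul (computable_classSize h hs hj₀)))

/-- Induction on the exponent, which is fixed and not part of the input; each step adds one sum. The
context type is generalized because the summation index extends it at every step. -/
theorem computable_shiftedPow (l : ℕ) {X : Type*} {enc : X → BinData} {inp : X → CertInput k}
    {s j₀ u v : X → ℕ} (h : TreeComputable enc (fun x => (inp x).encode))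
    (hs : UnaryComputable enc s) (hj₀ : UnaryComputable enc j₀) (hu : UnaryComputable enc u)
    (hv : UnaryComputable enc v) :
    IntComputable enc (fun x => (inp x).shiftedPow (s x) (j₀ x) l (u x) (v x)) := by
  induction l generalizing X with
  | zero => exact IntComputable.natCast (hu.eq hv).indicator
  | succ l ih =>
    exact IntComputable.sum (computable_n h)
      (F := fun w x => (inp x).shiftedAdj (s x) (j₀ x) (u x) w *
        (inp x).shiftedPow (s x) (j₀ x) l w (v x))
      ((computable_shiftedAdj h.weaken hs.weaken hj₀.weaken hu.weaken .var).mul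
        (ih h.weaken hs.weaken hj₀.weaken .var hv.weaken))

theorem computable_expands (ℓ : ℕ) (h : TreeComputable enc (fun x => (inp x).encode))
    (hs : UnaryComputable enc s) (hj₀ : UnaryComputable enc j₀) :
    PredComputable enc (fun x => (inp x).Expands ℓ (s x) (j₀ x)) := by
  refine PredComputable.and ?_ ?_
  · have h₁ : UnaryComputable (BinData.pushEnc enc) (fun p => (inp p.2).n) :=
      computable_n h.weaken
    have h₂ : UnaryComputable (BinData.pushEnc (BinData.pushEnc enc))
        (fun p => (inp p.2.2).adj (s p.2.2) (j₀ p.2.2) p.2.1 p.1) :=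
      computable_adj (inp := fun p : ℕ × ℕ × X => inp p.2.2) h.weaken.weaken hs.weaken.weaken
        hj₀.weaken.weaken (UnaryComputable.var (enc := enc)).weaken .var
    have h₃ := h₁.sum (F := fun v p => (inp p.2).adj (s p.2) (j₀ p.2) p.1 v) h₂
    have h₄ : UnaryComputable (BinData.pushEnc enc)
        (fun p => (inp p.2).classSize (s p.2) (j₀ p.2)) :=
      computable_classSize h.weaken hs.weaken hj₀.weaken
    exact PredComputable.forall_lt (computable_n h)
      (R := fun u x => (inp x).classSize (s x) (j₀ x) ≤
        (inp x).n * ∑ v ∈ Finset.range (inp x).n, (inp x).adj (s x) (j₀ x) u v)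
      (h₄.le (h₁.mul h₃))
  · exact IntComputable.le ((IntComputable.natCast (.const _)).mul
      (IntComputable.sum (computable_n h)
        (F := fun u x => (inp x).shiftedPow (s x) (j₀ x) ℓ u u)
        (computable_shiftedPow ℓ h.weaken hs.weaken hj₀.weaken .var .var)))
      (IntComputable.natCast (((computable_n h).mul (computable_classSize h hs hj₀)).pow ℓ))

theorem computable_slabSize (h : TreeComputable enc (fun x => (inp x).encode)) :
    UnaryComputable enc (fun x => (inp x).slabSize) := by
  classical
  exact (computable_length h).sum (F := fun j x => if (inp x).InSlab j then 1 else 0)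
    (computable_inSlab h.weaken .var).indicator

theorem computable_valid (ℓ : ℕ) (h : TreeComputable enc (fun x => (inp x).encode))
    (hs : UnaryComputable enc s) : PredComputable enc (fun x => (inp x).Valid ℓ (s x)) :=
  (UnaryComputable.lt (.const 0) (computable_slabSize h)).and
    (PredComputable.forall_lt (computable_length h)
      (R := fun j x => (inp x).InSlab j → (inp x).Expands ℓ (s x) j)
      ((computable_inSlab h.weaken .var).imp (computable_expands ℓ h.weaken hs.weaken .var)))

theorem computable_bound (h : TreeComputable enc (fun x => (inp x).encode))
    (hs : UnaryComputable enc s) : UnaryComputable enc (fun x => (inp x).bound (s x)) :=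
  (((UnaryComputable.const 1).add ((UnaryComputable.const (k - 2)).mul
    (computable_n h).log_two)).add ((UnaryComputable.const (k - 2)).mul hs)).add
    (((((UnaryComputable.const 8).mul (computable_n h)).mul (computable_budget h)).div
      (computable_slabSize h)).mul (computable_n h).log_two.succ)

theorem computable_valid_imp (ℓ : ℕ) {i s : X → ℕ} (h : TreeComputable enc (fun x => (inp x).encode))
    (hs : UnaryComputable enc s) (hi : UnaryComputable enc i) :
    PredComputable enc (fun x => (inp x).Valid ℓ (s x) → i x < (inp x).bound (s x)) :=
  (computable_valid ℓ h hs).imp (hi.lt (computable_bound h hs))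

theorem computable_belowBounds (ℓ : ℕ) {i : X → ℕ}
    (h : TreeComputable enc (fun x => (inp x).encode))
    (hi : UnaryComputable enc i) :
    PredComputable enc (fun x => (inp x).BelowBounds ℓ (i x)) := by
  unfold BelowBounds
  have h' := computable_valid_imp ℓ h.weaken UnaryComputable.var.succ hi.weaken
  exact PredComputable.forall_lt (computable_n h)
    (R := fun s x => (inp x).Valid ℓ (s + 1) → i x < (inp x).bound (s + 1)) h'

theorem computable_exponent (ℓ : ℕ) (h : TreeComputable enc (fun x => (inp x).encode)) :
    UnaryComputable enc (fun x => (inp x).exponent ℓ) := by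
  classical
  exact (computable_n h).sum (F := fun i x => if (inp x).BelowBounds ℓ i then 1 else 0)
    (computable_belowBounds ℓ h.weaken .var).indicator

end Computable

theorem polyTimeComputable_two_pow_exponent (ℓ : ℕ) :
    PolyTimeComputable CertInput.encode BinData.ofBinary
      (fun a : CertInput k => 2 ^ a.exponent ℓ) :=
  TreeComputable.ofBinary_two_pow (computable_exponent ℓ (inp := fun a : CertInput k => a)
    TreeComputable.self)

end CertInput

/-! ## Expansion from traces of powers -/

section Expansion

variable {ι : Type*} [Fintype ι]

theorem dotProduct_sq_le (f g : ι → ℝ) : (f ⬝ᵥ g) ^ 2 ≤ (f ⬝ᵥ f) * (g ⬝ᵥ g) := by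
  simpa [dotProduct, sq] using Finset.sum_mul_sq_le_sq_mul_sq Finset.univ f g

theorem dotProduct_self_nonneg_real (f : ι → ℝ) : 0 ≤ f ⬝ᵥ f :=
  Finset.sum_nonneg fun _ _ => mul_self_nonneg _

theorem Matrix.mulVec_dotProduct_mulVec_of_isSymm {A : Matrix ι ι ℝ} (hA : A.IsSymm) (f : ι → ℝ) :
    (A.mulVec f) ⬝ᵥ (A.mulVec f) = f ⬝ᵥ (A * A).mulVec f := by
  rw [← Matrix.mulVec_mulVec, Matrix.dotProduct_mulVec f, ← Matrix.mulVec_transpose, hA.eq]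

theorem Matrix.IsSymm.pow_real [DecidableEq ι] {A : Matrix ι ι ℝ} (hA : A.IsSymm) (m : ℕ) : (A ^ m).IsSymm := by
  rw [Matrix.IsSymm, Matrix.transpose_pow, hA.eq]

/-- Repeated Cauchy–Schwarz: squaring ⟨f, A^m f⟩ costs a factor ⟨f, f⟩ and doubles m, by symmetry.
This replaces the spectral theorem and explains why the exponents are powers of two. -/
theorem Matrix.dotProduct_mulVec_pow_le_dotProduct_pow_mulVec [DecidableEq ι]
    {A : Matrix ι ι ℝ} (hA : A.IsSymm)
    (f : ι → ℝ) (q : ℕ) :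
    (f ⬝ᵥ A.mulVec f) ^ (2 ^ (q + 1)) ≤
      (f ⬝ᵥ f) ^ (2 ^ (q + 1) - 1) * (f ⬝ᵥ (A ^ (2 ^ (q + 1))).mulVec f) := by
  induction q with
  | zero =>
    have h := dotProduct_sq_le f (A.mulVec f)
    rw [mulVec_dotProduct_mulVec_of_isSymm hA] at h
    simpa [sq] using h
  | succ q ih =>
    have h₀ := dotProduct_self_nonneg_real f
    set m := 2 ^ (q + 1) with hm
    have hm1 : 1 ≤ m := Nat.one_le_two_pow
    have hm2 : 2 ^ (q + 1 + 1) = m + m := by rw [pow_succ, ← hm]; ring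
    have h₁ : 0 ≤ (f ⬝ᵥ A.mulVec f) ^ m := by
      rw [hm, pow_succ, mul_comm, pow_mul]; positivity
    have h₂ := pow_le_pow_left₀ h₁ ih 2
    have h₃ := dotProduct_sq_le f ((A ^ m).mulVec f)
    rw [mulVec_dotProduct_mulVec_of_isSymm (hA.pow_real m), ← pow_add] at h₃
    rw [hm2]
    calc (f ⬝ᵥ A.mulVec f) ^ (m + m) = ((f ⬝ᵥ A.mulVec f) ^ m) ^ 2 := by ring
      _ ≤ ((f ⬝ᵥ f) ^ (m - 1) * (f ⬝ᵥ (A ^ m).mulVec f)) ^ 2 := h₂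
      _ = ((f ⬝ᵥ f) ^ (m - 1)) ^ 2 * (f ⬝ᵥ (A ^ m).mulVec f) ^ 2 := by ring
      _ ≤ ((f ⬝ᵥ f) ^ (m - 1)) ^ 2 * ((f ⬝ᵥ f) * (f ⬝ᵥ (A ^ (m + m)).mulVec f)) := by gcongr
      _ = (f ⬝ᵥ f) ^ (m + m - 1) * (f ⬝ᵥ (A ^ (m + m)).mulVec f) := by
        rw [← pow_mul, ← mul_assoc, ← pow_succ]
        congr 2
        omega

/-- Cauchy–Schwarz in each row; the trace of Q² is the sum of the squared entries of the symmetric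
matrix Q. -/
theorem Matrix.dotProduct_mul_self_mulVec_le {Q : Matrix ι ι ℝ} (hQ : Q.IsSymm) (f : ι → ℝ) :
    f ⬝ᵥ (Q * Q).mulVec f ≤ (Q * Q).trace * (f ⬝ᵥ f) := by
  rw [← mulVec_dotProduct_mulVec_of_isSymm hQ, Matrix.trace, Finset.sum_mul, dotProduct]
  refine Finset.sum_le_sum fun i _ => ?_
  have h := dotProduct_sq_le (Q i) f
  have e : (Q * Q).diag i = Q i ⬝ᵥ Q i := by
    rw [Matrix.diag_apply, Matrix.mul_apply, dotProduct]
    exact Finset.sum_congr rfl fun j _ => by rw [hQ.apply]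
  rw [e, ← sq]
  exact h

/-- The quadratic form of a symmetric matrix is controlled by the traces of its powers. -/
theorem Matrix.dotProduct_mulVec_pow_le_trace [DecidableEq ι]
    {A : Matrix ι ι ℝ} (hA : A.IsSymm)
    (f : ι → ℝ) (q : ℕ) :
    (f ⬝ᵥ A.mulVec f) ^ (2 ^ (q + 1)) ≤
      (A ^ (2 ^ (q + 1))).trace * (f ⬝ᵥ f) ^ (2 ^ (q + 1)) := by
  have h₀ := dotProduct_self_nonneg_real f
  have h₁ := dotProduct_mulVec_pow_le_dotProduct_pow_mulVec hA f q
  have h₂ := dotProduct_mul_self_mulVec_le (hA.pow_real (2 ^ q)) f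
  rw [← pow_add, ← two_mul, ← pow_succ'] at h₂
  have h₃ : 1 ≤ 2 ^ (q + 1) := Nat.one_le_two_pow
  calc _ ≤ _ := h₁
    _ ≤ (f ⬝ᵥ f) ^ (2 ^ (q + 1) - 1) * ((A ^ (2 ^ (q + 1))).trace * (f ⬝ᵥ f)) := by gcongr
    _ = (A ^ (2 ^ (q + 1))).trace * ((f ⬝ᵥ f) ^ (2 ^ (q + 1) - 1) * (f ⬝ᵥ f)) := by ring
    _ = _ := by rw [← pow_succ, Nat.sub_add_cancel h₃]

theorem Matrix.dotProduct_mulVec_le_of_trace_le [DecidableEq ι]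
    {A : Matrix ι ι ℝ} (hA : A.IsSymm)
    {θ : ℝ} (hθ : 0 ≤ θ) (q : ℕ) (h : (A ^ (2 ^ (q + 1))).trace ≤ θ ^ (2 ^ (q + 1)))
    (f : ι → ℝ) : f ⬝ᵥ A.mulVec f ≤ θ * (f ⬝ᵥ f) := by
  have h₀ := dotProduct_self_nonneg_real f
  have h₁ := dotProduct_mulVec_pow_le_trace hA f q
  refine le_of_pow_le_pow_left₀ (n := 2 ^ (q + 1)) (by positivity) (by positivity) (h₁.trans ?_)
  rw [mul_pow]
  gcongr

/-- A spectral gap gives edge expansion. -/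
theorem Matrix.card_mul_card_compl_le_cut [DecidableEq ι] {B : Matrix ι ι ℝ} (hB : B.IsSymm)
    {D θ : ℝ} (hdeg : ∀ u, D ≤ ∑ v, B u v)
    (hgap : ∀ f : ι → ℝ, ∑ i, f i = 0 → f ⬝ᵥ B.mulVec f ≤ θ * (f ⬝ᵥ f)) (Z : Finset ι) :
    (D - θ) * (Z.card * Zᶜ.card) ≤ Fintype.card ι * ∑ u ∈ Z, ∑ v ∈ Zᶜ, B u v := by
  rcases isEmpty_or_nonempty ι with hι | hι
  · simp [Finset.eq_empty_of_isEmpty Z]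
  set n : ℝ := (Fintype.card ι : ℝ) with hn
  have hn0 : 0 < n := by rw [hn]; exact_mod_cast Fintype.card_pos
  have hcompl : (Zᶜ.card : ℝ) = n - Z.card := by
    rw [Finset.card_compl, Nat.cast_sub (Finset.card_le_univ Z)]
  set z : ι → ℝ := fun i => if i ∈ Z then 1 else 0 with hz
  have hzsum : ∑ i, z i = Z.card := by simp [hz]
  have hzsq : ∑ i, z i * z i = Z.card := by simp [hz]
  set f : ι → ℝ := fun i => z i - Z.card / n with hf
  have hfsum : ∑ i, f i = 0 := by
    simp only [hf, Finset.sum_sub_distrib, hzsum, Finset.sum_const, Finset.card_univ,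
      nsmul_eq_mul, ← hn]
    field_simp
    ring
  have hff : f ⬝ᵥ f = Z.card * Zᶜ.card / n := by
    have : f ⬝ᵥ f = ∑ i, z i * z i - 2 * (Z.card / n) * ∑ i, z i + n * (Z.card / n) ^ 2 := by
      have e : ∀ i, f i * f i = z i * z i - 2 * (Z.card / n) * z i + (Z.card / n) ^ 2 :=
        fun i => by simp only [hf]; ring
      rw [dotProduct, Finset.sum_congr rfl fun i _ => e i, Finset.sum_add_distrib,
        Finset.sum_sub_distrib, ← Finset.mul_sum, Finset.sum_const, Finset.card_univ,
        nsmul_eq_mul]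
    rw [this, hzsum, hzsq, hcompl]
    field_simp
    ring
  -- The cut is the Laplacian quadratic form of the indicator z. This form does not change under
  -- constant shifts, so z may be replaced by its centred version f, to which the gap applies.
  have hcut : ∑ u ∈ Z, ∑ v ∈ Zᶜ, B u v = ∑ u, (∑ v, B u v) * (f u * f u) - f ⬝ᵥ B.mulVec f := by
    have e₁ : ∑ u ∈ Z, ∑ v ∈ Zᶜ, B u v = ∑ u, ∑ v, B u v * (z u * (1 - z v)) := by
      rw [← Finset.sum_subset (Finset.subset_univ Z)]
      · refine Finset.sum_congr rfl fun u hu => ?_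
        rw [← Finset.sum_subset (Finset.subset_univ Zᶜ)]
        · refine Finset.sum_congr rfl fun v hv => ?_
          simp [hz, hu, Finset.mem_compl.1 hv]
        · intro v _ hv
          have : v ∈ Z := by simpa using hv
          simp [hz, this]
      · intro u _ hu
        simp [hz, hu]
    have e₂ : ∑ u, ∑ v, B u v * (z u * (1 - z v)) = ∑ u, ∑ v, B u v * (z v * (1 - z u)) := by
      rw [Finset.sum_comm]
      exact Finset.sum_congr rfl fun u _ => Finset.sum_congr rfl fun v _ => by rw [hB.apply]
    have e₃ : ∑ u, (∑ v, B u v) * (f u * f u) = ∑ u, ∑ v, B u v * (f v * f v) := by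
      rw [Finset.sum_comm]
      refine Finset.sum_congr rfl fun u _ => ?_
      rw [Finset.sum_mul]
      exact Finset.sum_congr rfl fun v _ => by rw [hB.apply]
    have e₄ : f ⬝ᵥ B.mulVec f = ∑ u, ∑ v, B u v * (f u * f v) := by
      rw [dotProduct]
      refine Finset.sum_congr rfl fun u _ => ?_
      rw [Matrix.mulVec, dotProduct, Finset.mul_sum]
      exact Finset.sum_congr rfl fun v _ => by ring
    have e₅ : ∑ u, (∑ v, B u v) * (f u * f u) = ∑ u, ∑ v, B u v * (f u * f u) :=
      Finset.sum_congr rfl fun u _ => Finset.sum_mul _ _ _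
    have e₆ : ∑ u, ∑ v, B u v * (z u * (1 - z v)) + ∑ u, ∑ v, B u v * (z v * (1 - z u)) =
        ∑ u, ∑ v, B u v * (f u * f u) + ∑ u, ∑ v, B u v * (f v * f v) -
          2 * ∑ u, ∑ v, B u v * (f u * f v) := by
      simp only [Finset.mul_sum, ← Finset.sum_add_distrib, ← Finset.sum_sub_distrib]
      refine Finset.sum_congr rfl fun u _ => Finset.sum_congr rfl fun v _ => ?_
      have hu : z u * z u = z u := by simp [hz]
      have hv : z v * z v = z v := by simp [hz]
      simp only [hf]
      linear_combination (-(B u v)) * hu - B u v * hv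
    linarith
  have h₁ : D * (f ⬝ᵥ f) ≤ ∑ u, (∑ v, B u v) * (f u * f u) := by
    rw [dotProduct, Finset.mul_sum]
    exact Finset.sum_le_sum fun u _ => mul_le_mul_of_nonneg_right (hdeg u) (mul_self_nonneg _)
  have h₂ := hgap f hfsum
  have h₃ : (D - θ) * (f ⬝ᵥ f) ≤ ∑ u ∈ Z, ∑ v ∈ Zᶜ, B u v := by
    rw [hcut]; linarith
  rw [hff, mul_div_assoc', div_le_iff₀ hn0] at h₃
  linarith

end Expansion

/-! ## Soundness of the algorithm -/

/-- The number of sets of bounded size. -/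
theorem Finset.card_filter_card_le_pow {ι : Type*} [Fintype ι] [DecidableEq ι] (t : ℕ) :
    (Finset.univ.filter fun Z : Finset ι => Z.card ≤ t).card ≤ (Fintype.card ι + 1) ^ t := by
  have h : (Finset.univ.filter fun Z : Finset ι => Z.card ≤ t) ⊆
      -- A set of at most t elements is listed by t slots, each holding an element or `none`.
      Finset.univ.image (fun g : Fin t → Option ι => (Finset.univ.image g).eraseNone) := by
    intro Z hZ
    have hZ : Z.card ≤ t := by simpa using hZ
    let e := Z.equivFin
    refine Finset.mem_image.2 ⟨fun i => if h : (i : ℕ) < Z.card then some (e.symm ⟨i, h⟩).1 else none,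
      Finset.mem_univ _, ?_⟩
    ext v
    simp only [Finset.mem_eraseNone, Finset.mem_image, Finset.mem_univ, true_and]
    constructor
    · rintro ⟨i, hi⟩
      split at hi
      · simp only [Option.some.injEq] at hi
        rw [← hi]
        exact Subtype.prop _
      · cases hi
    · intro hv
      refine ⟨⟨e ⟨v, hv⟩, (e ⟨v, hv⟩).2.trans_le hZ⟩, ?_⟩
      simp
  refine (Finset.card_le_card h).trans (Finset.card_image_le.trans ?_)
  simp

/-! ### The spectral test implies cut expansion -/

namespace CertInput

variable {k : ℕ}

theorem vert_eq (a : CertInput k) (j : Fin a.edges.length) (i : Fin k) :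
    a.vert j i = (a.edges.get j i : ℕ) := by
  simp [vert]

theorem vert_lt (a : CertInput k) (hn : 0 < a.n) (j i : ℕ) : a.vert j i < a.n := by
  unfold vert
  split
  · exact Fin.isLt _
  · exact hn

theorem adj_comm (a : CertInput k) (s j₀ u v : ℕ) : a.adj s j₀ u v = a.adj s j₀ v u := by
  unfold adj
  refine Finset.sum_congr rfl fun j _ => ?_
  split
  · rw [add_comm]
  · rfl

/-- The adjacency matrix as a real matrix. -/
noncomputable def adjMatrix (a : CertInput k) (s j₀ : ℕ) : Matrix (Fin a.n) (Fin a.n) ℝ :=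
  fun u v => (a.adj s j₀ u v : ℝ)

/-- The shifted adjacency matrix as a real matrix. -/
noncomputable def shiftedMatrix (a : CertInput k) (s j₀ : ℕ) : Matrix (Fin a.n) (Fin a.n) ℝ :=
  fun u v => (a.shiftedAdj s j₀ u v : ℝ)

theorem shiftedMatrix_pow (a : CertInput k) (s j₀ l : ℕ) (u v : Fin a.n) :
    (a.shiftedMatrix s j₀ ^ l) u v = (a.shiftedPow s j₀ l u v : ℝ) := by
  induction l generalizing u with
  | zero =>
    simp only [pow_zero, Matrix.one_apply, shiftedPow, Fin.ext_iff]
    split <;> simp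
  | succ l ih =>
    rw [pow_succ', Matrix.mul_apply, shiftedPow, Finset.sum_range]
    push_cast
    exact Finset.sum_congr rfl fun w _ => by rw [ih]; rfl

theorem trace_shiftedMatrix_pow (a : CertInput k) (s j₀ l : ℕ) :
    (a.shiftedMatrix s j₀ ^ l).trace =
      ((∑ u ∈ Finset.range a.n, a.shiftedPow s j₀ l u u : ℤ) : ℝ) := by
  rw [Matrix.trace, Finset.sum_range]
  push_cast
  exact Finset.sum_congr rfl fun u _ => a.shiftedMatrix_pow s j₀ l u u

theorem adjMatrix_isSymm (a : CertInput k) (s j₀ : ℕ) : (a.adjMatrix s j₀).IsSymm := by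
  ext u v
  simp [adjMatrix, a.adj_comm s j₀ u v]

theorem shiftedMatrix_isSymm (a : CertInput k) (s j₀ : ℕ) : (a.shiftedMatrix s j₀).IsSymm := by
  ext u v
  simp [shiftedMatrix, shiftedAdj, a.adj_comm s j₀ u v]

/-- On vectors of sum zero the constant shift disappears, so the form of the shifted matrix is n²
times that of the adjacency matrix. With e hyperedges in the class, the trace test bounds the latter
by e/(2n) times the squared norm, half of the minimum degree e/n that the test guarantees. The cut
bound then applies with gap e/(2n). -/
theorem Expands.classSize_mul_min_le {a : CertInput k} {q s j₀ : ℕ}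
    (h : a.Expands (2 ^ (q + 1)) s j₀) (Z : Finset (Fin a.n)) :
    a.classSize s j₀ * min Z.card Zᶜ.card ≤
      4 * a.n * ∑ u ∈ Z, ∑ v ∈ Zᶜ, a.adj s j₀ u v := by
  rcases Nat.eq_zero_or_pos a.n with h0 | hn
  · have : Z = ∅ := by
      have : IsEmpty (Fin a.n) := by rw [h0]; infer_instance
      exact Finset.eq_empty_of_isEmpty Z
    simp [this]
  obtain ⟨hdeg, htr⟩ := h
  set e : ℝ := (a.classSize s j₀ : ℝ) with he
  have hn' : (0 : ℝ) < a.n := by exact_mod_cast hn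
  have htr' : (a.shiftedMatrix s j₀ ^ (2 ^ (q + 1))).trace ≤ (a.n * e / 2) ^ (2 ^ (q + 1)) := by
    have := (Int.cast_le (R := ℝ)).2 htr
    rw [trace_shiftedMatrix_pow, div_pow, le_div_iff₀ (by positivity), mul_comm]
    push_cast at this ⊢
    rw [he]
    exact this
  have hquad := Matrix.dotProduct_mulVec_le_of_trace_le (a.shiftedMatrix_isSymm s j₀)
    (by positivity) q htr'
  have hgap : ∀ f : Fin a.n → ℝ, ∑ i, f i = 0 →
      f ⬝ᵥ (a.adjMatrix s j₀).mulVec f ≤ e / (2 * a.n) * (f ⬝ᵥ f) := by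
    intro f hf
    have h₁ := hquad f
    have h₂ : f ⬝ᵥ (a.shiftedMatrix s j₀).mulVec f =
        a.n ^ 2 * (f ⬝ᵥ (a.adjMatrix s j₀).mulVec f) := by
      have e₁ : (a.shiftedMatrix s j₀).mulVec f =
          fun u => (a.n : ℝ) ^ 2 * (a.adjMatrix s j₀).mulVec f u := by
        funext u
        have : ∑ v, (2 * e) * f v = 0 := by rw [← Finset.mul_sum, hf, mul_zero]
        have h₅ : ∀ v, a.shiftedMatrix s j₀ u v * f v =
            a.n ^ 2 * (a.adjMatrix s j₀ u v * f v) - (2 * e) * f v := by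
          intro v
          simp only [shiftedMatrix, shiftedAdj, adjMatrix, he]
          push_cast
          ring
        rw [Matrix.mulVec, Matrix.mulVec, dotProduct, dotProduct, Finset.mul_sum,
          Finset.sum_congr rfl fun v _ => h₅ v, Finset.sum_sub_distrib, this, sub_zero]
      rw [e₁, dotProduct, dotProduct, Finset.mul_sum]
      exact Finset.sum_congr rfl fun u _ => by ring
    rw [h₂] at h₁
    have h₃ : f ⬝ᵥ (a.adjMatrix s j₀).mulVec f ≤ (a.n * e / 2 * (f ⬝ᵥ f)) / a.n ^ 2 := by
      rw [le_div_iff₀ (by positivity)]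
      linarith
    refine h₃.trans (le_of_eq ?_)
    field_simp
  have hcut := Matrix.card_mul_card_compl_le_cut (a.adjMatrix_isSymm s j₀) (D := e / a.n)
    (fun u => by
      have h₁ := hdeg u u.2
      rw [Finset.sum_range] at h₁
      rw [div_le_iff₀ hn', mul_comm]
      have h₂ : (a.classSize s j₀ : ℝ) ≤ ((a.n * ∑ v : Fin a.n, a.adj s j₀ u v : ℕ) : ℝ) := by
        exact_mod_cast h₁
      push_cast at h₂
      exact h₂) hgap Z
  have hsum : (Z.card : ℝ) + Zᶜ.card = a.n := by
    have := Finset.card_add_card_compl Z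
    rw [Fintype.card_fin] at this
    exact_mod_cast this
  -- The larger of the two sides has at least n/2 elements.
  have hmin : (a.n : ℝ) * min (Z.card : ℝ) Zᶜ.card ≤ 2 * (Z.card * Zᶜ.card) := by
    rw [← hsum]
    have h₁ : (0 : ℝ) ≤ Z.card := by positivity
    have h₂ : (0 : ℝ) ≤ Zᶜ.card := by positivity
    rcases le_total (Z.card : ℝ) Zᶜ.card with h | h
    · rw [min_eq_left h]; nlinarith
    · rw [min_eq_right h]; nlinarith
  have hfin : e * min (Z.card : ℝ) Zᶜ.card ≤
      4 * a.n * ∑ u ∈ Z, ∑ v ∈ Zᶜ, a.adjMatrix s j₀ u v := by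
    rw [Fintype.card_fin] at hcut
    have e₁ : e / a.n - e / (2 * a.n) = e / (2 * a.n) := by field_simp; ring
    rw [e₁, div_mul_eq_mul_div, div_le_iff₀ (by positivity)] at hcut
    have e₀ : 0 ≤ e := by positivity
    have := mul_le_mul_of_nonneg_left hmin e₀
    have h₅ : a.n * (e * min (Z.card : ℝ) Zᶜ.card) ≤
        a.n * (4 * a.n * ∑ u ∈ Z, ∑ v ∈ Zᶜ, a.adjMatrix s j₀ u v) := by
      nlinarith
    exact le_of_mul_le_mul_left h₅ hn'
  have : ((a.classSize s j₀ * min Z.card Zᶜ.card : ℕ) : ℝ) ≤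
      ((4 * a.n * ∑ u ∈ Z, ∑ v ∈ Zᶜ, a.adj s j₀ u v : ℕ) : ℝ) := by
    push_cast
    exact hfin
  exact_mod_cast this

end CertInput

/-! ### Counting assignments through one class -/

namespace CertInput

variable {k : ℕ}

open Classical in
theorem classSize_eq_card (a : CertInput k) (s j₀ : ℕ) :
    a.classSize s j₀ =
      (Finset.univ.filter fun j : Fin a.edges.length => a.SameClass s j₀ j).card := by
  rw [classSize, Finset.sum_range, Finset.card_filter]

open Classical in
theorem slabSize_eq_card (a : CertInput k) :
    a.slabSize = (Finset.univ.filter fun j : Fin a.edges.length => a.InSlab j).card := by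
  rw [slabSize, Finset.sum_range, Finset.card_filter]

theorem sameClass_congr {a : CertInput k} {s j₀ j₁ : ℕ}
    (h : ∀ i < k - 2, a.vert j₀ i / s = a.vert j₁ i / s) (j : ℕ) :
    a.SameClass s j₀ j ↔ a.SameClass s j₁ j := by
  unfold SameClass
  exact and_congr_right fun _ => forall₂_congr fun i hi => by rw [h i hi]

open Classical in
/-- The size of a cut, as the number of hyperedges whose last two vertices are separated. -/
theorem sum_adj_eq_card (a : CertInput k) (s j₀ : ℕ) (Z : Finset (Fin a.n)) :
    ∑ u ∈ Z, ∑ v ∈ Zᶜ, a.adj s j₀ u v =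
      (Finset.univ.filter fun j : Fin a.edges.length => a.SameClass s j₀ j ∧
        ((∃ u ∈ Z, a.vert j (k - 2) = u) ∧ (∃ v ∈ Zᶜ, a.vert j (k - 1) = v) ∨
        (∃ v ∈ Zᶜ, a.vert j (k - 2) = v) ∧ (∃ u ∈ Z, a.vert j (k - 1) = u))).card := by
  have key : ∀ (S T : Finset (Fin a.n)) (x y : ℕ),
      (∑ u ∈ S, ∑ v ∈ T, if x = (u : ℕ) ∧ y = (v : ℕ) then 1 else 0) =
        if (∃ u ∈ S, x = (u : ℕ)) ∧ (∃ v ∈ T, y = (v : ℕ)) then 1 else 0 := by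
    intro S T x y
    have h₁ : ∀ (S : Finset (Fin a.n)) (x : ℕ), (∑ u ∈ S, if x = (u : ℕ) then 1 else 0) =
        if ∃ u ∈ S, x = (u : ℕ) then 1 else 0 := by
      intro S x
      split
      · next h =>
        obtain ⟨u, hu, rfl⟩ := h
        simp [← Fin.ext_iff, hu]
      · next h =>
        push Not at h
        exact Finset.sum_eq_zero fun u hu => if_neg (h u hu)
    calc _ = (∑ u ∈ S, if x = (u : ℕ) then 1 else 0) * ∑ v ∈ T, if y = (v : ℕ) then 1 else 0 := by
          rw [Finset.sum_mul_sum]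
          refine Finset.sum_congr rfl fun u _ => Finset.sum_congr rfl fun v _ => ?_
          by_cases hx : x = (u : ℕ) <;> by_cases hy : y = (v : ℕ) <;> simp [hx, hy]
      _ = _ := by
          rw [h₁, h₁]
          by_cases hx : ∃ u ∈ S, x = (u : ℕ) <;> by_cases hy : ∃ v ∈ T, y = (v : ℕ) <;>
            simp only [hx, hy, and_self, and_true, and_false, if_true, if_false, mul_one, mul_zero]
  rw [Finset.card_filter]
  simp only [adj, Finset.sum_range]
  rw [Finset.sum_congr rfl fun u _ => Finset.sum_comm, Finset.sum_comm]
  refine Finset.sum_congr rfl fun j _ => ?_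
  by_cases hj : a.SameClass s j₀ j
  · simp only [hj, if_true, true_and, Finset.sum_add_distrib]
    rw [key, Finset.sum_comm, key]
    by_cases h₁ : (∃ u ∈ Z, a.vert j (k - 2) = (u : ℕ)) ∧ (∃ v ∈ Zᶜ, a.vert j (k - 1) = (v : ℕ))
    · have h₂ : ¬ ((∃ v ∈ Zᶜ, a.vert j (k - 2) = (v : ℕ)) ∧
          (∃ u ∈ Z, a.vert j (k - 1) = (u : ℕ))) := by
        rintro ⟨⟨v, hv, hv'⟩, -⟩
        obtain ⟨⟨u, hu, hu'⟩, -⟩ := h₁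
        have : u = v := Fin.ext (hu'.symm.trans hv')
        subst this
        exact Finset.mem_compl.1 hv hu
      simp only [h₁, h₂, if_true, if_false, or_false, and_self]
    · simp only [h₁, if_false, false_or, zero_add]
  · simp [hj]

/-- Two assignments that agree on the blocks of a class are separated only by a small set. -/
theorem classSize_mul_min_le_of_agree {a : CertInput k} (hk : 2 ≤ k) {q s j₀ : ℕ}
    (hexp : a.Expands (2 ^ (q + 1)) s j₀) (b : Fin a.edges.length → ℤˣ) (x y : Fin a.n → ℤˣ)
    (hagree : ∀ j : Fin a.edges.length, a.SameClass s j₀ j → ∀ i : Fin k, (i : ℕ) < k - 2 →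
      x (a.edges.get j i) = y (a.edges.get j i)) :
    a.classSize s j₀ * min (Finset.univ.filter fun v => x v ≠ y v).card
      (Finset.univ.filter fun v => x v ≠ y v)ᶜ.card ≤
    4 * a.n * (Nat.card {j : Fin a.edges.length // a.SameClass s j₀ j ∧
        ∏ i, x (a.edges.get j i) ≠ b j} +
      Nat.card {j : Fin a.edges.length // a.SameClass s j₀ j ∧
        ∏ i, y (a.edges.get j i) ≠ b j}) := by
  classical
  refine (hexp.classSize_mul_min_le _).trans (Nat.mul_le_mul_left _ ?_)
  rw [sum_adj_eq_card, Nat.card_eq_fintype_card, Nat.card_eq_fintype_card, Fintype.card_subtype,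
    Fintype.card_subtype]
  refine (Finset.card_le_card ?_).trans (Finset.card_union_le _ _)
  intro j hj
  simp only [Finset.mem_filter, Finset.mem_univ, true_and, Finset.mem_union] at hj ⊢
  obtain ⟨hc, hsep⟩ := hj
  by_contra hcon
  push Not at hcon
  have hx := hcon.1 hc
  have hy := hcon.2 hc
  -- If both assignments satisfy the hyperedge, the sign cancels in the product of the two clauses.
  -- By agreement the first k-2 factors cancel as well, so x·y takes equal values at the last two
  -- vertices, and these are not separated.
  have hprod : ∏ i, (x (a.edges.get j i) * y (a.edges.get j i)) = 1 := by
    rw [Finset.prod_mul_distrib, hx, hy, Int.units_mul_self]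
  let i₁ : Fin k := ⟨k - 2, by omega⟩
  let i₂ : Fin k := ⟨k - 1, by omega⟩
  have h12 : i₁ ≠ i₂ := by
    intro h
    have := congrArg Fin.val h
    simp only [i₁, i₂] at this
    omega
  have hv₁ : a.vert j (k - 2) = (a.edges.get j i₁ : ℕ) := a.vert_eq j i₁
  have hv₂ : a.vert j (k - 1) = (a.edges.get j i₂ : ℕ) := a.vert_eq j i₂
  have hprod₂ : ∏ i, (x (a.edges.get j i) * y (a.edges.get j i)) =
      (x (a.edges.get j i₁) * y (a.edges.get j i₁)) *
        (x (a.edges.get j i₂) * y (a.edges.get j i₂)) := by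
    refine Finset.prod_eq_mul i₁ i₂ h12 (fun i _ hi => ?_) (by simp) (by simp)
    have hi' : (i : ℕ) < k - 2 := by
      have h₁ : (i : ℕ) ≠ k - 2 := fun h => hi.1 (Fin.ext h)
      have h₂ : (i : ℕ) ≠ k - 1 := fun h => hi.2 (Fin.ext h)
      have := i.2
      omega
    rw [hagree j hc i hi', Int.units_mul_self]
  rw [hprod₂] at hprod
  simp only [hv₁, hv₂, Finset.mem_compl, Finset.mem_filter, Finset.mem_univ, true_and, not_not,
    ← Fin.ext_iff] at hsep
  rcases hsep with ⟨⟨u, hu, rfl⟩, ⟨v, hv, rfl⟩⟩ | ⟨⟨u, hu, rfl⟩, ⟨v, hv, rfl⟩⟩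
  · rw [hv, Int.units_mul_self, mul_one] at hprod
    exact hu (by rw [← mul_one (x _), ← Int.units_mul_self (y _), ← mul_assoc, hprod, one_mul])
  · rw [hu, Int.units_mul_self, one_mul] at hprod
    exact hv (by rw [← mul_one (x _), ← Int.units_mul_self (y _), ← mul_assoc, hprod, one_mul])

open Classical in
/-- Some class receives at most its share of the violated clauses. -/
theorem exists_class_card_le (a : CertInput k) (s : ℕ) (hslab : 0 < a.slabSize)
    (V : Finset (Fin a.edges.length)) (hV : V.card ≤ a.budget) :
    ∃ j₀ : Fin a.edges.length, a.InSlab j₀ ∧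
      (V.filter fun j : Fin a.edges.length => a.SameClass s j₀ j).card * a.slabSize ≤
        a.budget * a.classSize s j₀ := by
  set H := Finset.univ.filter fun j : Fin a.edges.length => a.InSlab j with hH
  let τ : Fin a.edges.length → (Fin (k - 2) → ℕ) := fun j i => a.vert j i / s
  have hclass : ∀ j₀ j : Fin a.edges.length, a.SameClass s j₀ j ↔ j ∈ H ∧ τ j = τ j₀ := by
    intro j₀ j
    simp only [SameClass, hH, Finset.mem_filter, Finset.mem_univ, true_and, τ, funext_iff]
    exact and_congr_right fun _ => ⟨fun h i => h i i.2, fun h i hi => h ⟨i, hi⟩⟩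
  -- Summing the reverse strict inequality over all classes would make the violated clauses in the
  -- slab exceed the budget.
  by_contra! hcon
  have h₁ : ∑ t ∈ H.image τ, (H.filter fun j => τ j = t).card = a.slabSize := by
    rw [slabSize_eq_card, ← Finset.card_eq_sum_card_image]
  have h₂ : ∑ t ∈ H.image τ, ((V ∩ H).filter fun j => τ j = t).card ≤ a.budget := by
    rw [← Finset.card_eq_sum_card_fiberwise]
    · exact (Finset.card_le_card Finset.inter_subset_left).trans hV
    · intro j hj
      exact Finset.mem_image_of_mem _ (Finset.mem_inter.1 hj).2
  have hne : (H.image τ).Nonempty := by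
    rw [slabSize_eq_card, Finset.card_pos] at hslab
    exact hslab.image _
  have h₃ : ∑ t ∈ H.image τ, a.budget * (H.filter fun j => τ j = t).card <
      ∑ t ∈ H.image τ, ((V ∩ H).filter fun j => τ j = t).card * a.slabSize := by
    refine Finset.sum_lt_sum_of_nonempty hne fun t ht => ?_
    obtain ⟨j₀, hj₀, rfl⟩ := Finset.mem_image.1 ht
    have h := hcon j₀ (by simpa [hH] using hj₀)
    rw [classSize_eq_card] at h
    have e₁ : (V.filter fun j : Fin a.edges.length => a.SameClass s j₀ j) =
        (V ∩ H).filter fun j => τ j = τ j₀ := by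
      ext j; simp [hclass, and_assoc]
    have e₂ : (Finset.univ.filter fun j : Fin a.edges.length => a.SameClass s j₀ j) =
        H.filter fun j => τ j = τ j₀ := by
      ext j; simp [hclass]
    rwa [e₁, e₂] at h
  rw [← Finset.mul_sum, h₁, ← Finset.sum_mul] at h₃
  exact absurd h₃ (not_lt.2 (Nat.mul_le_mul_right _ h₂))

/-- Each assignment is mapped to the block indices of a class in which it violates few clauses and
to its values on these blocks. Within a fibre, all assignments are compared with one reference, and
expansion leaves at most 2(n+1)^t possible sets of disagreement. -/
theorem Valid.card_le_two_pow_bound {a : CertInput k} (hk : 2 ≤ k) {q s : ℕ}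
    (hs : 0 < s)
    (hvalid : a.Valid (2 ^ (q + 1)) s) (b : Fin a.edges.length → ℤˣ)
    (X : Finset (Fin a.n → ℤˣ))
    (hX : ∀ x ∈ X, (Finset.univ.filter fun j => ∏ i, x (a.edges.get j i) ≠ b j).card ≤ a.budget) :
    X.card ≤ 2 ^ a.bound s := by
  classical
  obtain ⟨hslab, hexp⟩ := hvalid
  have hcl : ∀ x : Fin a.n → ℤˣ, ∃ j₀ : Fin a.edges.length, x ∈ X → (a.InSlab j₀ ∧
      Nat.card {j : Fin a.edges.length // a.SameClass s j₀ j ∧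
        ∏ i, x (a.edges.get j i) ≠ b j} * a.slabSize ≤ a.budget * a.classSize s j₀) := by
    intro x
    by_cases hx : x ∈ X
    · obtain ⟨j₀, h₁, h₂⟩ := a.exists_class_card_le s hslab _ (hX x hx)
      refine ⟨j₀, fun _ => ⟨h₁, ?_⟩⟩
      rw [Finset.filter_filter] at h₂
      rw [Nat.card_eq_fintype_card, Fintype.card_subtype]
      simpa only [and_comm] using h₂
    · have : 0 < a.edges.length := by
        rw [slabSize_eq_card, Finset.card_pos] at hslab
        obtain ⟨j, -⟩ := hslab
        exact j.pos
      exact ⟨⟨0, this⟩, fun h => absurd h hx⟩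
  choose J hJ using hcl
  set N := 2 ^ Nat.log 2 a.n with hN
  have hNpos : 0 < N := by positivity
  let xval : (Fin a.n → ℤˣ) → ℕ → ℤˣ := fun x m => if h : m < a.n then x ⟨m, h⟩ else 1
  -- The reduction modulo N only puts the index into `Fin N`: for a class in the slab the block
  -- index is below N already, so nothing is lost. Positions beyond n get the value 1 through
  -- `xval`.
  let Ψ : (Fin a.n → ℤˣ) → (Fin (k - 2) → Fin N) × (Fin (k - 2) → Fin s → ℤˣ) := fun x =>
    (fun i => ⟨(a.vert (J x) i / s) % N, Nat.mod_lt _ hNpos⟩,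
      fun i r => xval x (s * (a.vert (J x) i / s) + r))
  set t := 8 * a.n * a.budget / a.slabSize with ht
  have hfib : ∀ y ∈ (Finset.univ : Finset ((Fin (k - 2) → Fin N) × (Fin (k - 2) → Fin s → ℤˣ))),
      (X.filter fun x => Ψ x = y).card ≤ 2 * (a.n + 1) ^ t := by
    intro y _
    rcases (X.filter fun x => Ψ x = y).eq_empty_or_nonempty with h0 | ⟨x₀, hx₀⟩
    · rw [h0]; simp
    obtain ⟨hx₀X, hx₀y⟩ := Finset.mem_filter.1 hx₀
    let D : (Fin a.n → ℤˣ) → Finset (Fin a.n) := fun x => Finset.univ.filter fun v => x v ≠ x₀ v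
    have hD : ∀ x ∈ X.filter fun x => Ψ x = y, (D x).card ≤ t ∨ (D x)ᶜ.card ≤ t := by
      intro x hx
      obtain ⟨hxX, hxy⟩ := Finset.mem_filter.1 hx
      have hΨ : Ψ x = Ψ x₀ := hxy.trans hx₀y.symm
      have hblock : ∀ i < k - 2, a.vert (J x) i / s = a.vert (J x₀) i / s := by
        intro i hi
        have h₁ := congrFun (congrArg Prod.fst hΨ) ⟨i, hi⟩
        have h₂ := congrArg Fin.val h₁
        simp only [Ψ] at h₂
        have h₃ : a.vert (J x) i / s < N :=
          (Nat.div_le_self _ _).trans_lt ((hJ x hxX).1 i hi)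
        have h₄ : a.vert (J x₀) i / s < N :=
          (Nat.div_le_self _ _).trans_lt ((hJ x₀ hx₀X).1 i hi)
        rwa [Nat.mod_eq_of_lt h₃, Nat.mod_eq_of_lt h₄] at h₂
      have hsame := sameClass_congr hblock
      have hagree : ∀ j : Fin a.edges.length, a.SameClass s (J x) j → ∀ i : Fin k,
          (i : ℕ) < k - 2 → x (a.edges.get j i) = x₀ (a.edges.get j i) := by
        intro j hj i hi
        have h₁ := congrFun (congrFun (congrArg Prod.snd hΨ) ⟨i, hi⟩)
          ⟨a.vert j i % s, Nat.mod_lt _ hs⟩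
        simp only [Ψ] at h₁
        rw [← hj.2 i hi, ← ((hsame j).1 hj).2 i hi, Nat.div_add_mod, a.vert_eq j i] at h₁
        simpa [xval] using h₁
      have hmain := classSize_mul_min_le_of_agree hk
        (hexp (J x) (J x).2 (hJ x hxX).1) b x x₀ hagree
      have hb₁ := (hJ x hxX).2
      have hb₂ := (hJ x₀ hx₀X).2
      have hsize : a.classSize s (J x₀) = a.classSize s (J x) := by
        rw [classSize_eq_card, classSize_eq_card]
        congr 1
        ext j
        simp [hsame]
      rw [hsize] at hb₂
      simp only [← hsame] at hb₂
      set v₁ := Nat.card {j : Fin a.edges.length // a.SameClass s (J x) j ∧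
        ∏ i, x (a.edges.get j i) ≠ b j}
      set v₂ := Nat.card {j : Fin a.edges.length // a.SameClass s (J x) j ∧
        ∏ i, x₀ (a.edges.get j i) ≠ b j}
      have hpos : 0 < a.classSize s (J x) := by
        rw [classSize_eq_card, Finset.card_pos]
        exact ⟨J x, Finset.mem_filter.2 ⟨Finset.mem_univ _, (hJ x hxX).1, fun _ _ => rfl⟩⟩
      -- The factor 8 in t is the 4 of the expansion bound, doubled because x and the reference each
      -- violate up to their share.
      have hle : min (D x).card (D x)ᶜ.card ≤ t := by
        rw [ht, Nat.le_div_iff_mul_le hslab]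
        refine Nat.le_of_mul_le_mul_left ?_ hpos
        calc a.classSize s (J x) * (min (D x).card (D x)ᶜ.card * a.slabSize)
            = (a.classSize s (J x) * min (D x).card (D x)ᶜ.card) * a.slabSize := by ring
          _ ≤ (4 * a.n * (v₁ + v₂)) * a.slabSize := Nat.mul_le_mul_right _ hmain
          _ = 4 * a.n * (v₁ * a.slabSize + v₂ * a.slabSize) := by ring
          _ ≤ 4 * a.n * (a.budget * a.classSize s (J x) + a.budget * a.classSize s (J x)) := by
            gcongr
          _ = a.classSize s (J x) * (8 * a.n * a.budget) := by ring
      exact min_le_iff.1 hle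
    -- There are only two signs, so the reference and the set of disagreement determine the
    -- assignment.
    have hinj : Function.Injective D := by
      intro x x' h
      funext v
      have h₁ : (x v ≠ x₀ v) ↔ (x' v ≠ x₀ v) := by
        have := Finset.ext_iff.1 h v
        simpa [D] using this
      rcases Int.units_eq_one_or (x v) with h₂ | h₂ <;>
      rcases Int.units_eq_one_or (x' v) with h₃ | h₃ <;>
      rcases Int.units_eq_one_or (x₀ v) with h₄ | h₄ <;>
      simp_all
    have hsub : (X.filter fun x => Ψ x = y).image D ⊆
        (Finset.univ.filter fun Z : Finset (Fin a.n) => Z.card ≤ t) ∪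
        (Finset.univ.filter fun Z : Finset (Fin a.n) => Z.card ≤ t).image compl := by
      intro Z hZ
      obtain ⟨x, hx, rfl⟩ := Finset.mem_image.1 hZ
      rcases hD x hx with h | h
      · exact Finset.mem_union_left _ (by simpa using h)
      · refine Finset.mem_union_right _ (Finset.mem_image.2 ⟨(D x)ᶜ, ?_, compl_compl _⟩)
        rw [Finset.mem_filter]
        exact ⟨Finset.mem_univ _, h⟩
    have hcount := Finset.card_filter_card_le_pow (ι := Fin a.n) t
    rw [Fintype.card_fin] at hcount
    calc (X.filter fun x => Ψ x = y).card
        = ((X.filter fun x => Ψ x = y).image D).card := (Finset.card_image_of_injective _ hinj).symm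
      _ ≤ _ := Finset.card_le_card hsub
      _ ≤ _ := Finset.card_union_le _ _
      _ ≤ (a.n + 1) ^ t + (a.n + 1) ^ t :=
        Nat.add_le_add hcount (Finset.card_image_le.trans hcount)
      _ = 2 * (a.n + 1) ^ t := by ring
  have htot := Finset.card_le_mul_card_image_of_maps_to (f := Ψ) (s := X)
    (t := Finset.univ) (fun x _ => Finset.mem_univ _) (2 * (a.n + 1) ^ t) hfib
  have hcard : (Finset.univ : Finset ((Fin (k - 2) → Fin N) × (Fin (k - 2) → Fin s → ℤˣ))).card =
      N ^ (k - 2) * 2 ^ ((k - 2) * s) := by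
    simp only [Finset.card_univ, Fintype.card_prod, Fintype.card_fun, Fintype.card_fin,
      Fintype.card_units_int]
    rw [mul_comm (k - 2) s, pow_mul]
  rw [hcard] at htot
  refine htot.trans ?_
  have hlog : a.n + 1 ≤ 2 ^ (Nat.log 2 a.n + 1) := Nat.lt_pow_succ_log_self (by norm_num) _
  calc 2 * (a.n + 1) ^ t * (N ^ (k - 2) * 2 ^ ((k - 2) * s))
      ≤ 2 * (2 ^ (Nat.log 2 a.n + 1)) ^ t * (N ^ (k - 2) * 2 ^ ((k - 2) * s)) := by gcongr
    _ = 2 ^ a.bound s := by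
      rw [bound, ← ht, hN, ← pow_mul, ← pow_mul, ← pow_add, ← pow_succ', ← pow_add]
      congr 1
      ring

theorem exponent_le_n (a : CertInput k) (ℓ : ℕ) : a.exponent ℓ ≤ a.n := by
  classical
  rw [exponent, ← Finset.card_filter]
  exact (Finset.card_filter_le _ _).trans (by simp)

theorem Valid.exponent_le_bound {a : CertInput k} {ℓ s : ℕ} (hs : 0 < s) (hsn : s ≤ a.n)
    (h : a.Valid ℓ s) : a.exponent ℓ ≤ a.bound s := by
  classical
  obtain ⟨s, rfl⟩ : ∃ s', s = s' + 1 := ⟨s - 1, by omega⟩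
  rw [exponent, ← Finset.card_filter, ← Finset.card_range (a.bound (s + 1))]
  refine Finset.card_le_card fun i hi => ?_
  rw [Finset.mem_range]
  exact (Finset.mem_filter.1 hi).2 s hsn h

/-- The exponent counts an initial segment of the numbers below n, so it is the minimum of n and the
valid bounds. If it were below n and below every valid bound, then it would itself be counted,
together with everything below it. -/
theorem exponent_eq_n_or_exists (a : CertInput k) (ℓ : ℕ) :
    a.exponent ℓ = a.n ∨ ∃ s, 0 < s ∧ a.Valid ℓ s ∧ a.bound s ≤ a.exponent ℓ := by
  classical
  by_contra! hcon
  obtain ⟨h₁, h₂⟩ := hcon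
  have h₃ : a.exponent ℓ < a.n := lt_of_le_of_ne (a.exponent_le_n ℓ) h₁
  have h₄ : Finset.range (a.exponent ℓ + 1) ⊆
      (Finset.range a.n).filter fun i => a.BelowBounds ℓ i := by
    intro i hi
    rw [Finset.mem_range] at hi
    rw [Finset.mem_filter, Finset.mem_range]
    refine ⟨by omega, fun s _ hs => ?_⟩
    have := h₂ (s + 1) (by omega) hs
    omega
  have h₅ := Finset.card_le_card h₄
  rw [Finset.card_range, Finset.card_filter] at h₅
  exact absurd h₅ (by rw [← exponent]; omega)

theorem _root_.List.card_filter_get_cast {α : Type*} (l : List α) (p : α → Prop)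
    [DecidablePred p] {m : ℕ} (hm : m = l.length) :
    (Finset.univ.filter fun j : Fin m => p (l.get (Fin.cast hm j))).card =
      l.countP fun c => p c := by
  subst hm
  induction l with
  | nil => simp
  | cons c l ih =>
    rw [Finset.card_filter] at ih ⊢
    refine (Fin.sum_univ_succ (n := l.length) _).trans ?_
    rw [List.countP_cons, add_comm, ← ih]
    by_cases hc : p c <;> simp [hc]

/-- An approximately satisfying assignment violates at most η|L| clauses, hence at most the floor
that the algorithm receives. The bound of a valid block length applies for any signs; if no bound is
attained, the output is the trivial 2^n. -/
theorem certifiesAllSignings (hk : 2 ≤ k) (q : ℕ) :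
    CertifiesAllSignings (fun a : CertInput k => 2 ^ a.exponent (2 ^ (q + 1))) := by
  classical
  rintro n L η hη₀ - Φ rfl
  set a : CertInput k := certInput Φ.hypergraph η with ha
  have han : a.n = n := rfl
  have hlen : a.edges.length = Φ.length := by
    change (Φ.map Prod.snd).length = _
    simp
  let b : Fin a.edges.length → ℤˣ := fun j => (Φ.get (Fin.cast hlen j)).1
  have hedge : ∀ j : Fin a.edges.length, a.edges.get j = (Φ.get (Fin.cast hlen j)).2 := by
    intro j
    exact List.getElem_map _
  set X : Finset (Fin n → ℤˣ) := Finset.univ.filter fun x => Φ.IsApproxSat η x with hXdef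
  have hX : ∀ x ∈ X, (Finset.univ.filter fun j : Fin a.edges.length =>
      ∏ i, x (a.edges.get j i) ≠ b j).card ≤ a.budget := by
    intro x hx
    have hsat : Φ.IsApproxSat η x := (Finset.mem_filter.1 hx).2
    have h₁ : (Finset.univ.filter fun j : Fin a.edges.length =>
        ∏ i, x (a.edges.get j i) ≠ b j).card + Φ.numSat x = Φ.length := by
      have e₁ := List.card_filter_get_cast Φ (fun c => ¬ ∏ i, x (c.2 i) = c.1) hlen
      simp only [← hedge] at e₁
      have e₂ := List.length_eq_countP_add_countP (fun c => ∏ i, x (c.2 i) = c.1) (l := Φ)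
      have e₃ : (Finset.univ.filter fun j : Fin a.edges.length =>
          ∏ i, x (a.edges.get j i) ≠ b j).card =
          Φ.countP fun c => ¬ ∏ i, x (c.2 i) = c.1 := e₁
      rw [e₃, XorInstance.numSat, e₂, add_comm]
      simp
    refine Nat.le_floor ?_
    have h₃ : ((Φ.hypergraph).length : ℝ) = Φ.length := by simp [XorInstance.hypergraph]
    rw [h₃]
    unfold XorInstance.IsApproxSat at hsat
    have h₄ : ((Finset.univ.filter fun j : Fin a.edges.length =>
        ∏ i, x (a.edges.get j i) ≠ b j).card : ℝ) + (Φ.numSat x : ℝ) = Φ.length := by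
      exact_mod_cast h₁
    linarith
  have hgoal : X.card ≤ 2 ^ a.exponent (2 ^ (q + 1)) := by
    rcases a.exponent_eq_n_or_exists (2 ^ (q + 1)) with h | ⟨s, hs, hv, hb⟩
    · rw [h]
      exact (Finset.card_le_univ X).trans (by simp [han])
    · exact (hv.card_le_two_pow_bound hk hs b X hX).trans (Nat.pow_le_pow_right (by norm_num) hb)
  have : Φ.numApproxSat η = X.card := by
    rw [XorInstance.numApproxSat, ← Set.ncard_coe_finset]
    congr 1
    ext x
    simp [hXdef]
  rw [this]
  exact hgoal

end CertInput

/-! ## Norm bounds from discrepancy -/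

section Discrepancy

/-- Remove a smallest element. Among m+1 nonnegative values the smallest is at most the average, so
the hypothesis for the whole set gives that its square is at most β²/(m+1). Adding these bounds up
gives the harmonic number. -/
theorem sum_sq_le_of_sum_le_sqrt_card {ι : Type*} [DecidableEq ι] (φ : ι → ℝ) {β : ℝ}
    (P : Finset ι) (hφ : ∀ i ∈ P, 0 ≤ φ i)
    (h : ∀ S ⊆ P, ∑ i ∈ S, φ i ≤ β * Real.sqrt S.card) :
    ∑ i ∈ P, φ i ^ 2 ≤ β ^ 2 * (harmonic P.card : ℝ) := by
  induction hm : P.card generalizing P with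
  | zero => simp [Finset.card_eq_zero.1 hm]
  | succ m ih =>
    have hne : P.Nonempty := by rw [← Finset.card_pos]; omega
    obtain ⟨a, haP, hamin⟩ := Finset.exists_min_image P φ hne
    have h₁ : (P.card : ℝ) * φ a ≤ β * Real.sqrt P.card := by
      refine le_trans ?_ (h P subset_rfl)
      rw [← nsmul_eq_mul]
      exact Finset.card_nsmul_le_sum _ _ _ hamin
    have h₂ : φ a ^ 2 ≤ β ^ 2 * ((m : ℝ) + 1)⁻¹ := by
      have h₃ : (0 : ℝ) < P.card := by rw [hm]; positivity
      have h₄ := pow_le_pow_left₀ (mul_nonneg h₃.le (hφ a haP)) h₁ 2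
      rw [mul_pow, mul_pow, Real.sq_sqrt h₃.le] at h₄
      have h₅ : (P.card : ℝ) = m + 1 := by rw [hm]; push_cast; ring
      rw [h₅] at h₃ h₄
      rw [← div_eq_mul_inv, le_div_iff₀ h₃]
      nlinarith
    have h₆ := ih (P.erase a) (fun i hi => hφ i (Finset.mem_of_mem_erase hi))
      (fun S hS => h S (hS.trans (Finset.erase_subset _ _)))
      (by rw [Finset.card_erase_of_mem haP]; omega)
    rw [← Finset.add_sum_erase _ _ haP, harmonic_succ]
    push_cast
    linarith

variable {ι : Type*} [Fintype ι] [DecidableEq ι]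

/-- The nonnegative and the negative values are treated separately, whence the factor 2. -/
theorem sum_sq_le_of_abs_sum_le_sqrt_card (φ : ι → ℝ) {β : ℝ}
    (h : ∀ S : Finset ι, |∑ i ∈ S, φ i| ≤ β * Real.sqrt S.card) :
    ∑ i, φ i ^ 2 ≤ 2 * β ^ 2 * (harmonic (Fintype.card ι) : ℝ) := by
  classical
  have hmono : ∀ P : Finset ι, (harmonic P.card : ℝ) ≤ (harmonic (Fintype.card ι) : ℝ) := by
    intro P
    have : harmonic P.card ≤ harmonic (Fintype.card ι) :=
      Finset.sum_le_sum_of_subset_of_nonneg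
        (Finset.range_subset_range.2 (Finset.card_le_univ P)) (fun i _ _ => by positivity)
    exact_mod_cast this
  have h₁ := sum_sq_le_of_sum_le_sqrt_card φ (β := β) (Finset.univ.filter fun i => 0 ≤ φ i)
    (fun i hi => (Finset.mem_filter.1 hi).2) (fun S _ => (le_abs_self _).trans (h S))
  have h₂ := sum_sq_le_of_sum_le_sqrt_card (fun i => - φ i) (β := β)
    (Finset.univ.filter fun i => ¬ 0 ≤ φ i)
    (fun i hi => by have := (Finset.mem_filter.1 hi).2; linarith)
    (fun S _ => by rw [Finset.sum_neg_distrib]; exact (neg_le_abs _).trans (h S))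
  simp only [neg_sq] at h₂
  rw [← Finset.sum_filter_add_sum_filter_not _ (fun i => 0 ≤ φ i)]
  have h₃ := mul_le_mul_of_nonneg_left (hmono (Finset.univ.filter fun i => 0 ≤ φ i)) (sq_nonneg β)
  have h₄ := mul_le_mul_of_nonneg_left (hmono (Finset.univ.filter fun i => ¬ 0 ≤ φ i)) (sq_nonneg β)
  linarith

/-- A matrix all of whose rectangles have small sums has small operator norm. -/
theorem Matrix.mulVec_dotProduct_mulVec_le_of_discrepancy (N : Matrix ι ι ℝ) {α : ℝ}
    (h : ∀ S T : Finset ι, |∑ a ∈ S, ∑ b ∈ T, N a b| ≤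
      α * Real.sqrt (S.card * T.card)) (x : ι → ℝ) :
    N.mulVec x ⬝ᵥ N.mulVec x ≤
      (2 * α * (harmonic (Fintype.card ι) : ℝ)) ^ 2 * (x ⬝ᵥ x) := by
  set H : ℝ := (harmonic (Fintype.card ι) : ℝ) with hH
  have hH0 : 0 ≤ H := by
    have : 0 ≤ harmonic (Fintype.card ι) := Finset.sum_nonneg fun i _ => by positivity
    rw [hH]
    exact_mod_cast this
  have hx0 := dotProduct_self_nonneg_real x
  -- The scalar lemma is used twice: here for the column sums over a fixed S, and afterwards for the
  -- vector N x itself. Each use costs a factor 2H in the squared norm.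
  have h₁ : ∀ S : Finset ι, |∑ a ∈ S, N.mulVec x a| ≤
      Real.sqrt (2 * α ^ 2 * H * (x ⬝ᵥ x)) * Real.sqrt S.card := by
    intro S
    have e : ∑ a ∈ S, N.mulVec x a = (fun b => ∑ a ∈ S, N a b) ⬝ᵥ x := by
      simp only [Matrix.mulVec, dotProduct]
      rw [Finset.sum_comm]
      exact Finset.sum_congr rfl fun b _ => (Finset.sum_mul _ _ _).symm
    have h₂ := sum_sq_le_of_abs_sum_le_sqrt_card (fun b => ∑ a ∈ S, N a b)
      (β := α * Real.sqrt S.card) (fun T => by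
        rw [Finset.sum_comm, mul_assoc, ← Real.sqrt_mul (by positivity)]
        exact h S T)
    rw [mul_pow, Real.sq_sqrt (by positivity)] at h₂
    have h₃ := dotProduct_sq_le (fun b => ∑ a ∈ S, N a b) x
    rw [← Real.sqrt_mul (by positivity), e]
    refine Real.abs_le_sqrt (h₃.trans ?_)
    have h₄ : (fun b => ∑ a ∈ S, N a b) ⬝ᵥ (fun b => ∑ a ∈ S, N a b) =
        ∑ b, (∑ a ∈ S, N a b) ^ 2 := by
      simp only [dotProduct, sq]
    rw [h₄]
    calc _ ≤ 2 * (α ^ 2 * S.card) * H * (x ⬝ᵥ x) := by gcongr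
      _ = _ := by ring
  have h₅ := sum_sq_le_of_abs_sum_le_sqrt_card (N.mulVec x) h₁
  rw [Real.sq_sqrt (by positivity)] at h₅
  calc N.mulVec x ⬝ᵥ N.mulVec x = ∑ i, N.mulVec x i ^ 2 := by simp only [dotProduct, sq]
    _ ≤ _ := h₅
    _ = _ := by ring

/-- By symmetry a diagonal entry of A^(2m) is the squared norm of A^m applied to a basis vector. -/
theorem Matrix.trace_pow_le_of_mulVec_le {A : Matrix ι ι ℝ} (hA : A.IsSymm) {K : ℝ} (m : ℕ)
    (h : ∀ x : ι → ℝ, A.mulVec x ⬝ᵥ A.mulVec x ≤ K ^ 2 * (x ⬝ᵥ x)) :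
    (A ^ (2 * m)).trace ≤ Fintype.card ι * K ^ (2 * m) := by
  have h₁ : ∀ x : ι → ℝ, (A ^ m).mulVec x ⬝ᵥ (A ^ m).mulVec x ≤ K ^ (2 * m) * (x ⬝ᵥ x) := by
    intro x
    induction m with
    | zero => simp
    | succ m ih =>
      rw [pow_succ', ← Matrix.mulVec_mulVec]
      refine (h _).trans ?_
      calc K ^ 2 * _ ≤ K ^ 2 * (K ^ (2 * m) * (x ⬝ᵥ x)) := by gcongr
        _ = _ := by ring
  have h₂ : ∀ i, (A ^ (2 * m)) i i ≤ K ^ (2 * m) := by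
    intro i
    have h₃ := h₁ (Pi.single i 1)
    rw [Matrix.mulVec_dotProduct_mulVec_of_isSymm (hA.pow_real m), ← pow_add, ← two_mul] at h₃
    simpa using h₃
  rw [Matrix.trace, ← nsmul_eq_mul, ← Finset.card_univ]
  exact Finset.sum_le_card_nsmul _ _ _ fun i _ => h₂ i

/-- The norm of a symmetrized matrix of small discrepancy, up to a small constant matrix. -/
theorem Matrix.mulVec_dotProduct_mulVec_le_of_symmetrized [Nonempty ι] (N A : Matrix ι ι ℝ)
    {α c : ℝ}
    (h : ∀ S T : Finset ι, |∑ a ∈ S, ∑ b ∈ T, N a b| ≤ α * Real.sqrt (S.card * T.card))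
    (hc : |c| * Fintype.card ι ≤ 2 * α) (hA : ∀ a b, A a b = N a b + N b a + c) (x : ι → ℝ) :
    A.mulVec x ⬝ᵥ A.mulVec x ≤
      (6 * α * (harmonic (Fintype.card ι) : ℝ)) ^ 2 * (x ⬝ᵥ x) := by
  have h₁ := N.mulVec_dotProduct_mulVec_le_of_discrepancy h x
  have h₂ := N.transpose.mulVec_dotProduct_mulVec_le_of_discrepancy (α := α) (fun S T => by
    simp only [Matrix.transpose_apply]
    rw [Finset.sum_comm, mul_comm (S.card : ℝ)]
    exact h T S) x
  set H : ℝ := (harmonic (Fintype.card ι) : ℝ) with hH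
  have hH1 : 1 ≤ H := by
    have h₀ : harmonic 1 ≤ harmonic (Fintype.card ι) :=
      Finset.sum_le_sum_of_subset_of_nonneg
        (Finset.range_subset_range.2 Fintype.card_pos) (fun i _ _ => by positivity)
    rw [show harmonic 1 = 1 by simp [harmonic]] at h₀
    rw [hH]
    exact_mod_cast h₀
  have hx0 := dotProduct_self_nonneg_real x
  set X := x ⬝ᵥ x with hX
  have h₃ : (∑ b, c * x b) ^ 2 * Fintype.card ι ≤ 4 * α ^ 2 * X := by
    have h₄ := dotProduct_sq_le (fun _ : ι => (1 : ℝ)) x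
    have h₅ : (fun _ : ι => (1 : ℝ)) ⬝ᵥ (fun _ => 1) = Fintype.card ι := by simp [dotProduct]
    have h₆ : (fun _ : ι => (1 : ℝ)) ⬝ᵥ x = ∑ b, x b := by simp [dotProduct]
    rw [h₅, h₆] at h₄
    rw [← Finset.mul_sum, mul_pow]
    have h₇ := pow_le_pow_left₀ (by positivity) hc 2
    rw [mul_pow, sq_abs] at h₇
    calc c ^ 2 * (∑ b, x b) ^ 2 * Fintype.card ι
        ≤ c ^ 2 * (Fintype.card ι * X) * Fintype.card ι := by gcongr
      _ = c ^ 2 * (Fintype.card ι : ℝ) ^ 2 * X := by ring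
      _ ≤ (2 * α) ^ 2 * X := by gcongr
      _ = _ := by ring
  have h₄ : ∀ a, A.mulVec x a = N.mulVec x a + N.transpose.mulVec x a + ∑ b, c * x b := by
    intro a
    simp only [Matrix.mulVec, dotProduct, Matrix.transpose_apply, ← Finset.sum_add_distrib]
    exact Finset.sum_congr rfl fun b _ => by rw [hA]; ring
  have h₅ : A.mulVec x ⬝ᵥ A.mulVec x ≤ 3 * (N.mulVec x ⬝ᵥ N.mulVec x) +
      3 * (N.transpose.mulVec x ⬝ᵥ N.transpose.mulVec x) +
      3 * ((∑ b, c * x b) ^ 2 * Fintype.card ι) := by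
    have e : (∑ b, c * x b) ^ 2 * (Fintype.card ι : ℝ) = ∑ _a : ι, (∑ b, c * x b) ^ 2 := by
      rw [Finset.sum_const, Finset.card_univ, nsmul_eq_mul, mul_comm]
    rw [e, dotProduct, dotProduct, dotProduct, Finset.mul_sum, Finset.mul_sum, Finset.mul_sum,
      ← Finset.sum_add_distrib, ← Finset.sum_add_distrib]
    refine Finset.sum_le_sum fun a _ => ?_
    rw [h₄ a]
    nlinarith [sq_nonneg (N.mulVec x a - N.transpose.mulVec x a),
      sq_nonneg (N.mulVec x a - ∑ b, c * x b), sq_nonneg (N.transpose.mulVec x a - ∑ b, c * x b)]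
  have h₆ : α ^ 2 * X ≤ α ^ 2 * X * H ^ 2 :=
    le_mul_of_one_le_right (by positivity) (one_le_pow₀ hH1)
  calc _ ≤ _ := h₅
    _ ≤ 3 * ((2 * α * H) ^ 2 * X) + 3 * ((2 * α * H) ^ 2 * X) + 3 * (4 * α ^ 2 * X) := by gcongr
    -- The constants add up to 3·4 + 3·4 + 3·4 = 36; the last summand acquires its factor H² from H
    -- ≥ 1.
    _ ≤ (6 * α * H) ^ 2 * X := by nlinarith

end Discrepancy

/-! ### Quasirandom classes pass the spectral test -/

namespace CertInput

variable {k : ℕ}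

open Classical in
/-- The number of hyperedges in a class whose last two vertices are `u` and `v`. -/
noncomputable def endCount (a : CertInput k) (s j₀ u v : ℕ) : ℕ :=
  ∑ j ∈ Finset.range a.edges.length, if a.SameClass s j₀ j ∧
    a.vert j (k - 2) = u ∧ a.vert j (k - 1) = v then 1 else 0

theorem adj_eq_endCount_add (a : CertInput k) (s j₀ u v : ℕ) :
    a.adj s j₀ u v = a.endCount s j₀ u v + a.endCount s j₀ v u := by
  classical
  rw [adj, endCount, endCount, ← Finset.sum_add_distrib]
  refine Finset.sum_congr rfl fun j _ => ?_
  by_cases h : a.SameClass s j₀ j <;> simp [h]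

theorem classSize_eq_sum_endCount (a : CertInput k) (hn : 0 < a.n) (s j₀ : ℕ) :
    a.classSize s j₀ = ∑ u : Fin a.n, ∑ v : Fin a.n, a.endCount s j₀ u v := by
  classical
  simp only [classSize, endCount]
  rw [Finset.sum_congr rfl fun u _ => Finset.sum_comm, Finset.sum_comm]
  refine Finset.sum_congr rfl fun j _ => ?_
  rw [Finset.sum_eq_single (⟨a.vert j (k - 2), a.vert_lt hn _ _⟩ : Fin a.n),
    Finset.sum_eq_single (⟨a.vert j (k - 1), a.vert_lt hn _ _⟩ : Fin a.n)]
  · simp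
  · intro v _ hv
    exact if_neg fun h => hv (Fin.ext h.2.2.symm)
  · simp
  · intro u _ hu
    exact Finset.sum_eq_zero fun v _ => if_neg fun h => hu (Fin.ext h.2.1.symm)
  · simp

/-- Quasirandomness of the endpoint counts makes the spectral test pass. -/
theorem expands_of_quasirandom (a : CertInput k) (hn : 0 < a.n) (q s j₀ : ℕ) {μ α : ℝ}
    (hμ : 0 < μ)
    (hdisc : ∀ S T : Finset (Fin a.n),
      |∑ u ∈ S, ∑ v ∈ T, (a.endCount s j₀ u v : ℝ) - μ * (S.card * T.card)| ≤
        α * Real.sqrt (S.card * T.card))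
    (hrow : ∀ u : Fin a.n, |∑ v : Fin a.n, (a.endCount s j₀ u v : ℝ) - a.n * μ| ≤ a.n * μ / 4)
    (hcol : ∀ v : Fin a.n, |∑ u : Fin a.n, (a.endCount s j₀ u v : ℝ) - a.n * μ| ≤ a.n * μ / 4)
    (hsmall : a.n * (16 * α * (harmonic a.n : ℝ) / (a.n * μ)) ^ (2 ^ (q + 1)) ≤ 1) :
    a.Expands (2 ^ (q + 1)) s j₀ := by
  have hn' : (0 : ℝ) < a.n := by exact_mod_cast hn
  have : Nonempty (Fin a.n) := ⟨⟨0, hn⟩⟩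
  set d : ℝ := a.n * μ with hd
  have hd0 : 0 < d := by positivity
  set e : ℝ := (a.classSize s j₀ : ℝ) with he
  have hesum : e = ∑ u : Fin a.n, ∑ v : Fin a.n, (a.endCount s j₀ u v : ℝ) := by
    rw [he, a.classSize_eq_sum_endCount hn]
    push_cast
    rfl
  have hcard : (Finset.univ : Finset (Fin a.n)).card = a.n := by simp
  have hlower : 3 / 4 * (a.n * d) ≤ e := by
    rw [hesum]
    have := Finset.card_nsmul_le_sum (Finset.univ : Finset (Fin a.n))
      (fun u => ∑ v : Fin a.n, (a.endCount s j₀ u v : ℝ)) (3 / 4 * d)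
      (fun u _ => by have := abs_le.1 (hrow u); linarith)
    rw [hcard, nsmul_eq_mul] at this
    linarith
  have hupper : e ≤ 5 / 4 * (a.n * d) := by
    rw [hesum]
    have := Finset.sum_le_card_nsmul (Finset.univ : Finset (Fin a.n))
      (fun u => ∑ v : Fin a.n, (a.endCount s j₀ u v : ℝ)) (5 / 4 * d)
      (fun u _ => by have := abs_le.1 (hrow u); linarith)
    rw [hcard, nsmul_eq_mul] at this
    linarith
  have he0 : 0 < e := lt_of_lt_of_le (by positivity) hlower
  constructor
  · intro u hu
    have h₁ := abs_le.1 (hrow ⟨u, hu⟩)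
    have h₂ := abs_le.1 (hcol ⟨u, hu⟩)
    have h₃ : ((∑ v ∈ Finset.range a.n, a.adj s j₀ u v : ℕ) : ℝ) =
        ∑ v : Fin a.n, (a.endCount s j₀ u v : ℝ) + ∑ v : Fin a.n, (a.endCount s j₀ v u : ℝ) := by
      rw [Finset.sum_range, ← Finset.sum_add_distrib]
      push_cast
      exact Finset.sum_congr rfl fun v _ => by rw [adj_eq_endCount_add]; push_cast; rfl
    have h₄ : (a.classSize s j₀ : ℝ) ≤
        ((a.n * ∑ v ∈ Finset.range a.n, a.adj s j₀ u v : ℕ) : ℝ) := by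
      rw [Nat.cast_mul, h₃, ← he]
      have h₅ : 3 / 2 * d ≤ ∑ v : Fin a.n, (a.endCount s j₀ u v : ℝ) +
        ∑ v : Fin a.n, (a.endCount s j₀ v u : ℝ) := by
        simp only at h₁ h₂
        linarith [h₁.1, h₂.1]
      have h₆ := mul_le_mul_of_nonneg_left h₅ hn'.le
      nlinarith [mul_pos hn' hd0]
    exact_mod_cast h₄
  · set H : ℝ := (harmonic a.n : ℝ) with hH
    have hH0 : 0 ≤ H := by
      have : 0 ≤ harmonic a.n := Finset.sum_nonneg fun i _ => by positivity
      rw [hH]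
      exact_mod_cast this
    let N : Matrix (Fin a.n) (Fin a.n) ℝ := fun u v => (a.endCount s j₀ u v : ℝ) - μ
    let A : Matrix (Fin a.n) (Fin a.n) ℝ :=
      fun u v => (a.adj s j₀ u v : ℝ) - 2 * e / a.n ^ 2
    have hN : ∀ S T : Finset (Fin a.n), |∑ u ∈ S, ∑ v ∈ T, N u v| ≤
        α * Real.sqrt (S.card * T.card) := by
      intro S T
      refine le_trans (le_of_eq ?_) (hdisc S T)
      simp only [N, Finset.sum_sub_distrib, Finset.sum_const, nsmul_eq_mul]
      ring_nf
    -- The test subtracts the actual mean 2e/n² of the adjacency matrix, not the ideal 2μ. The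
    -- discrepancy of the full square bounds the difference.
    have hc : |2 * μ - 2 * e / a.n ^ 2| * Fintype.card (Fin a.n) ≤ 2 * α := by
      have h₁ := hdisc Finset.univ Finset.univ
      rw [← hesum, hcard, Real.sqrt_mul_self hn'.le] at h₁
      have h₂ : 2 * μ - 2 * e / a.n ^ 2 = -(2 / a.n ^ 2 * (e - μ * (a.n * a.n))) := by
        field_simp
        ring
      rw [h₂, abs_neg, abs_mul, abs_of_pos (by positivity), Fintype.card_fin]
      calc 2 / (a.n : ℝ) ^ 2 * |e - μ * (a.n * a.n)| * a.n
          ≤ 2 / (a.n : ℝ) ^ 2 * (α * a.n) * a.n := by gcongr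
        _ = 2 * α := by field_simp
    have hA : ∀ u v, A u v = N u v + N v u + (2 * μ - 2 * e / a.n ^ 2) := by
      intro u v
      simp only [A, N, adj_eq_endCount_add]
      push_cast
      ring
    have hAsymm : A.IsSymm := by
      ext u v
      change (a.adj s j₀ v u : ℝ) - 2 * e / a.n ^ 2 = (a.adj s j₀ u v : ℝ) - 2 * e / a.n ^ 2
      rw [a.adj_comm]
    have hnorm := fun x => Matrix.mulVec_dotProduct_mulVec_le_of_symmetrized N A hN hc hA x
    have htr := Matrix.trace_pow_le_of_mulVec_le hAsymm (2 ^ q) hnorm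
    rw [← pow_succ', Fintype.card_fin, ← hH] at htr
    set ℓ := 2 ^ (q + 1) with hℓ
    have hM : a.shiftedMatrix s j₀ = (a.n : ℝ) ^ 2 • A := by
      ext u v
      change ((a.shiftedAdj s j₀ u v : ℤ) : ℝ) =
        (a.n : ℝ) ^ 2 * ((a.adj s j₀ u v : ℝ) - 2 * e / a.n ^ 2)
      rw [shiftedAdj, mul_sub, mul_div_cancel₀ _ (by positivity), he]
      push_cast
      ring
    have hfinal : (2 : ℝ) ^ ℓ * (a.shiftedMatrix s j₀ ^ ℓ).trace ≤ (a.n * e) ^ ℓ := by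
      rw [hM, smul_pow, Matrix.trace_smul, smul_eq_mul]
      calc (2 : ℝ) ^ ℓ * (((a.n : ℝ) ^ 2) ^ ℓ * (A ^ ℓ).trace)
          ≤ 2 ^ ℓ * (((a.n : ℝ) ^ 2) ^ ℓ * (a.n * (6 * α * H) ^ ℓ)) := by gcongr
        _ = a.n * (2 * a.n ^ 2 * (6 * α * H)) ^ ℓ := by
          rw [show 2 * (a.n : ℝ) ^ 2 * (6 * α * H) = 2 * ((a.n : ℝ) ^ 2 * (6 * α * H)) by ring,
            mul_pow 2, mul_pow ((a.n : ℝ) ^ 2)]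
          ring
        -- The constant 16 is 2·6/(3/4): the 2 of the test, the 6 of the norm bound, and the lower
        -- bound 3/4·nd for the class size.
        _ = a.n * ((3 / 4 * (a.n * (a.n * d))) * (16 * α * H / d)) ^ ℓ := by
          congr 2
          field_simp
          ring
        _ = (a.n * (16 * α * H / d) ^ ℓ) * (3 / 4 * (a.n * (a.n * d))) ^ ℓ := by
          rw [mul_pow _ (16 * α * H / d)]; ring
        _ ≤ 1 * (a.n * e) ^ ℓ := by
          refine mul_le_mul hsmall (pow_le_pow_left₀ (by positivity) ?_ _) (by positivity)
            zero_le_one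
          calc 3 / 4 * (a.n * (a.n * d)) = a.n * (3 / 4 * (a.n * d)) := by ring
            _ ≤ a.n * e := by gcongr
        _ = _ := one_mul _
    rw [trace_shiftedMatrix_pow] at hfinal
    have : (((2 ^ ℓ : ℕ) : ℤ) * ∑ u ∈ Finset.range a.n, a.shiftedPow s j₀ ℓ u u : ℤ) ≤
        ((((a.n * a.classSize s j₀) ^ ℓ : ℕ) : ℤ) : ℝ) := by
      push_cast at hfinal ⊢
      exact hfinal
    exact_mod_cast this

end CertInput

/-! ## Concentration for random subsets -/

open MeasureTheory ProbabilityTheory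

section RandomSubset

variable {ι : Type*}

open Classical in
/-- The number of elements of `F` that belong to the random set `I`. -/
noncomputable def hitCount (I : Set ι) (F : Finset ι) : ℕ := (F.filter (· ∈ I)).card

open Classical in
theorem hitCount_mono (I : Set ι) {F G : Finset ι} (h : F ⊆ G) : hitCount I F ≤ hitCount I G :=
  Finset.card_le_card (Finset.filter_subset_filter _ h)

variable [Fintype ι]

theorem setBernoulli_real_eq_sum [DecidableEq ι] (p : unitInterval) (A : Set (Set ι))
    [DecidablePred (· ∈ A)] :
    (setBernoulli (Set.univ : Set ι) p).real A =
      ∑ s : Finset ι, if (s : Set ι) ∈ A then (p : ℝ) ^ s.card * (1 - p : ℝ) ^ sᶜ.card else 0 := by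
  classical
  have h₁ : A = ((Finset.univ.filter fun s : Set ι => s ∈ A : Finset (Set ι)) : Set (Set ι)) := by
    ext s; simp
  conv_lhs => rw [h₁]
  rw [← sum_measureReal_singleton, Finset.sum_filter]
  refine Eq.symm (Finset.sum_bij (fun s _ => (s : Set ι)) (fun _ _ => Finset.mem_univ _)
    (fun s _ t _ h => Finset.coe_injective h) (fun s _ => ⟨s.toFinite.toFinset, Finset.mem_univ _,
      by simp⟩) (fun s _ => ?_))
  by_cases hs : (s : Set ι) ∈ A
  · rw [if_pos hs, if_pos hs, setBernoulli_real_singleton p (Set.subset_univ _) Set.finite_univ,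
      Set.ncard_coe_finset, ← Set.compl_eq_univ_sdiff, ← Finset.coe_compl, Set.ncard_coe_finset]
  · rw [if_neg hs, if_neg hs]

/-- The exponential Markov inequality for the number of hits. -/
theorem setBernoulli_real_le_exp (p : unitInterval) (F : Finset ι) (A : Set (Set ι)) (l c : ℝ)
    (hA : ∀ I ∈ A, c ≤ l * hitCount I F) :
    (setBernoulli (Set.univ : Set ι) p).real A ≤
      Real.exp ((p * F.card : ℝ) * (Real.exp l - 1) - c) := by
  classical
  have hp0 : (0 : ℝ) ≤ p := p.2.1
  have hp1 : (p : ℝ) ≤ 1 := p.2.2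
  rw [setBernoulli_real_eq_sum]
  have h₁ : ∀ s : Finset ι, (if (s : Set ι) ∈ A then (p : ℝ) ^ s.card * (1 - p : ℝ) ^ sᶜ.card
      else 0) ≤ Real.exp (-c) * ((∏ i ∈ s, (p : ℝ) * (if i ∈ F then Real.exp l else 1)) *
        ∏ i ∈ Finset.univ \ s, (1 - p : ℝ)) := by
    intro s
    have h₂ : ∏ i ∈ s, (p : ℝ) * (if i ∈ F then Real.exp l else 1) =
        (p : ℝ) ^ s.card * Real.exp (l * hitCount (s : Set ι) F) := by
      rw [Finset.prod_mul_distrib, Finset.prod_const, Finset.prod_ite, Finset.prod_const,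
        Finset.prod_const_one, mul_one, ← Real.exp_nat_mul, mul_comm l]
      congr 4
      unfold hitCount
      congr 1
      ext i
      simp [and_comm]
    have h₃ : (0 : ℝ) ≤ (p : ℝ) ^ s.card * (1 - p : ℝ) ^ sᶜ.card :=
      mul_nonneg (by positivity) (pow_nonneg (by linarith) _)
    rw [h₂, Finset.prod_const, ← Finset.compl_eq_univ_sdiff]
    have h₄ : Real.exp (-c) * ((p : ℝ) ^ s.card * Real.exp (l * hitCount (s : Set ι) F) *
        (1 - p : ℝ) ^ sᶜ.card) = ((p : ℝ) ^ s.card * (1 - p : ℝ) ^ sᶜ.card) *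
          Real.exp (l * hitCount (s : Set ι) F - c) := by
      rw [sub_eq_neg_add (l * _) c, Real.exp_add]; ring
    rw [h₄]
    split
    · next hs =>
      exact le_mul_of_one_le_right h₃ (Real.one_le_exp (by linarith [hA _ hs]))
    · positivity
  refine (Finset.sum_le_sum fun s _ => h₁ s).trans ?_
  -- By independence the exponential moment factors: the sum over all subsets is expanded back into
  -- a product over the elements, and each factor obeys 1 + z ≤ exp z.
  rw [← Finset.mul_sum, ← Finset.powerset_univ, ← Finset.prod_add,
    sub_eq_neg_add (_ * (Real.exp l - 1)) c, Real.exp_add]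
  refine mul_le_mul_of_nonneg_left ?_ (Real.exp_pos _).le
  have h₅ : ∏ i : ι, ((p : ℝ) * (if i ∈ F then Real.exp l else 1) + (1 - p)) ≤
      ∏ i : ι, (if i ∈ F then Real.exp ((p : ℝ) * (Real.exp l - 1)) else 1) := by
    refine Finset.prod_le_prod (fun i _ => ?_) (fun i _ => ?_)
    · split <;> [have := Real.exp_pos l; skip] <;> nlinarith
    · split
      · have := Real.add_one_le_exp ((p : ℝ) * (Real.exp l - 1))
        linarith
      · linarith
  refine h₅.trans (le_of_eq ?_)
  rw [Finset.prod_ite_mem, Finset.univ_inter, Finset.prod_const, ← Real.exp_nat_mul]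
  ring_nf

/-- A Chernoff bound with a free parameter. -/
theorem setBernoulli_real_abs_hitCount_sub_ge (p : unitInterval) (F : Finset ι) {l : ℝ}
    (hl0 : 0 ≤ l) (hl1 : l ≤ 1) (t : ℝ) :
    (setBernoulli (Set.univ : Set ι) p).real
      {I | t ≤ |(hitCount I F : ℝ) - p * F.card|} ≤
      2 * Real.exp ((p * F.card : ℝ) * l ^ 2 - l * t) := by
  set M : ℝ := (p * F.card : ℝ) with hM
  have hM0 : 0 ≤ M := mul_nonneg p.2.1 (Nat.cast_nonneg _)
  have hsub : {I : Set ι | t ≤ |(hitCount I F : ℝ) - M|} ⊆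
      {I | l * (M + t) ≤ l * hitCount I F} ∪ {I | -(l * (M - t)) ≤ -l * hitCount I F} := by
    intro I hI
    rcases le_abs.1 hI.out with h | h
    · left
      exact mul_le_mul_of_nonneg_left (by linarith) hl0
    · right
      have : l * (hitCount I F : ℝ) ≤ l * (M - t) := mul_le_mul_of_nonneg_left (by linarith) hl0
      simp only [Set.mem_ofPred_eq]
      linarith
  have h₁ := setBernoulli_real_le_exp p F {I | l * (M + t) ≤ l * hitCount I F} l _ fun I hI => hI
  have h₂ := setBernoulli_real_le_exp p F {I | -(l * (M - t)) ≤ -l * hitCount I F} (-l) _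
    fun I hI => hI
  -- For |l| ≤ 1, |exp l - 1 - l| ≤ l²; this serves the upper tail with l and the lower tail with
  -- -l.
  have e₁ := (abs_le.1 (Real.abs_exp_sub_one_sub_id_le (x := l)
    (abs_le.2 ⟨by linarith, hl1⟩))).2
  have e₂ := (abs_le.1 (Real.abs_exp_sub_one_sub_id_le (x := -l)
    (abs_le.2 ⟨by linarith, by linarith⟩))).2
  rw [← hM] at h₁ h₂
  calc _ ≤ _ := measureReal_mono hsub
    _ ≤ _ := measureReal_union_le _ _
    _ ≤ Real.exp (M * l ^ 2 - l * t) + Real.exp (M * l ^ 2 - l * t) := by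
      refine add_le_add (h₁.trans (Real.exp_le_exp.2 ?_)) (h₂.trans (Real.exp_le_exp.2 ?_))
      · nlinarith
      · nlinarith
    _ = _ := by ring

end RandomSubset

/-! ### Quasirandomness of random endpoint counts -/

section RandomGraph

variable {ι : Type*} {n : ℕ}

/-- The elements of `W` with endpoints in `S` and `T`. -/
def rectangle (W : Finset ι) (u v : ι → Fin n) (S T : Finset (Fin n)) : Finset ι :=
  W.filter fun i => u i ∈ S ∧ v i ∈ T

theorem sum_hitCount_rectangle (I : Set ι) (W : Finset ι) (u v : ι → Fin n)
    (S T : Finset (Fin n)) :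
    ∑ a ∈ S, ∑ b ∈ T, hitCount I (rectangle W u v {a} {b}) =
      hitCount I (rectangle W u v S T) := by
  classical
  simp only [hitCount, rectangle, Finset.filter_filter]
  rw [← Finset.sum_product', Finset.card_eq_sum_card_fiberwise (f := fun i => (u i, v i))
    (t := S ×ˢ T)]
  · refine Finset.sum_congr rfl fun ab hab => ?_
    congr 1
    rw [Finset.filter_filter]
    refine Finset.filter_congr fun i _ => ?_
    have := Finset.mem_product.1 hab
    simp only [Finset.mem_singleton, Prod.ext_iff]
    constructor
    · rintro ⟨⟨h₁, h₂⟩, h₃⟩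
      exact ⟨⟨⟨h₁ ▸ this.1, h₂ ▸ this.2⟩, h₃⟩, h₁, h₂⟩
    · rintro ⟨⟨-, h₃⟩, h₁, h₂⟩
      exact ⟨⟨h₁, h₂⟩, h₃⟩
  · intro i hi
    have := (Finset.mem_filter.1 hi).2.1
    exact Finset.mem_product.2 this

/-- Additivity of hit counts over rectangles, applied to the full set, where a hit count is a
cardinality. -/
theorem card_rectangle (W : Finset ι) (u v : ι → Fin n) {w : ℕ}
    (hw : ∀ a b, (rectangle W u v {a} {b}).card = w) (S T : Finset (Fin n)) :
    (rectangle W u v S T).card = w * (S.card * T.card) := by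
  have h := sum_hitCount_rectangle Set.univ W u v S T
  have e : ∀ F : Finset ι, hitCount Set.univ F = F.card := fun F => by simp [hitCount]
  simp only [e, hw] at h
  rw [← h]
  simp
  ring

/-- The counts of endpoints are quasirandom, with density `y ^ 4 / n`. -/
def IsQuasirandom (n : ℕ) (y : ℝ) (N : Fin n → Fin n → ℕ) : Prop :=
  (∀ S T : Finset (Fin n), |∑ a ∈ S, ∑ b ∈ T, (N a b : ℝ) - y ^ 4 / n * (S.card * T.card)| ≤
    y ^ 3 * Real.sqrt (S.card * T.card)) ∧
  (∀ a, |∑ b, (N a b : ℝ) - y ^ 4| ≤ y ^ 4 / 4) ∧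
  (∀ b, |∑ a, (N a b : ℝ) - y ^ 4| ≤ y ^ 4 / 4)

/-- If one side of a rectangle is much smaller than the other one, then the degrees alone control
its discrepancy. -/
theorem abs_sub_le_of_unbalanced {X y m r M : ℝ} (hy : 2 ≤ y) (hm : 0 ≤ m)
    (hX : 0 ≤ X) (hXle : X ≤ 5 / 4 * y ^ 4 * m) (hM : 0 ≤ M) (hMle : M ≤ y ^ 4 * m)
    (h : y ^ 4 * m ≤ r) :
    |X - M| ≤ y ^ 3 * Real.sqrt (r * m) := by
  -- Imbalance gives r·m ≥ y^4 m², so the allowed error is at least y^5 m, while X and M are at most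
  -- 5/4·y^4 m.
  have h₁ : y ^ 2 * m ≤ Real.sqrt (r * m) := by
    refine Real.le_sqrt_of_sq_le ?_
    nlinarith
  have h₂ : y ^ 3 * (y ^ 2 * m) ≤ y ^ 3 * Real.sqrt (r * m) := by gcongr
  have h₃ : 5 / 4 * y ^ 4 * m ≤ y ^ 3 * (y ^ 2 * m) := by
    have : 0 ≤ y ^ 4 * m := by positivity
    nlinarith
  have h₄ : y ^ 4 * m ≤ 5 / 4 * y ^ 4 * m := by
    have : 0 ≤ y ^ 4 * m := by positivity
    nlinarith
  rw [abs_le]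
  constructor <;> linarith

theorem sum_pow_card_nonempty {κ : Type*} [Fintype κ] [DecidableEq κ] (Q : ℝ) :
    ∑ S ∈ (Finset.univ : Finset (Finset κ)).erase ∅, Q ^ S.card =
      (1 + Q) ^ Fintype.card κ - 1 := by
  have h₁ := Finset.prod_add (fun _ : κ => Q) (fun _ => (1 : ℝ)) Finset.univ
  simp only [Finset.prod_const, one_pow, mul_one, Finset.card_univ, Finset.powerset_univ] at h₁
  rw [add_comm, h₁, ← Finset.sum_erase_add _ _ (Finset.mem_univ ∅)]
  simp

theorem one_add_pow_sub_one_le {Q : ℝ} (hQ : 0 ≤ Q) (n : ℕ) (h : n * Q ≤ 1) :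
    (1 + Q) ^ n - 1 ≤ 2 * (n * Q) := by
  have h₁ : (1 + Q) ^ n ≤ Real.exp (n * Q) := by
    rw [Real.exp_nat_mul]
    exact pow_le_pow_left₀ (by linarith) (by linarith [Real.add_one_le_exp Q]) n
  have h₀ : 0 ≤ n * Q := by positivity
  have h₂ := (abs_le.1 (Real.abs_exp_sub_one_sub_id_le (x := n * Q)
    (abs_le.2 ⟨by linarith, h⟩))).2
  nlinarith

/-- Chernoff and a union bound over stars and over rectangles. In a very unbalanced rectangle the
optimal Chernoff parameter would exceed the range where the bound holds, so only balanced rectangles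
enter the union; the degree bounds settle the others. -/
theorem setBernoulli_real_not_isQuasirandom_le [Fintype ι] (p : unitInterval) (W : Finset ι)
    (u v : ι → Fin n) {w : ℕ} (hw : ∀ a b, (rectangle W u v {a} {b}).card = w) {y : ℝ}
    (hy : 2 ≤ y) (hn : 0 < n) (hpw : (p : ℝ) * w = y ^ 4 / n)
    (hsmall : n * Real.exp (-y / 4) ≤ 1) :
    (setBernoulli (Set.univ : Set ι) p).real
      {I | ¬ IsQuasirandom n y fun a b => hitCount I (rectangle W u v {a} {b})} ≤
      4 * n * Real.exp (-y ^ 4 / 64) + 8 * n ^ 2 * Real.exp (-y / 2) := by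
  classical
  have hn' : (0 : ℝ) < n := by exact_mod_cast hn
  set P := setBernoulli (Set.univ : Set ι) p with hP
  have hcard : ∀ S T : Finset (Fin n), (p : ℝ) * (rectangle W u v S T).card =
      y ^ 4 / n * (S.card * T.card) := by
    intro S T
    rw [card_rectangle W u v hw, ← hpw]
    push_cast
    ring
  have hcardn : (Finset.univ : Finset (Fin n)).card = n := by simp
  let bad : Finset (Fin n) → Finset (Fin n) → ℝ → Set (Set ι) := fun S T t =>
    {I | t ≤ |(hitCount I (rectangle W u v S T) : ℝ) - y ^ 4 / n * (S.card * T.card)|}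
  have hbad : ∀ S T (t l : ℝ), 0 ≤ l → l ≤ 1 →
      P.real (bad S T t) ≤ 2 * Real.exp (y ^ 4 / n * (S.card * T.card) * l ^ 2 - l * t) := by
    intro S T t l hl0 hl1
    have := setBernoulli_real_abs_hitCount_sub_ge p (rectangle W u v S T) hl0 hl1 t
    rwa [hcard] at this
  -- degrees
  have hrow : ∀ a : Fin n, P.real (bad {a} Finset.univ (y ^ 4 / 4)) ≤
      2 * Real.exp (-y ^ 4 / 64) := by
    intro a
    -- With l = 1/8 the exponent is y^4/64 - y^4/32.
    refine (hbad _ _ _ (1 / 8) (by norm_num) (by norm_num)).trans (le_of_eq ?_)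
    rw [Finset.card_singleton, hcardn]
    congr 2
    push_cast
    field_simp
    ring
  have hcol : ∀ a : Fin n, P.real (bad Finset.univ {a} (y ^ 4 / 4)) ≤
      2 * Real.exp (-y ^ 4 / 64) := by
    intro a
    refine (hbad _ _ _ (1 / 8) (by norm_num) (by norm_num)).trans (le_of_eq ?_)
    rw [Finset.card_singleton, hcardn]
    congr 2
    push_cast
    field_simp
    ring
  -- rectangles
  let Bal : Finset (Fin n) → Finset (Fin n) → Prop := fun S T =>
    (max S.card T.card : ℝ) ≤ y ^ 4 * (min S.card T.card : ℝ)
  set Q := Real.exp (-y / 4) with hQ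
  have hrect : ∀ S T : Finset (Fin n), S ≠ ∅ → T ≠ ∅ → Bal S T →
      P.real (bad S T (y ^ 3 * Real.sqrt (S.card * T.card))) ≤ 2 * (Q ^ S.card * Q ^ T.card) := by
    intro S T hS hT hST
    have hs : (1 : ℝ) ≤ S.card := by
      exact_mod_cast Finset.card_pos.2 (Finset.nonempty_iff_ne_empty.2 hS)
    have ht : (1 : ℝ) ≤ T.card := by
      exact_mod_cast Finset.card_pos.2 (Finset.nonempty_iff_ne_empty.2 hT)
    have hsn : (S.card : ℝ) ≤ n := by exact_mod_cast (Finset.card_le_univ S).trans (by simp)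
    have htn : (T.card : ℝ) ≤ n := by exact_mod_cast (Finset.card_le_univ T).trans (by simp)
    set r : ℝ := max (S.card : ℝ) T.card with hr
    have hr1 : 1 ≤ r := hs.trans (le_max_left _ _)
    have hrn : r ≤ n := max_le hsn htn
    set g := Real.sqrt (S.card * T.card) with hg
    have hg0 : 0 < g := Real.sqrt_pos.2 (by positivity)
    have hgsq : g ^ 2 = S.card * T.card := Real.sq_sqrt (by positivity)
    have hrg : r ≤ y ^ 2 * g := by
      have h₁ : r * min (S.card : ℝ) T.card = g ^ 2 := by rw [hgsq, hr, max_mul_min]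
      have h₂ : r ^ 2 ≤ (y ^ 2 * g) ^ 2 := by
        rw [mul_pow, ← h₁]
        have : r ≤ y ^ 4 * min (S.card : ℝ) T.card := hST
        nlinarith
      exact (pow_le_pow_iff_left₀ (by linarith) (by positivity) (by norm_num)).1 h₂
    -- This l makes the exponent r²/n - ry ≤ -ry/2, as r ≤ n and y ≥ 2. That is at most
    -- -(|S|+|T|)y/4, which pays for the choice of S and T. Balance is what makes l ≤ 1.
    refine (hbad S T _ (r / (y ^ 2 * g)) (by positivity)
      ((div_le_one (by positivity)).2 hrg)).trans ?_
    rw [← pow_add, hQ, ← Real.exp_nat_mul]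
    refine mul_le_mul_of_nonneg_left (Real.exp_le_exp.2 ?_) (by norm_num)
    rw [← hgsq]
    have e₁ : y ^ 4 / n * g ^ 2 * (r / (y ^ 2 * g)) ^ 2 = r * (r / n) := by field_simp
    have e₂ : r / (y ^ 2 * g) * (y ^ 3 * g) = r * y := by field_simp
    rw [e₁, e₂]
    have h₃ : r * (r / n) ≤ r := mul_le_of_le_one_right (by linarith) ((div_le_one hn').2 hrn)
    have h₄ : (S.card : ℝ) + T.card ≤ 2 * r := by
      linarith [le_max_left (S.card : ℝ) T.card, le_max_right (S.card : ℝ) T.card]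
    push_cast
    nlinarith
  have hcover : {I | ¬ IsQuasirandom n y fun a b => hitCount I (rectangle W u v {a} {b})} ⊆
      ((⋃ a ∈ (Finset.univ : Finset (Fin n)), bad {a} Finset.univ (y ^ 4 / 4)) ∪
        ⋃ b ∈ (Finset.univ : Finset (Fin n)), bad Finset.univ {b} (y ^ 4 / 4)) ∪
      ⋃ ST ∈ (((Finset.univ : Finset (Finset (Fin n))).erase ∅) ×ˢ
        ((Finset.univ : Finset (Finset (Fin n))).erase ∅)).filter (fun ST => Bal ST.1 ST.2),
        bad ST.1 ST.2 (y ^ 3 * Real.sqrt (ST.1.card * ST.2.card)) := by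
    intro I hI
    by_contra hcon
    simp only [Set.mem_union, Set.mem_iUnion, not_or, not_exists] at hcon
    obtain ⟨⟨h₁, h₂⟩, h₃⟩ := hcon
    apply hI.out
    have hsum : ∀ S T : Finset (Fin n), ∑ a ∈ S, ∑ b ∈ T,
        (hitCount I (rectangle W u v {a} {b}) : ℝ) = hitCount I (rectangle W u v S T) := by
      intro S T
      exact_mod_cast sum_hitCount_rectangle I W u v S T
    have hr : ∀ a : Fin n, |(hitCount I (rectangle W u v {a} Finset.univ) : ℝ) - y ^ 4| ≤
        y ^ 4 / 4 := by
      intro a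
      have := h₁ a (Finset.mem_univ _)
      simp only [bad, Set.mem_ofPred_eq, not_le, Finset.card_singleton, hcardn] at this
      rw [show y ^ 4 / (n : ℝ) * ((1 : ℕ) * n) = y ^ 4 by push_cast; field_simp] at this
      exact this.le
    have hc : ∀ a : Fin n, |(hitCount I (rectangle W u v Finset.univ {a}) : ℝ) - y ^ 4| ≤
        y ^ 4 / 4 := by
      intro a
      have := h₂ a (Finset.mem_univ _)
      simp only [bad, Set.mem_ofPred_eq, not_le, Finset.card_singleton, hcardn] at this
      rw [show y ^ 4 / (n : ℝ) * (n * (1 : ℕ)) = y ^ 4 by push_cast; field_simp] at this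
      exact this.le
    have hdegS : ∀ S T : Finset (Fin n), (hitCount I (rectangle W u v S T) : ℝ) ≤
        5 / 4 * y ^ 4 * S.card := by
      intro S T
      have e₁ : (hitCount I (rectangle W u v S T) : ℝ) ≤
          hitCount I (rectangle W u v S Finset.univ) := by
        refine Nat.cast_le.2 (hitCount_mono I ?_)
        intro i hi
        have := Finset.mem_filter.1 hi
        exact Finset.mem_filter.2 ⟨this.1, this.2.1, Finset.mem_univ _⟩
      have e₂ := Finset.sum_le_card_nsmul S
        (fun a => (hitCount I (rectangle W u v {a} Finset.univ) : ℝ)) (5 / 4 * y ^ 4)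
        (fun a _ => by have := abs_le.1 (hr a); linarith)
      have e₃ : ∑ a ∈ S, (hitCount I (rectangle W u v {a} Finset.univ) : ℝ) =
          hitCount I (rectangle W u v S Finset.univ) := by
        rw [← hsum S]
        exact Finset.sum_congr rfl fun a _ => by rw [← hsum {a}, Finset.sum_singleton]
      rw [e₃, nsmul_eq_mul] at e₂
      linarith
    have hdegT : ∀ S T : Finset (Fin n), (hitCount I (rectangle W u v S T) : ℝ) ≤
        5 / 4 * y ^ 4 * T.card := by
      intro S T
      have e₁ : (hitCount I (rectangle W u v S T) : ℝ) ≤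
          hitCount I (rectangle W u v Finset.univ T) := by
        refine Nat.cast_le.2 (hitCount_mono I ?_)
        intro i hi
        have := Finset.mem_filter.1 hi
        exact Finset.mem_filter.2 ⟨this.1, Finset.mem_univ _, this.2.2⟩
      have e₂ := Finset.sum_le_card_nsmul T
        (fun a => (hitCount I (rectangle W u v Finset.univ {a}) : ℝ)) (5 / 4 * y ^ 4)
        (fun a _ => by have := abs_le.1 (hc a); linarith)
      have e₃ : ∑ a ∈ T, (hitCount I (rectangle W u v Finset.univ {a}) : ℝ) =
          hitCount I (rectangle W u v Finset.univ T) := by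
        rw [← hsum _ T, Finset.sum_comm]
        exact Finset.sum_congr rfl fun a _ => by
          rw [← hsum _ {a}]; exact Finset.sum_congr rfl fun b _ => Finset.sum_singleton _ _
      rw [e₃, nsmul_eq_mul] at e₂
      linarith
    refine ⟨fun S T => ?_, fun a => ?_, fun b => ?_⟩
    · rw [hsum]
      have hsn : (S.card : ℝ) ≤ n := by exact_mod_cast (Finset.card_le_univ S).trans (by simp)
      have htn : (T.card : ℝ) ≤ n := by exact_mod_cast (Finset.card_le_univ T).trans (by simp)
      by_cases hbal : S ≠ ∅ ∧ T ≠ ∅ ∧ Bal S T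
      · have := h₃ (S, T) (by simp [hbal.1, hbal.2.1, hbal.2.2])
        simp only [bad, Set.mem_ofPred_eq, not_le] at this
        exact this.le
      · have hM : y ^ 4 / n * (S.card * T.card) ≤ y ^ 4 * min (S.card : ℝ) T.card := by
          rw [← max_mul_min (S.card : ℝ), div_mul_eq_mul_div, div_le_iff₀ hn']
          have : max (S.card : ℝ) T.card ≤ n := max_le hsn htn
          have h₀ : 0 ≤ y ^ 4 * min (S.card : ℝ) T.card := by positivity
          nlinarith
        have hX : (hitCount I (rectangle W u v S T) : ℝ) ≤
            5 / 4 * y ^ 4 * min (S.card : ℝ) T.card := by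
          rcases min_choice (S.card : ℝ) T.card with h | h <;> rw [h]
          exacts [hdegS S T, hdegT S T]
        have hunb : y ^ 4 * min (S.card : ℝ) T.card ≤ max (S.card : ℝ) T.card := by
          by_cases hS : S = ∅
          · simp [hS]
          by_cases hT : T = ∅
          · simp [hT]
          have : ¬ Bal S T := fun h => hbal ⟨hS, hT, h⟩
          exact (not_le.1 this).le
        have := abs_sub_le_of_unbalanced hy (m := min (S.card : ℝ) T.card)
          (r := max (S.card : ℝ) T.card) (by positivity) (by positivity) hX
          (by positivity) hM hunb
        rwa [max_mul_min] at this
    · have := hsum {a} Finset.univ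
      rw [Finset.sum_singleton] at this
      rw [this]
      exact hr a
    · have := hsum Finset.univ {b}
      simp only [Finset.sum_singleton] at this
      rw [this]
      exact hc b
  have hQ0 : 0 ≤ Q := (Real.exp_pos _).le
  have hsumrect : ∑ ST ∈ (((Finset.univ : Finset (Finset (Fin n))).erase ∅) ×ˢ
        ((Finset.univ : Finset (Finset (Fin n))).erase ∅)).filter (fun ST => Bal ST.1 ST.2),
        P.real (bad ST.1 ST.2 (y ^ 3 * Real.sqrt (ST.1.card * ST.2.card))) ≤
      8 * n ^ 2 * Real.exp (-y / 2) := by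
    calc _ ≤ ∑ ST ∈ (((Finset.univ : Finset (Finset (Fin n))).erase ∅) ×ˢ
        ((Finset.univ : Finset (Finset (Fin n))).erase ∅)).filter (fun ST => Bal ST.1 ST.2),
          2 * (Q ^ ST.1.card * Q ^ ST.2.card) := by
          refine Finset.sum_le_sum fun ST hST => ?_
          obtain ⟨h₁, h₂⟩ := Finset.mem_filter.1 hST
          obtain ⟨h₃, h₄⟩ := Finset.mem_product.1 h₁
          exact hrect _ _ (Finset.ne_of_mem_erase h₃) (Finset.ne_of_mem_erase h₄) h₂
      _ ≤ ∑ ST ∈ ((Finset.univ : Finset (Finset (Fin n))).erase ∅) ×ˢ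
        ((Finset.univ : Finset (Finset (Fin n))).erase ∅),
          2 * (Q ^ ST.1.card * Q ^ ST.2.card) :=
        Finset.sum_le_sum_of_subset_of_nonneg (Finset.filter_subset _ _)
          (fun _ _ _ => by positivity)
      -- Excluding empty sets removes the constant term, so that each factor is of order nQ.
      _ = 2 * ((1 + Q) ^ n - 1) ^ 2 := by
        rw [← Finset.mul_sum, Finset.sum_product]
        simp only
        rw [← Finset.sum_mul_sum, sum_pow_card_nonempty, Fintype.card_fin, sq]
      _ ≤ 2 * (2 * (n * Q)) ^ 2 := by
        have h₁ := one_add_pow_sub_one_le hQ0 n hsmall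
        have h₂ : 0 ≤ (1 + Q) ^ n - 1 := by
          linarith [one_le_pow₀ (n := n) (by linarith : 1 ≤ 1 + Q)]
        gcongr
      _ = 8 * n ^ 2 * (Q * Q) := by ring
      _ = _ := by rw [hQ, ← Real.exp_add]; ring_nf
  have hsumrow : ∑ a : Fin n, P.real (bad {a} Finset.univ (y ^ 4 / 4)) ≤
      2 * n * Real.exp (-y ^ 4 / 64) := by
    refine (Finset.sum_le_card_nsmul _ _ _ fun a _ => hrow a).trans (le_of_eq ?_)
    rw [hcardn, nsmul_eq_mul]; ring
  have hsumcol : ∑ a : Fin n, P.real (bad Finset.univ {a} (y ^ 4 / 4)) ≤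
      2 * n * Real.exp (-y ^ 4 / 64) := by
    refine (Finset.sum_le_card_nsmul _ _ _ fun a _ => hcol a).trans (le_of_eq ?_)
    rw [hcardn, nsmul_eq_mul]; ring
  calc _ ≤ _ := measureReal_mono hcover
    _ ≤ _ := measureReal_union_le _ _
    _ ≤ _ := add_le_add (measureReal_union_le _ _) le_rfl
    _ ≤ _ := add_le_add (add_le_add (measureReal_biUnion_finset_le _ _)
      (measureReal_biUnion_finset_le _ _)) (measureReal_biUnion_finset_le _ _)
    _ ≤ _ := add_le_add (add_le_add hsumrow hsumcol) hsumrect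
    _ = _ := by ring

end RandomGraph

open MeasureTheory ProbabilityTheory

/-! ## Listings of random hypergraphs -/

namespace SignedHypergraph

variable {k n : ℕ}

/-- Counting in a listing is counting signed hyperedges. -/
theorem IsUnsignedListing.card_filter {I : SignedHypergraph k n} {L : List (HyperTuple k n)}
    (h : I.IsUnsignedListing L) (g : HyperTuple k n → Prop) [DecidablePred g] :
    (Finset.univ.filter fun j : Fin L.length => g (L.get j)).card =
      hitCount I (Finset.univ.filter fun z => g z.2) := by
  classical
  have h₁ : ∀ U : HyperTuple k n, (Finset.univ.filter fun j : Fin L.length => L.get j = U).card =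
      ((Finset.univ : Finset ((Fin k → ℤˣ) × HyperTuple k n)).filter
        fun z => z ∈ I ∧ z.2 = U).card := by
    intro U
    have e₁ := List.card_filter_get_cast L (fun V => V = U) rfl
    have e₂ : L.countP (fun V => decide (V = U)) = L.count U := by
      rw [List.count]
      exact List.countP_congr fun V _ => by simp
    rw [e₂, h U] at e₁
    refine e₁.trans ?_
    rw [← Set.ncard_coe_finset]
    refine Set.ncard_congr (fun c _ => (c, U)) (fun c hc => by simpa using hc)
      (fun c c' _ _ hcc => (Prod.ext_iff.1 hcc).1) (fun z hz => ?_)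
    obtain ⟨hz₁, hz₂⟩ : z ∈ I ∧ z.2 = U := by simpa using hz
    exact ⟨z.1, by subst hz₂; exact hz₁, by subst hz₂; rfl⟩
  have h₂ := Finset.card_eq_sum_card_fiberwise (f := fun j : Fin L.length => L.get j)
    (s := Finset.univ.filter fun j : Fin L.length => g (L.get j)) (t := Finset.univ.filter g)
    (fun j hj => by simpa using hj)
  have h₃ := Finset.card_eq_sum_card_fiberwise (f := fun z : (Fin k → ℤˣ) × HyperTuple k n => z.2)
    (s := (Finset.univ.filter fun z : (Fin k → ℤˣ) × HyperTuple k n => g z.2).filter (· ∈ I))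
    (t := Finset.univ.filter g) (fun z hz => by
      have := (Finset.mem_filter.1 (Finset.mem_filter.1 hz).1).2
      simpa using this)
  unfold hitCount
  rw [h₂]
  refine Eq.trans (Finset.sum_congr rfl fun U hU => ?_) h₃.symm
  have hgU : g U := (Finset.mem_filter.1 hU).2
  rw [Finset.filter_filter, Finset.filter_filter, Finset.filter_filter]
  refine Eq.trans ?_ ((h₁ U).trans ?_)
  · congr 1
    refine Finset.filter_congr fun j _ => ?_
    exact ⟨fun h => h.2, fun h => ⟨h ▸ hgU, h⟩⟩
  · congr 1
    refine Finset.filter_congr fun z _ => ?_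
    exact ⟨fun h => ⟨h.2 ▸ hgU, h⟩, fun h => h.2⟩

/-! ### Block classes of signed hyperedges -/

/-- The first `k - 2` vertices of `U` lie below `N`, in the blocks `τ` of length `s`. -/
def InBlocks (N s : ℕ) (τ : Fin (k - 2) → ℕ) (U : HyperTuple k n) : Prop :=
  ∀ i : Fin (k - 2), (U (i.castLE (Nat.sub_le k 2)) : ℕ) < N ∧
    (U (i.castLE (Nat.sub_le k 2)) : ℕ) / s = τ i

open Classical in
/-- The signed hyperedges whose first `k - 2` vertices lie in given blocks. -/
noncomputable def blockClass (k n N s : ℕ) (τ : Fin (k - 2) → ℕ) :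
    Finset ((Fin k → ℤˣ) × HyperTuple k n) :=
  Finset.univ.filter fun z => InBlocks N s τ z.2

/-- The vertex with a given index. -/
def endpoint (i : ℕ) (hi : i < k) (z : (Fin k → ℤˣ) × HyperTuple k n) : Fin n := z.2 ⟨i, hi⟩

/-- Since s divides N, every block below N is complete; this is why N is a power of two and the slab
replaces [n]. -/
theorem card_block {N s t : ℕ} (hNn : N ≤ n) (hs : 0 < s) (hsN : s ∣ N) (ht : t < N / s) :
    (Finset.univ.filter fun x : Fin n => (x : ℕ) < N ∧ (x : ℕ) / s = t).card = s := by
  have h : (Finset.univ.filter fun x : Fin n => (x : ℕ) < N ∧ (x : ℕ) / s = t).map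
      Fin.valEmbedding = Finset.Ico (t * s) (t * s + s) := by
    obtain ⟨r, rfl⟩ := hsN
    rw [Nat.mul_div_cancel_left _ hs] at ht
    have h₁ : t * s + s ≤ s * r := by
      calc t * s + s = s * (t + 1) := by ring
        _ ≤ s * r := Nat.mul_le_mul_left _ ht
    ext m
    simp only [Finset.mem_map, Finset.mem_filter, Finset.mem_univ, true_and, Fin.valEmbedding_apply,
      Finset.mem_Ico]
    constructor
    · rintro ⟨x, ⟨-, hx⟩, rfl⟩
      rw [Nat.div_eq_iff hs] at hx
      omega
    · rintro ⟨h₂, h₃⟩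
      refine ⟨⟨m, by omega⟩, ⟨by simp only; omega, ?_⟩, rfl⟩
      simp only
      rw [Nat.div_eq_iff hs]
      omega
  rw [← Finset.card_map Fin.valEmbedding, h, Nat.card_Ico]
  omega

/-- The set is a box: all 2^k sign vectors, s choices for each of the first k-2 vertices, one for
each of the last two. Its size does not depend on a and b, as the quasirandomness lemma requires. -/
theorem card_rectangle_blockClass (hk : 2 ≤ k) {N s : ℕ} (hNn : N ≤ n) (hs : 0 < s) (hsN : s ∣ N)
    (τ : Fin (k - 2) → ℕ) (hτ : ∀ i, τ i < N / s) (a b : Fin n) :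
    (rectangle (blockClass k n N s τ) (endpoint (k - 2) (by omega)) (endpoint (k - 1) (by omega))
      {a} {b}).card = 2 ^ k * s ^ (k - 2) := by
  classical
  let B : Fin k → Finset (Fin n) := fun i =>
    if h : (i : ℕ) < k - 2 then
      Finset.univ.filter fun x : Fin n => (x : ℕ) < N ∧ (x : ℕ) / s = τ ⟨i, h⟩
    else if (i : ℕ) = k - 2 then {a} else {b}
  have h₁ : rectangle (blockClass k n N s τ) (endpoint (k - 2) (by omega))
      (endpoint (k - 1) (by omega)) {a} {b} = Finset.univ ×ˢ Fintype.piFinset B := by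
    ext ⟨c, U⟩
    simp only [rectangle, blockClass, endpoint, Finset.mem_filter, Finset.mem_univ, true_and,
      Finset.mem_singleton, Finset.mem_product, Fintype.mem_piFinset]
    constructor
    · rintro ⟨h₁, h₂, h₃⟩ i
      by_cases hi : (i : ℕ) < k - 2
      · simp only [B, hi, dif_pos, Finset.mem_filter, Finset.mem_univ, true_and]
        exact h₁ ⟨i, hi⟩
      · by_cases hi' : (i : ℕ) = k - 2
        · simp only [B, hi', dif_neg, not_false_eq_true, if_true, Finset.mem_singleton,
            lt_irrefl]
          rw [← h₂]
          exact congrArg U (Fin.ext hi')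
        · simp only [B, hi, hi', dif_neg, not_false_eq_true, if_false, Finset.mem_singleton]
          rw [← h₃]
          refine congrArg U (Fin.ext ?_)
          have := i.2
          simp only
          omega
    · intro h
      refine ⟨fun i => ?_, ?_, ?_⟩
      · have := h (i.castLE (Nat.sub_le k 2))
        simpa [B] using this
      · have := h ⟨k - 2, by omega⟩
        simpa [B] using this
      · have := h ⟨k - 1, by omega⟩
        have e₁ : ¬ k - 1 < k - 2 := by omega
        have e₂ : k - 1 ≠ k - 2 := by omega
        simpa [B, e₁, e₂] using this
  have h₂ : ∀ i, (B i).card = if (i : ℕ) < k - 2 then s else 1 := by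
    intro i
    by_cases hi : (i : ℕ) < k - 2
    · simp only [B, hi, dif_pos, if_true]
      exact card_block hNn hs hsN (hτ _)
    · by_cases hi' : (i : ℕ) = k - 2
      · simp [B, hi']
      · simp [B, hi, hi']
  have h₃ : ∏ i, (B i).card = s ^ (k - 2) := by
    rw [Finset.prod_congr rfl fun i _ => h₂ i, Fin.prod_univ_eq_prod_range
      (fun i => if i < k - 2 then s else 1) k, Finset.prod_ite, Finset.prod_const,
      Finset.prod_const_one, mul_one]
    congr 1
    have : (Finset.range k).filter (fun i => i < k - 2) = Finset.range (k - 2) := by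
      ext i
      simp only [Finset.mem_filter, Finset.mem_range]
      omega
    rw [this, Finset.card_range]
  rw [h₁, Finset.card_product, Fintype.card_piFinset, h₃]
  simp

/-- The counts of last vertices in all classes are quasirandom. -/
def AllQuasirandom (hk : 2 ≤ k) (N s : ℕ) (y : ℝ) (I : SignedHypergraph k n) : Prop :=
  ∀ τ : Fin (k - 2) → Fin (N / s), IsQuasirandom n y fun a b =>
    hitCount I (rectangle (blockClass k n N s fun i => τ i) (endpoint (k - 2) (by omega))
      (endpoint (k - 1) (by omega)) {a} {b})

variable {I : SignedHypergraph k n} {L : List (HyperTuple k n)}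

/-- The bridge from the algorithm to the random model: what is counted along any listing is a hit
count of the random set, so the order of the listing is irrelevant. -/
theorem IsUnsignedListing.endCount_eq (hk : 2 ≤ k) (h : I.IsUnsignedListing L) (η : ℝ)
    (s j₀ : ℕ) (u v : Fin n) :
    (certInput L η).endCount s j₀ u v =
      hitCount I (rectangle (blockClass k n (2 ^ Nat.log 2 n) s
        fun i => (certInput L η).vert j₀ i / s) (endpoint (k - 2) (by omega))
        (endpoint (k - 1) (by omega)) {u} {v}) := by
  classical
  set a := certInput L η with ha
  have hvert : ∀ (j : Fin L.length) (i : Fin k), a.vert j i = (L.get j i : ℕ) :=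
    fun j i => a.vert_eq j i
  have h₁ := h.card_filter fun U => InBlocks (2 ^ Nat.log 2 n) s (fun i => a.vert j₀ i / s) U ∧
    U ⟨k - 2, by omega⟩ = u ∧ U ⟨k - 1, by omega⟩ = v
  have h₂ : a.endCount s j₀ u v = (Finset.univ.filter fun j : Fin L.length =>
      InBlocks (2 ^ Nat.log 2 n) s (fun i => a.vert j₀ i / s) (L.get j) ∧
        L.get j ⟨k - 2, by omega⟩ = u ∧ L.get j ⟨k - 1, by omega⟩ = v).card := by
    rw [CertInput.endCount, Finset.card_filter]
    refine (Finset.sum_range _).trans (Finset.sum_congr rfl fun j _ => ?_)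
    refine if_congr ?_ rfl rfl
    have e₁ := hvert j ⟨k - 2, by omega⟩
    have e₂ := hvert j ⟨k - 1, by omega⟩
    simp only at e₁ e₂
    refine and_congr ?_ (and_congr ?_ ?_)
    · unfold CertInput.SameClass CertInput.InSlab InBlocks
      constructor
      · rintro ⟨h₃, h₄⟩ i
        have e := hvert j (i.castLE (Nat.sub_le k 2))
        rw [← e]
        exact ⟨h₃ i i.2, h₄ i i.2⟩
      · intro h₃
        refine ⟨fun i hi => ?_, fun i hi => ?_⟩
        · have e := hvert j ⟨i, by omega⟩
          simp only at e
          rw [e]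
          exact (h₃ ⟨i, hi⟩).1
        · have e := hvert j ⟨i, by omega⟩
          simp only at e
          rw [e]
          exact (h₃ ⟨i, hi⟩).2
    · rw [e₁, Fin.ext_iff]
    · rw [e₂, Fin.ext_iff]
  rw [h₂, h₁]
  congr 1
  ext z
  simp [rectangle, blockClass, endpoint]

theorem IsUnsignedListing.length_eq (h : I.IsUnsignedListing L) :
    L.length = hitCount I Finset.univ := by
  have := h.card_filter fun _ => True
  simpa using this

/-- The block classes are disjoint subsets of the slab, and the row bounds give each of them at
least 3/4·n y^4 hyperedges. -/
theorem IsUnsignedListing.slabSize_ge (hk : 2 ≤ k) (h : I.IsUnsignedListing L) (η : ℝ) {s : ℕ}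
    {y : ℝ} (hq : AllQuasirandom hk (2 ^ Nat.log 2 n) s y I) :
    ((2 ^ Nat.log 2 n / s : ℕ) : ℝ) ^ (k - 2) * (3 / 4 * (n * y ^ 4)) ≤
      (certInput L η).slabSize := by
  classical
  set N := 2 ^ Nat.log 2 n with hN
  set a := certInput L η with ha
  have hvert : ∀ (j : Fin L.length) (i : Fin k), a.vert j i = (L.get j i : ℕ) :=
    fun j i => a.vert_eq j i
  let slab : HyperTuple k n → Prop := fun U =>
    ∀ i : Fin (k - 2), (U (i.castLE (Nat.sub_le k 2)) : ℕ) < N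
  have h₁ : a.slabSize = hitCount I (Finset.univ.filter fun z => slab z.2) := by
    rw [← h.card_filter slab, a.slabSize_eq_card]
    congr 1
    refine Finset.filter_congr fun j _ => ?_
    unfold CertInput.InSlab
    constructor
    · intro h₃ i
      have e := hvert j (i.castLE (Nat.sub_le k 2))
      rw [← e]
      exact h₃ i i.2
    · intro h₃ i hi
      have e := hvert j ⟨i, by omega⟩
      simp only at e
      rw [e]
      exact h₃ ⟨i, hi⟩
  have h₂ : ∑ τ : Fin (k - 2) → Fin (N / s),
      hitCount I (blockClass k n N s fun i => τ i) ≤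
        hitCount I (Finset.univ.filter fun z => slab z.2) := by
    unfold hitCount
    rw [← Finset.card_biUnion]
    · refine Finset.card_le_card fun z hz => ?_
      obtain ⟨τ, -, hz⟩ := Finset.mem_biUnion.1 hz
      obtain ⟨hz₁, hz₂⟩ := Finset.mem_filter.1 hz
      have hz₃ : InBlocks N s (fun i => τ i) z.2 := (Finset.mem_filter.1 hz₁).2
      exact Finset.mem_filter.2 ⟨Finset.mem_filter.2 ⟨Finset.mem_univ _, fun i => (hz₃ i).1⟩, hz₂⟩
    · intro τ _ τ' _ hne
      refine Finset.disjoint_left.2 fun z hz hz' => hne (funext fun i => Fin.ext ?_)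
      have e₁ : InBlocks N s (fun i => τ i) z.2 :=
        (Finset.mem_filter.1 (Finset.mem_filter.1 hz).1).2
      have e₂ : InBlocks N s (fun i => τ' i) z.2 :=
        (Finset.mem_filter.1 (Finset.mem_filter.1 hz').1).2
      exact (e₁ i).2.symm.trans (e₂ i).2
  have h₃ : ∀ τ : Fin (k - 2) → Fin (N / s),
      3 / 4 * (n * y ^ 4) ≤ (hitCount I (blockClass k n N s fun i => τ i) : ℝ) := by
    intro τ
    have e₁ := sum_hitCount_rectangle I (blockClass k n N s fun i => τ i)
      (endpoint (k - 2) (by omega)) (endpoint (k - 1) (by omega)) Finset.univ Finset.univ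
    have e₂ : rectangle (blockClass k n N s fun i => τ i) (endpoint (k - 2) (by omega))
        (endpoint (k - 1) (by omega)) Finset.univ Finset.univ =
        blockClass k n N s fun i => τ i := by
      simp [rectangle]
    rw [e₂] at e₁
    rw [← e₁]
    push_cast
    have e₃ := Finset.card_nsmul_le_sum (Finset.univ : Finset (Fin n))
      (fun u => ∑ v : Fin n, (hitCount I (rectangle (blockClass k n N s fun i => τ i)
        (endpoint (k - 2) (by omega)) (endpoint (k - 1) (by omega)) {u} {v}) : ℝ)) (3 / 4 * y ^ 4)
      (fun u _ => by have := abs_le.1 ((hq τ).2.1 u); linarith)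
    rw [Finset.card_univ, Fintype.card_fin, nsmul_eq_mul] at e₃
    linarith
  rw [h₁]
  refine le_trans ?_ (Nat.cast_le.2 h₂)
  push_cast
  have h₄ := Finset.card_nsmul_le_sum (Finset.univ : Finset (Fin (k - 2) → Fin (N / s))) _ _
    fun τ _ => h₃ τ
  rw [nsmul_eq_mul] at h₄
  refine le_trans (le_of_eq ?_) h₄
  simp

/-- For a quasirandom hypergraph, the block length `s` is valid. -/
theorem IsUnsignedListing.valid (hk : 2 ≤ k) (hn : 0 < n) (h : I.IsUnsignedListing L) (η : ℝ)
    {s : ℕ} {y : ℝ} (hsN : s ∣ 2 ^ Nat.log 2 n) (hy : 0 < y) (q : ℕ)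
    (hq : AllQuasirandom hk (2 ^ Nat.log 2 n) s y I)
    (hsmall : n * (16 * (harmonic n : ℝ) / y) ^ (2 ^ (q + 1)) ≤ 1) :
    (certInput L η).Valid (2 ^ (q + 1)) s := by
  have hn' : (0 : ℝ) < n := by exact_mod_cast hn
  have hs : 0 < s := Nat.pos_of_dvd_of_pos hsN (by positivity)
  have hNs : 0 < 2 ^ Nat.log 2 n / s := Nat.div_pos (Nat.le_of_dvd (by positivity) hsN) hs
  constructor
  · have h₁ := h.slabSize_ge hk η hq
    have h₂ : (0 : ℝ) < ((2 ^ Nat.log 2 n / s : ℕ) : ℝ) := by exact_mod_cast hNs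
    have h₃ : (0 : ℝ) < (certInput L η).slabSize := lt_of_lt_of_le (by positivity) h₁
    exact_mod_cast h₃
  · intro j hj hslab
    let τ : Fin (k - 2) → Fin (2 ^ Nat.log 2 n / s) := fun i =>
      ⟨(certInput L η).vert j i / s, by
        rw [Nat.div_lt_iff_lt_mul hs, Nat.div_mul_cancel hsN]
        exact hslab i i.2⟩
    obtain ⟨h₁, h₂, h₃⟩ := hq τ
    have hcount : ∀ u v : Fin n, (certInput L η).endCount s j u v = hitCount I
        (rectangle (blockClass k n (2 ^ Nat.log 2 n) s fun i => τ i) (endpoint (k - 2) (by omega))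
        (endpoint (k - 1) (by omega)) {u} {v}) := fun u v => h.endCount_eq hk η s j u v
    simp only [← hcount] at h₁ h₂ h₃
    have hμ : (n : ℝ) * (y ^ 4 / n) = y ^ 4 := by field_simp
    refine CertInput.expands_of_quasirandom (certInput L η) hn q s j (μ := y ^ 4 / n) (α := y ^ 3)
      (by positivity) h₁ ?_ ?_ ?_
    · change ∀ u : Fin n, |∑ v : Fin n, ((certInput L η).endCount s j u v : ℝ) - n * (y ^ 4 / n)| ≤
        n * (y ^ 4 / n) / 4
      rw [hμ]
      exact h₂
    · change ∀ v : Fin n, |∑ u : Fin n, ((certInput L η).endCount s j u v : ℝ) - n * (y ^ 4 / n)| ≤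
        n * (y ^ 4 / n) / 4
      rw [hμ]
      exact h₃
    · change (n : ℝ) * (16 * y ^ 3 * (harmonic n : ℝ) / (n * (y ^ 4 / n))) ^ (2 ^ (q + 1)) ≤ 1
      rw [hμ]
      refine le_trans (le_of_eq ?_) hsmall
      congr 2
      field_simp

end SignedHypergraph

open MeasureTheory ProbabilityTheory

/-! ## The bound for random hypergraphs -/

namespace SignedHypergraph

variable {k n : ℕ} {I : SignedHypergraph k n} {L : List (HyperTuple k n)}

/-- For a quasirandom hypergraph with at most `2 * m` hyperedges, the number of steps in the second
part of the bound is small. -/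
theorem IsUnsignedListing.budget_div_slabSize_le (hk : 2 ≤ k) (hn : 0 < n)
    (h : I.IsUnsignedListing L) {η m y : ℝ} (hη : 0 ≤ η) (hm : 0 < m) {s : ℕ}
    (hsN : s ∣ 2 ^ Nat.log 2 n)
    (hq : AllQuasirandom hk (2 ^ Nat.log 2 n) s y I)
    (hym : y ^ 4 * n ^ (k - 1) = m * s ^ (k - 2)) (hlen : (hitCount I Finset.univ : ℝ) ≤ 2 * m) :
    ((8 * n * (certInput L η).budget / (certInput L η).slabSize : ℕ) : ℝ) ≤
      2 ^ (k + 3) * (η * n) := by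
  have hn' : (0 : ℝ) < n := by exact_mod_cast hn
  have hs : 0 < s := Nat.pos_of_dvd_of_pos hsN (by positivity)
  have hs' : (0 : ℝ) < s := by exact_mod_cast hs
  obtain ⟨K, rfl⟩ : ∃ K, k = K + 2 := ⟨k - 2, by omega⟩
  simp only [Nat.add_sub_cancel] at *
  rw [show K + 2 - 1 = K + 1 from rfl] at hym
  -- The slab keeps at least half of the vertices, so restricting k-2 coordinates to it costs at
  -- most a factor 2^(k-2).
  have hN : (n : ℝ) ≤ 2 * ((2 ^ Nat.log 2 n : ℕ) : ℝ) := by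
    have := (Nat.lt_pow_succ_log_self (b := 2) (by norm_num) n).le
    rw [pow_succ, mul_comm] at this
    exact_mod_cast this
  have h₁ : 3 / 4 * m ≤ 2 ^ K * ((certInput L η).slabSize : ℝ) := by
    have h₂ := h.slabSize_ge hk η hq
    simp only [Nat.add_sub_cancel] at h₂
    rw [Nat.cast_div hsN hs'.ne'] at h₂
    refine le_trans ?_ (mul_le_mul_of_nonneg_left h₂ (by positivity))
    have h₃ : (n : ℝ) * y ^ 4 = m * s ^ K / n ^ K := by
      rw [eq_div_iff (by positivity), ← hym]
      ring
    have h₄ : (n : ℝ) ^ K ≤ (2 * ((2 ^ Nat.log 2 n : ℕ) : ℝ)) ^ K :=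
      pow_le_pow_left₀ hn'.le hN K
    rw [h₃, div_pow]
    have h₅ : (2 : ℝ) ^ K * (((2 ^ Nat.log 2 n : ℕ) : ℝ) ^ K / s ^ K *
        (3 / 4 * (m * s ^ K / n ^ K))) =
        3 / 4 * m * ((2 * ((2 ^ Nat.log 2 n : ℕ) : ℝ)) ^ K / n ^ K) := by
      rw [mul_pow]
      field_simp
    rw [h₅]
    refine le_mul_of_one_le_right (by positivity) ?_
    rwa [one_le_div (by positivity)]
  have h₂ : (0 : ℝ) < (certInput L η).slabSize := by
    by_contra hcon
    have : (2 : ℝ) ^ K * ((certInput L η).slabSize : ℝ) ≤ 0 :=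
      mul_nonpos_of_nonneg_of_nonpos (by positivity) (not_lt.1 hcon)
    linarith
  have h₃ : ((certInput L η).budget : ℝ) ≤ η * (2 * m) := by
    refine (Nat.floor_le (by positivity)).trans ?_
    rw [h.length_eq]
    exact mul_le_mul_of_nonneg_left hlen hη
  refine Nat.cast_div_le.trans ?_
  rw [div_le_iff₀ h₂]
  push_cast
  calc (8 : ℝ) * n * (certInput L η).budget ≤ 8 * n * (η * (2 * m)) := by gcongr
    _ = 64 / 3 * (η * n) * (3 / 4 * m) := by ring
    _ ≤ 64 / 3 * (η * n) * (2 ^ K * ((certInput L η).slabSize : ℝ)) := by gcongr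
    _ ≤ 32 * (η * n) * (2 ^ K * ((certInput L η).slabSize : ℝ)) := by gcongr; norm_num
    _ = 2 ^ (K + 2 + 3) * (η * n) * ((certInput L η).slabSize : ℝ) := by ring

/-- The bound for a quasirandom hypergraph. -/
theorem IsUnsignedListing.two_pow_exponent_le (hk : 2 ≤ k) (hn : 2 ≤ n)
    (h : I.IsUnsignedListing L) {η m y : ℝ} (hη : 0 ≤ η) (hm : 0 < m) (hy : 0 < y) {s : ℕ}
    (hsN : s ∣ 2 ^ Nat.log 2 n) (q : ℕ)
    (hq : AllQuasirandom hk (2 ^ Nat.log 2 n) s y I)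
    (hsmall : n * (16 * (harmonic n : ℝ) / y) ^ (2 ^ (q + 1)) ≤ 1)
    (hym : y ^ 4 * n ^ (k - 1) = m * s ^ (k - 2)) (hlen : (hitCount I Finset.univ : ℝ) ≤ 2 * m) :
    (2 : ℝ) ^ (certInput L η).exponent (2 ^ (q + 1)) ≤
      2 * (2 * (n : ℝ)) ^ (k - 2) * Real.exp (2 ^ (k + 4) * (η * n * Real.log n)) *
        Real.exp (((k : ℝ) - 2) * ((s : ℝ) - 1)) := by
  have hn' : (0 : ℝ) < n := by positivity
  have hs : 0 < s := Nat.pos_of_dvd_of_pos hsN (by positivity)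
  have hNn : 2 ^ Nat.log 2 n ≤ n := Nat.pow_log_le_self 2 (by omega)
  have hsn : s ≤ n := (Nat.le_of_dvd (by positivity) hsN).trans hNn
  have hle : (certInput L η).exponent (2 ^ (q + 1)) ≤ (certInput L η).bound s :=
    CertInput.Valid.exponent_le_bound hs hsn (h.valid hk (by omega) η hsN hy q hq hsmall)
  have ht := h.budget_div_slabSize_le hk (by omega) hη hm hsN hq hym hlen
  set t : ℕ := 8 * n * (certInput L η).budget / (certInput L η).slabSize with htdef
  have hlog : 0 ≤ Real.log n := Real.log_natCast_nonneg n
  refine (pow_le_pow_right₀ one_le_two hle).trans ?_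
  obtain ⟨K, rfl⟩ : ∃ K, k = K + 2 := ⟨k - 2, by omega⟩
  obtain ⟨r, rfl⟩ : ∃ r, s = r + 1 := ⟨s - 1, by omega⟩
  -- One unit of each block length is moved to the logarithmic term: it turns n^(k-2) into
  -- (2n)^(k-2) and leaves s - 1, which vanishes for blocks of length one.
  have hbound : (certInput L η).bound (r + 1) =
      1 + K * (Nat.log 2 n + 1) + (Nat.log 2 n + 1) * t + K * r := by
    change 1 + K * Nat.log 2 n + K * (r + 1) + t * (Nat.log 2 n + 1) = _
    ring
  have h₁ : (2 : ℝ) ^ (Nat.log 2 n + 1) ≤ 2 * n := by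
    rw [pow_succ, mul_comm]
    exact_mod_cast Nat.mul_le_mul_left 2 hNn
  have h₂ : (2 : ℝ) ^ ((Nat.log 2 n + 1) * t) ≤
      Real.exp (2 ^ (K + 2 + 4) * (η * n * Real.log n)) := by
    have e₁ : (2 : ℝ) * n ≤ Real.exp (2 * Real.log n) := by
      rw [two_mul (Real.log n), Real.exp_add, Real.exp_log hn']
      have : (2 : ℝ) ≤ n := by exact_mod_cast hn
      gcongr
    calc (2 : ℝ) ^ ((Nat.log 2 n + 1) * t) = (2 ^ (Nat.log 2 n + 1)) ^ t := pow_mul _ _ _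
      _ ≤ Real.exp (2 * Real.log n) ^ t := by gcongr; exact h₁.trans e₁
      _ = Real.exp (t * (2 * Real.log n)) := (Real.exp_nat_mul _ _).symm
      _ ≤ Real.exp (2 ^ (K + 2 + 3) * (η * n) * (2 * Real.log n)) := by gcongr
      _ = _ := by congr 1; ring
  have h₃ : (2 : ℝ) ^ (K * r) ≤ Real.exp (((K + 2 : ℕ) - 2 : ℝ) * ((r + 1 : ℕ) - 1 : ℝ)) := by
    have e₁ : (2 : ℝ) ≤ Real.exp 1 := by
      have := Real.add_one_le_exp 1
      linarith
    calc (2 : ℝ) ^ (K * r) ≤ Real.exp 1 ^ (K * r) := by gcongr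
      _ = _ := by
        rw [← Real.exp_nat_mul]
        push_cast
        congr 1
        ring
  rw [hbound, pow_add, pow_add, pow_add, pow_one, mul_comm K, pow_mul, Nat.add_sub_cancel]
  gcongr

/-- A random hypergraph is quasirandom and has few hyperedges. -/
theorem setBernoulli_real_not_good_le (hk : 2 ≤ k) (hn : 0 < n) (p : unitInterval) {m y : ℝ}
    {s : ℕ} (hsN : s ∣ 2 ^ Nat.log 2 n) (hp : (p : ℝ) * (2 ^ k * n ^ k) = m) (hy : 2 ≤ y)
    (hym : y ^ 4 * n ^ (k - 1) = m * s ^ (k - 2)) (hsmall : n * Real.exp (-y / 4) ≤ 1) :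
    (setBernoulli (Set.univ : Set ((Fin k → ℤˣ) × HyperTuple k n)) p).real
      {I | ¬ (AllQuasirandom hk (2 ^ Nat.log 2 n) s y I ∧
        (hitCount I Finset.univ : ℝ) ≤ 2 * m)} ≤
      n ^ (k - 2) * (4 * n * Real.exp (-y ^ 4 / 64) + 8 * n ^ 2 * Real.exp (-y / 2)) +
        2 * Real.exp (-m / 4) := by
  set P := setBernoulli (Set.univ : Set ((Fin k → ℤˣ) × HyperTuple k n)) p
  have hn' : (0 : ℝ) < n := by exact_mod_cast hn
  have hs : 0 < s := Nat.pos_of_dvd_of_pos hsN (by positivity)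
  have hNn : 2 ^ Nat.log 2 n ≤ n := Nat.pow_log_le_self 2 (by omega)
  have hsub : {I | ¬ (AllQuasirandom hk (2 ^ Nat.log 2 n) s y I ∧
      (hitCount I Finset.univ : ℝ) ≤ 2 * m)} ⊆
      (⋃ τ : Fin (k - 2) → Fin (2 ^ Nat.log 2 n / s), {I | ¬ IsQuasirandom n y fun a b =>
        hitCount I (rectangle (blockClass k n (2 ^ Nat.log 2 n) s fun i => τ i)
          (endpoint (k - 2) (by omega)) (endpoint (k - 1) (by omega)) {a} {b})}) ∪
      {I | m ≤ |(hitCount I Finset.univ : ℝ) -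
        p * (Finset.univ : Finset ((Fin k → ℤˣ) × HyperTuple k n)).card|} := by
    intro I hI
    by_cases hq : AllQuasirandom hk (2 ^ Nat.log 2 n) s y I
    · right
      have hI' : ¬ (hitCount I Finset.univ : ℝ) ≤ 2 * m := fun h => hI ⟨hq, h⟩
      have hcard : (p : ℝ) * (Finset.univ : Finset ((Fin k → ℤˣ) × HyperTuple k n)).card = m := by
        rw [← hp]
        simp
      rw [Set.mem_ofPred_eq, hcard]
      refine le_trans ?_ (le_abs_self _)
      linarith
    · left
      unfold AllQuasirandom at hq
      push Not at hq
      obtain ⟨τ, hτ⟩ := hq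
      exact Set.mem_iUnion.2 ⟨τ, hτ⟩
  refine (measureReal_mono hsub).trans ((measureReal_union_le _ _).trans (add_le_add ?_ ?_))
  · refine (measureReal_iUnion_fintype_le _).trans ?_
    have hτ : ∀ τ : Fin (k - 2) → Fin (2 ^ Nat.log 2 n / s), P.real {I | ¬ IsQuasirandom n y
        fun a b => hitCount I (rectangle (blockClass k n (2 ^ Nat.log 2 n) s fun i => τ i)
          (endpoint (k - 2) (by omega)) (endpoint (k - 1) (by omega)) {a} {b})} ≤
        4 * n * Real.exp (-y ^ 4 / 64) + 8 * n ^ 2 * Real.exp (-y / 2) := by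
      intro τ
      refine setBernoulli_real_not_isQuasirandom_le p _ _ _ (w := 2 ^ k * s ^ (k - 2))
        (fun a b => card_rectangle_blockClass hk hNn hs hsN _ (fun i => (τ i).2) a b) hy hn ?_
        hsmall
      rw [eq_div_iff hn'.ne']
      have e₁ : (n : ℝ) ^ k = n ^ (k - 1) * n := by
        rw [← pow_succ]
        congr 1
        omega
      rw [← hp, e₁] at hym
      have e₂ : (0 : ℝ) < n ^ (k - 1) := by positivity
      refine mul_right_cancel₀ e₂.ne' ?_
      rw [hym]
      push_cast
      ring
    refine (Finset.sum_le_card_nsmul _ _ _ fun τ _ => hτ τ).trans ?_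
    rw [nsmul_eq_mul]
    refine mul_le_mul_of_nonneg_right ?_ (by positivity)
    rw [Finset.card_univ, Fintype.card_fun, Fintype.card_fin, Fintype.card_fin]
    push_cast
    refine pow_le_pow_left₀ (Nat.cast_nonneg _) ?_ _
    exact_mod_cast (Nat.div_le_self _ _).trans hNn
  · refine (setBernoulli_real_abs_hitCount_sub_ge p Finset.univ (l := 1 / 2) (by norm_num)
      (by norm_num) m).trans (le_of_eq ?_)
    have hcard : (p : ℝ) * (Finset.univ : Finset ((Fin k → ℤˣ) × HyperTuple k n)).card = m := by
      rw [← hp]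
      simp
    rw [hcard]
    congr 2
    ring

end SignedHypergraph

/-- There is a power of two between `x` and `1 + 2 * x` that divides the largest power of two below
`n`. -/
theorem exists_dvd_two_pow_log {n : ℕ} {x : ℝ} (hx₀ : 0 ≤ x) (hx : 4 * x ≤ n) :
    ∃ s : ℕ, s ∣ 2 ^ Nat.log 2 n ∧ x ≤ s ∧ (s : ℝ) - 1 ≤ 2 * x := by
  -- For x ≤ 1 the length 1 works because s - 1 = 0, even if x is far below 1.
  by_cases h : x ≤ 1
  · exact ⟨1, one_dvd _, by simpa using h, by simpa using hx₀⟩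
  · obtain ⟨σ, h₁, h₂⟩ := exists_nat_pow_near (not_le.1 h).le (one_lt_two : (1 : ℝ) < 2)
    refine ⟨2 ^ (σ + 1), pow_dvd_pow 2 ?_, ?_, ?_⟩
    · refine Nat.le_log_of_pow_le one_lt_two ?_
      have h₃ : (2 : ℝ) ^ (σ + 1) ≤ n := by
        rw [pow_succ]
        linarith
      exact_mod_cast h₃
    · push_cast
      exact h₂.le
    · push_cast
      rw [pow_succ]
      linarith

open MeasureTheory ProbabilityTheory

/-! ## Asymptotics -/

theorem eventually_log_le_rpow {b : ℝ} (hb : 0 < b) :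
    ∀ᶠ n : ℕ in Filter.atTop, 16 * (1 + Real.log n) ≤ (n : ℝ) ^ b := by
  have h₁ := (isLittleO_log_rpow_atTop hb).bound (show (0 : ℝ) < 1 / 32 by norm_num)
  have h₂ := (tendsto_rpow_atTop hb).eventually_ge_atTop 32
  filter_upwards [tendsto_natCast_atTop_atTop.eventually h₁,
    tendsto_natCast_atTop_atTop.eventually h₂] with n hn₁ hn₂
  rw [Real.norm_of_nonneg (Real.rpow_nonneg n.cast_nonneg _), Real.norm_eq_abs] at hn₁
  have := le_abs_self (Real.log n)
  linarith

theorem eventually_four_mul_rpow_le {b : ℝ} (hb : b < 1) :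
    ∀ᶠ n : ℕ in Filter.atTop, 4 * (n : ℝ) ^ b ≤ n := by
  have h₂ := (tendsto_rpow_atTop (sub_pos.2 hb)).eventually_ge_atTop 4
  filter_upwards [tendsto_natCast_atTop_atTop.eventually h₂, Filter.eventually_gt_atTop 0]
    with n hn hn₀
  have hn₀' : (0 : ℝ) < n := by exact_mod_cast hn₀
  calc 4 * (n : ℝ) ^ b ≤ (n : ℝ) ^ (1 - b) * (n : ℝ) ^ b := by gcongr
    _ = n := by rw [← Real.rpow_add hn₀']; simp

/-- The failure probability is small. -/
theorem failure_le {k n : ℕ} (hk : 2 ≤ k) (hn : 0 < n) {w y m : ℝ} (hw : 16 ≤ w) (hwy : w ^ 2 ≤ y)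
    (hwn : 2 * w ^ 2 ≤ m) :
    (n : ℝ) ^ (k - 2) * (4 * n * Real.exp (-y ^ 4 / 64) + 8 * n ^ 2 * Real.exp (-y / 2)) +
      2 * Real.exp (-m / 4) ≤ (n : ℝ) ^ k * Real.exp (-w) := by
  obtain ⟨K, rfl⟩ : ∃ K, k = K + 2 := ⟨k - 2, by omega⟩
  rw [Nat.add_sub_cancel]
  have hn' : (1 : ℝ) ≤ n := by exact_mod_cast hn
  have hy : 4 ≤ y := by nlinarith
  have h₁ : Real.exp (-y ^ 4 / 64) ≤ Real.exp (-w ^ 2 / 2) := by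
    refine Real.exp_le_exp.2 ?_
    have h₂ : 4 ^ 3 * y ≤ y ^ 4 := by
      calc 4 ^ 3 * y ≤ y ^ 3 * y := by gcongr
        _ = y ^ 4 := by ring
    nlinarith
  have h₂ : Real.exp (-y / 2) ≤ Real.exp (-w ^ 2 / 2) := Real.exp_le_exp.2 (by linarith)
  have h₃ : Real.exp (-m / 4) ≤ Real.exp (-w ^ 2 / 2) := Real.exp_le_exp.2 (by linarith)
  have h₄ : 14 * Real.exp (-w ^ 2 / 2) ≤ Real.exp (-w) := by
    have h₅ : (14 : ℝ) ≤ Real.exp 13 := by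
      have := Real.add_one_le_exp (13 : ℝ)
      linarith
    calc 14 * Real.exp (-w ^ 2 / 2) ≤ Real.exp 13 * Real.exp (-w ^ 2 / 2) := by gcongr
      _ = Real.exp (13 + -w ^ 2 / 2) := (Real.exp_add _ _).symm
      _ ≤ Real.exp (-w) := Real.exp_le_exp.2 (by nlinarith)
  have h₅ : (1 : ℝ) ≤ n ^ (K + 2) := one_le_pow₀ hn'
  calc (n : ℝ) ^ K * (4 * n * Real.exp (-y ^ 4 / 64) + 8 * n ^ 2 * Real.exp (-y / 2)) +
      2 * Real.exp (-m / 4)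
      ≤ (n : ℝ) ^ K * (4 * (n * n) * Real.exp (-w ^ 2 / 2) + 8 * n ^ 2 * Real.exp (-w ^ 2 / 2)) +
        2 * (n ^ (K + 2) * Real.exp (-w ^ 2 / 2)) := by
        gcongr
        · exact le_mul_of_one_le_right (by linarith) hn'
        · exact h₃.trans (le_mul_of_one_le_left (Real.exp_pos _).le h₅)
    _ = (n : ℝ) ^ (K + 2) * (14 * Real.exp (-w ^ 2 / 2)) := by ring
    _ ≤ _ := by gcongr

/-- The parameters of the certificate for large `n`. -/
theorem exists_blockLength {k n : ℕ} (hk : 3 ≤ k) {δ ε : ℝ} (hε : 0 < ε) (hε2 : ε ≤ 2)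
    (hδ : 0 < δ) (q : ℕ) (hq : 8 ≤ 2 ^ (q + 1) * ε) (hn : 4 ≤ n)
    (h₁ : 4 * (n : ℝ) ^ (1 - δ / ((k : ℝ) - 2) + ε) ≤ n)
    (h₂ : 16 * (1 + Real.log n) ≤ (n : ℝ) ^ (1 / 8 * ε)) :
    ∃ (s : ℕ) (y : ℝ), s ∣ 2 ^ Nat.log 2 n ∧
      (s : ℝ) - 1 ≤ 2 * (n : ℝ) ^ (1 - δ / ((k : ℝ) - 2) + ε) ∧
      2 ≤ y ∧ y ^ 4 * n ^ (k - 1) = (n : ℝ) ^ (1 + δ) * s ^ (k - 2) ∧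
      n * Real.exp (-y / 4) ≤ 1 ∧
      n * (16 * (harmonic n : ℝ) / y) ^ (2 ^ (q + 1)) ≤ 1 ∧
      (n : ℝ) ^ (k - 2) * (4 * n * Real.exp (-y ^ 4 / 64) + 8 * n ^ 2 * Real.exp (-y / 2)) +
        2 * Real.exp (-(n : ℝ) ^ (1 + δ) / 4) ≤ (n : ℝ) ^ k * Real.exp (-(n : ℝ) ^ (1 / 8 * ε)) := by
  have hn' : (4 : ℝ) ≤ n := by exact_mod_cast hn
  have hn₀ : (0 : ℝ) < n := by linarith
  have hn₁ : (1 : ℝ) ≤ n := by linarith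
  have hlog : 0 ≤ Real.log n := Real.log_natCast_nonneg n
  obtain ⟨s, hs₁, hs₂, hs₃⟩ := exists_dvd_two_pow_log (Real.rpow_nonneg hn₀.le _) h₁
  obtain ⟨K, rfl⟩ : ∃ K, k = K + 2 := ⟨k - 2, by omega⟩
  have hK : (1 : ℝ) ≤ K := by exact_mod_cast (by omega : 1 ≤ K)
  have hK₂ : ((K + 2 : ℕ) : ℝ) - 2 = K := by push_cast; ring
  rw [hK₂] at hs₂ hs₃
  simp only [Nat.add_sub_cancel, hK₂]
  rw [show K + 2 - 1 = K + 1 from rfl]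
  have hs₀ : (0 : ℝ) < s := by exact_mod_cast Nat.pos_of_dvd_of_pos hs₁ (by positivity)
  set w : ℝ := (n : ℝ) ^ (1 / 8 * ε) with hw
  have hw16 : 16 ≤ w := by linarith
  -- This d is the expected number of hyperedges of a class with a given vertex in second to last
  -- position. The block length is chosen to make it at least n^((k-2)ε) ≥ n^ε = w^8, so its fourth
  -- root y is at least w².
  set d : ℝ := (n : ℝ) ^ (1 + δ) * s ^ K / n ^ (K + 1) with hd
  have hd₀ : 0 < d := by positivity
  have hwd : w ^ 8 ≤ d := by
    rw [hd, le_div_iff₀ (by positivity)]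
    have e₁ : w ^ 8 ≤ (n : ℝ) ^ (K * ε) := by
      rw [hw, ← Real.rpow_natCast, ← Real.rpow_mul hn₀.le]
      refine Real.rpow_le_rpow_of_exponent_le hn₁ ?_
      push_cast
      nlinarith
    have e₂ : ((n : ℝ) ^ (1 - δ / K + ε)) ^ K ≤ (s : ℝ) ^ K :=
      pow_le_pow_left₀ (Real.rpow_nonneg hn₀.le _) hs₂ K
    calc w ^ 8 * n ^ (K + 1) ≤ (n : ℝ) ^ (K * ε) * n ^ (K + 1) := by gcongr
      _ = (n : ℝ) ^ (1 + δ) * ((n : ℝ) ^ (1 - δ / K + ε)) ^ K := by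
        rw [← Real.rpow_natCast, ← Real.rpow_natCast, ← Real.rpow_mul hn₀.le,
          ← Real.rpow_add hn₀, ← Real.rpow_add hn₀]
        congr 1
        push_cast
        field_simp
        ring
      _ ≤ (n : ℝ) ^ (1 + δ) * s ^ K := by gcongr
  obtain ⟨y, hy₀, hyd⟩ : ∃ y : ℝ, 0 < y ∧ y ^ 4 = d :=
    ⟨d ^ (1 / 4 : ℝ), by positivity, by
      rw [← Real.rpow_natCast, ← Real.rpow_mul hd₀.le]
      norm_num⟩
  have hwy : w ^ 2 ≤ y := by
    refine le_of_pow_le_pow_left₀ (n := 4) (by norm_num) hy₀.le ?_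
    rw [hyd, ← pow_mul]
    exact hwd
  have hlogw : Real.log n ≤ w := by linarith
  refine ⟨s, y, hs₁, hs₃, by nlinarith, ?_, ?_, ?_, ?_⟩
  · rw [hyd, hd]
    field_simp
  · calc n * Real.exp (-y / 4) = Real.exp (Real.log n) * Real.exp (-y / 4) := by
          rw [Real.exp_log hn₀]
      _ = Real.exp (Real.log n + -y / 4) := (Real.exp_add _ _).symm
      _ ≤ 1 := Real.exp_le_one_iff.2 (by nlinarith)
  · have e₀ : (0 : ℝ) ≤ harmonic n := by
      unfold harmonic
      positivity
    have e₁ : 16 * (harmonic n : ℝ) / y ≤ 1 / w := by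
      rw [div_le_div_iff₀ hy₀ (by linarith)]
      have := harmonic_le_one_add_log n
      calc 16 * (harmonic n : ℝ) * w ≤ 16 * (1 + Real.log n) * w := by gcongr
        _ ≤ w * w := by gcongr
        _ = w ^ 2 := by ring
        _ ≤ 1 * y := by linarith
    -- Here ℓε ≥ 8 enters: the power of w swallows the factor n lost by passing from norm to trace.
    have e₂ : (n : ℝ) ≤ w ^ (2 ^ (q + 1)) := by
      rw [hw, ← Real.rpow_natCast, ← Real.rpow_mul hn₀.le]
      refine Real.self_le_rpow_of_one_le hn₁ ?_
      push_cast
      linarith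
    calc n * (16 * (harmonic n : ℝ) / y) ^ (2 ^ (q + 1))
        ≤ w ^ (2 ^ (q + 1)) * (1 / w) ^ (2 ^ (q + 1)) := by gcongr
      _ = 1 := by
        rw [← mul_pow, mul_one_div_cancel (by linarith), one_pow]
  · refine failure_le (k := K + 2) (n := n) (by omega) (by omega) hw16 hwy ?_
    have e₁ : w ^ 2 ≤ (n : ℝ) ^ (1 / 2 : ℝ) := by
      rw [hw, ← Real.rpow_natCast, ← Real.rpow_mul hn₀.le]
      refine Real.rpow_le_rpow_of_exponent_le hn₁ ?_
      push_cast
      linarith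
    have e₂ : (2 : ℝ) ≤ (n : ℝ) ^ (1 / 2 : ℝ) := by
      rw [← Real.sqrt_eq_rpow]
      exact Real.le_sqrt_of_sq_le (by linarith)
    calc 2 * w ^ 2 ≤ (n : ℝ) ^ (1 / 2 : ℝ) * (n : ℝ) ^ (1 / 2 : ℝ) := by gcongr
      _ = (n : ℝ) ^ (1 : ℝ) := by rw [← Real.rpow_add hn₀]; norm_num
      _ ≤ _ := Real.rpow_le_rpow_of_exponent_le hn₁ (by linarith)

theorem mainTheorem2 (k : ℕ) (hk : 3 ≤ k) (δ : ℝ) (hδ : 0 < δ) (hδk : δ < (k : ℝ) - 1) :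
    ∃ C c : ℝ, 0 < C ∧ 0 < c ∧ ∀ ε : ℝ, 0 < ε →
      ∃ A : CertInput k → ℕ,
        PolyTimeComputable CertInput.encode BinData.ofBinary A ∧
        CertifiesAllSignings A ∧
        ∃ n₀ : ℕ, ∀ n : ℕ, n₀ ≤ n → ∀ η : ℝ, 0 ≤ η → η ≤ 1 →
          1 - (n : ℝ) ^ k * Real.exp (-(n : ℝ) ^ (c * ε)) ≤
            (signedHypergraphLaw k ((n : ℝ) ^ (1 + δ)) n).real
              {I | ∀ L : List (HyperTuple k n), I.IsUnsignedListing L →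
                (A (certInput L η) : ℝ) ≤
                  2 * (2 * (n : ℝ)) ^ (k - 2) *
                    Real.exp (C * (η * n * Real.log n)) *
                    Real.exp (C * (n : ℝ) ^ (1 - δ / ((k : ℝ) - 2) + ε))} := by
  have hk' : (3 : ℝ) ≤ k := by exact_mod_cast hk
  refine ⟨2 ^ (k + 4), 1 / 8, by positivity, by norm_num, fun ε hε => ?_⟩
  -- The power in the trace test depends on ε alone, so the algorithm may depend on ε while C and c
  -- do not.
  obtain ⟨q, hq⟩ : ∃ q : ℕ, 8 ≤ (2 : ℝ) ^ (q + 1) * ε := by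
    obtain ⟨q, hq⟩ := pow_unbounded_of_one_lt (8 / ε) (one_lt_two : (1 : ℝ) < 2)
    refine ⟨q, ?_⟩
    rw [div_lt_iff₀ hε] at hq
    rw [pow_succ]
    linarith
  refine ⟨fun a => 2 ^ a.exponent (2 ^ (q + 1)), CertInput.polyTimeComputable_two_pow_exponent _,
    CertInput.certifiesAllSignings (by omega) q, ?_⟩
  have hCn : (k : ℝ) ≤ 2 ^ k := by exact_mod_cast Nat.lt_two_pow_self.le
  have hC16 : (2 : ℝ) ^ (k + 4) = 16 * 2 ^ k := by ring
  -- If the exponent of n is at least 1, the claim follows from the trivial output bound 2^n.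
  -- Otherwise it is below 1, and block lengths of the required order fit into the slab.
  rcases le_or_gt 1 (1 - δ / ((k : ℝ) - 2) + ε) with ha | ha
  · refine ⟨1, fun n hn η hη₀ _ => ?_⟩
    have hn₁ : (1 : ℝ) ≤ n := by exact_mod_cast hn
    have huniv : {I : SignedHypergraph k n | ∀ L : List (HyperTuple k n), I.IsUnsignedListing L →
        ((2 ^ (certInput L η).exponent (2 ^ (q + 1)) : ℕ) : ℝ) ≤ 2 * (2 * (n : ℝ)) ^ (k - 2) *
          Real.exp (2 ^ (k + 4) * (η * n * Real.log n)) *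
          Real.exp (2 ^ (k + 4) * (n : ℝ) ^ (1 - δ / ((k : ℝ) - 2) + ε))} = Set.univ := by
      refine Set.eq_univ_of_forall fun I L _ => ?_
      have e₁ : (n : ℝ) ≤ (n : ℝ) ^ (1 - δ / ((k : ℝ) - 2) + ε) :=
        Real.self_le_rpow_of_one_le hn₁ ha
      have e₂ : (2 : ℝ) ≤ Real.exp 1 := by
        have := Real.add_one_le_exp 1
        linarith
      have e₃ : (1 : ℝ) ≤ (2 * (n : ℝ)) ^ (k - 2) := one_le_pow₀ (by linarith)
      have e₄ : 1 ≤ Real.exp (2 ^ (k + 4) * (η * n * Real.log n)) :=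
        Real.one_le_exp (by have := Real.log_natCast_nonneg n; positivity)
      have e₅ : (1 : ℝ) ≤ 2 * (2 * (n : ℝ)) ^ (k - 2) *
          Real.exp (2 ^ (k + 4) * (η * n * Real.log n)) :=
        one_le_mul_of_one_le_of_one_le (by linarith) e₄
      refine le_trans ?_ (le_mul_of_one_le_left (Real.exp_pos _).le e₅)
      push_cast
      calc (2 : ℝ) ^ (certInput L η).exponent (2 ^ (q + 1)) ≤ 2 ^ n :=
            pow_le_pow_right₀ one_le_two ((certInput L η).exponent_le_n _)
        _ ≤ Real.exp 1 ^ n := by gcongr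
        _ = Real.exp n := by rw [← Real.exp_nat_mul, mul_one]
        _ ≤ _ := by
          refine Real.exp_le_exp.2 (e₁.trans (le_mul_of_one_le_left (by positivity) ?_))
          linarith
    rw [huniv, signedHypergraphLaw, probReal_univ]
    have : 0 ≤ (n : ℝ) ^ k * Real.exp (-(n : ℝ) ^ (1 / 8 * ε)) := by positivity
    linarith
  · have hε2 : ε ≤ 2 := by
      -- From δ < k - 1 ≤ 2(k - 2), where k ≥ 3 is used.
      have : δ / ((k : ℝ) - 2) ≤ 2 := by
        rw [div_le_iff₀ (by linarith)]
        linarith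
      linarith
    obtain ⟨n₀, hn₀⟩ := Filter.eventually_atTop.1
      ((eventually_four_mul_rpow_le ha).and (eventually_log_le_rpow
        (show 0 < 1 / 8 * ε by positivity)))
    refine ⟨max n₀ 4, fun n hn η hη₀ _ => ?_⟩
    have hn4 : 4 ≤ n := (le_max_right _ _).trans hn
    have hn₁ : (1 : ℝ) ≤ n := by exact_mod_cast (by omega : 1 ≤ n)
    obtain ⟨h₁, h₂⟩ := hn₀ n ((le_max_left _ _).trans hn)
    obtain ⟨s, y, hs₁, hs₂, hy, hym, hexp, hsmall, hfail⟩ :=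
      exists_blockLength hk hε hε2 hδ q hq hn4 h₁ h₂
    -- The inclusion probability is a genuine one because 1 + δ < k, so the projection to the unit
    -- interval is the identity here.
    have hmem : (n : ℝ) ^ (1 + δ) / (2 ^ k * (n : ℝ) ^ k) ∈ Set.Icc (0 : ℝ) 1 := by
      refine ⟨by positivity, ?_⟩
      rw [div_le_one (by positivity)]
      calc (n : ℝ) ^ (1 + δ) ≤ (n : ℝ) ^ (k : ℝ) :=
            Real.rpow_le_rpow_of_exponent_le hn₁ (by linarith)
        _ = (n : ℝ) ^ k := Real.rpow_natCast _ _
        _ ≤ 2 ^ k * (n : ℝ) ^ k :=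
          le_mul_of_one_le_left (by positivity) (one_le_pow₀ one_le_two)
    rw [signedHypergraphLaw, Set.projIcc_of_mem _ hmem]
    set p : unitInterval := ⟨_, hmem⟩
    have hbad := SignedHypergraph.setBernoulli_real_not_good_le (by omega : 2 ≤ k)
      (by omega : 0 < n) p hs₁ (m := (n : ℝ) ^ (1 + δ))
      (div_mul_cancel₀ _ (by positivity)) hy hym hexp
    set P := setBernoulli (Set.univ : Set ((Fin k → ℤˣ) × HyperTuple k n)) p
    set G : Set (SignedHypergraph k n) :=
      {I | SignedHypergraph.AllQuasirandom (by omega : 2 ≤ k) (2 ^ Nat.log 2 n) s y I ∧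
        (hitCount I Finset.univ : ℝ) ≤ 2 * (n : ℝ) ^ (1 + δ)}
    -- Subadditivity suffices, so measurability of the good event plays no role.
    have hG : 1 ≤ P.real G + P.real Gᶜ := by
      rw [← probReal_univ (μ := P), ← Set.union_compl_self G]
      exact measureReal_union_le _ _
    have hGc : P.real Gᶜ ≤ (n : ℝ) ^ k * Real.exp (-(n : ℝ) ^ (1 / 8 * ε)) := hbad.trans hfail
    refine le_trans (by linarith : _ ≤ P.real G) (measureReal_mono ?_)
    rintro I ⟨hI₁, hI₂⟩ L hL
    have h₃ := hL.two_pow_exponent_le (by omega) (by omega) hη₀ (by positivity) (by linarith) hs₁ q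
      hI₁ hsmall hym hI₂
    push_cast
    refine h₃.trans (mul_le_mul_of_nonneg_left (Real.exp_le_exp.2 ?_) (by positivity))
    have h₄ : (0 : ℝ) ≤ (n : ℝ) ^ (1 - δ / ((k : ℝ) - 2) + ε) := by positivity
    calc ((k : ℝ) - 2) * ((s : ℝ) - 1)
        ≤ ((k : ℝ) - 2) * (2 * (n : ℝ) ^ (1 - δ / ((k : ℝ) - 2) + ε)) :=
          mul_le_mul_of_nonneg_left hs₂ (by linarith)
      _ = (2 * ((k : ℝ) - 2)) * (n : ℝ) ^ (1 - δ / ((k : ℝ) - 2) + ε) := by ring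
      _ ≤ _ := mul_le_mul_of_nonneg_right (by linarith) h₄
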